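/- **Notation.** For $\tau$ in the upper half plane $\mathbb H$ write $e(z)=\exp(2\pi i z)$, $q=e(\tau)$, and let $\eta(\tau)=q^{1/24}\prod_{n>0}(1-q^n)$. For a lattice $M$, let $M'\subset M\otimes\mathbb Q$ be its dual, and let $M(n)$ be $M$ with all norms multiplied by $n$. $II_{1,1}(n)$ is $\mathbb Z^2$ with norm $(m_1,m_2)^2=-2nm_1m_2$, and $II_{1,1}=II_{1,1}(1)$. For an even lattice $M$ of signature $(b^+,b^-)$ with $b^+-b^-$ even, a family $F=(f_\gamma)_{\gamma\in M'/M}$ of functions on $\mathbb H$ is a modular form of weight $k\in\mathbb Z$ and representation $\rho_M$ if for all $\gamma\in M'/M$ $$f_\gamma(\tau+1)=e(\gamma^2/2)f_\gamma(\tau),\qquad f_\gamma(-1/\tau)=\frac{\sqrt i^{\,b^--b^+}}{\sqrt{|M'/M|}}\,\tau^k\sum_{\delta\in M'/M}e(-(\gamma,\delta))f_\delta(\tau),\qquad \sqrt i=e(1/8).$$ It is holomorphic on $\mathbb H$ and meromorphic at the cusps if every $f_\gamma$ is holomorphic on $\mathbb H$ and has an expansion in rational powers of $q$ with bounded denominators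 and exponents bounded below. **Proposition.** Let $p$ be a prime such that $m=8/(p+1)$ is an integer (so $p\in\{3,7\}$). Put $$f(\tau)=m\,\frac{(\eta(2p\tau)\eta(2\tau))^m}{(\eta(p\tau)\eta(\tau))^{2m}},\qquad \gamma(\tau)=\frac{(\eta(p\tau/2)\eta(\tau/2))^m}{(\eta(p\tau)\eta(\tau))^{2m}},\qquad \delta=f+\gamma .$$ Then $\delta$ has a Fourier expansion with exponents in $\frac12+\mathbb Z$ only (supersymmetry). Put $$g_j(\tau)=\frac1p\sum_{k=0}^{p-1}e\Big(\!-\frac{jk}{2p}\Big)f\Big(\frac{\tau+k}p\Big)\ (j\text{ even}),\qquad \lambda_j(\tau)=\frac1p\sum_{k=0}^{p-1}e\Big(\!-\frac{jk}{p}\Big)\delta\Big(\frac{\tau+2k}p\Big)\ (j\text{ odd}),\qquad 0\le j<2p.$$ Then $f(\tau/p)=g_0+g_2+\dots+g_{2p-2}$ and $\delta(\tau/p)=\lambda_1+\lambda_3+\dots+\lambda_{2p-1}$, and $g_j$ resp. $\lambda_j$ has a Fourier expansion $\sum_{n\in\mathbb Z}a(n)q^{n+j/2p}$ with $a(n)=0$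 for $n\ll0$. Let $E_8^p$ be the sublattice of $E_8$ fixed by any automorphism of cycle shape $1^mp^m$ (i.e. with characteristic polynomial $(X-1)^m(X^p-1)^m$) and let $$M=E_8^p(-1)\oplus II_{1,1}(2p)\oplus II_{1,1}.$$ Define $F=(f_\gamma)_{\gamma\in M'/M}$, where $\gamma^2/2$ is taken mod $1$, by $$f_\gamma=\begin{cases} f+g_0 & \gamma=0,\\ -f-g_0 & \gamma^2/2=0,\ \gamma\text{ of order }2,\\ \delta+\lambda_p & \gamma^2/2=1/2,\ \gamma\text{ of order }2,\\ \lambda_j & \gamma^2/2=j/2p,\ j\text{ odd},\ \gamma\text{ of order }2p,\\ g_j & \gamma^2/2=j/2p,\ j\text{ even},\ \gamma\text{ of order }p,\\ -g_j & \gamma^2/2=j/2p,\ j\text{ even},\ \gamma\text{ of order }2p.\end{cases}$$ Then $F$ is a modular form of weight $-m$ and representation $\rho_M$ which is holomorphic on $\mathbb H$ and meromorphic at the cusps. The result extends to $p=1$, $m=4$: put $f(\tau)=8\eta(2\tau)^8/\eta(\tau)^{16}$ and $\delta(\tau)=f(\tau)+\eta(\tau/2)^8/\eta(\tau)^{16}$.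 Then $\delta$ has exponents in $\frac12+\mathbb Z$ only, and for $M=E_8(-1)\oplus II_{1,1}(2)\oplus II_{1,1}$ the family $F$ with $f_0=f$, with $f_\gamma=-f$ if $\gamma\ne0$ and $\gamma^2/2=0$ mod $1$, and with $f_\gamma=\delta$ if $\gamma^2/2=1/2$ mod $1$, is a modular form of weight $-4$ and representation $\rho_M$ which is holomorphic on $\mathbb H$ and meromorphic at the cusps. -/

import Mathlib

open scoped Real

noncomputable section

namespace FakeMonster

/-! ### Lattices in rational quadratic spaces -/

section Lattice

variable {V : Type*} [AddCommGroup V] [Module ℚ V]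

/-- The dual `M'` of a lattice `M` inside `M ⊗ ℚ` (realised as the rational span of `M`): the vectors
of the rational span of `M` having integral scalar product with all vectors of `M`. -/
def dualLattice (B : LinearMap.BilinForm ℚ V) (M : Submodule ℤ V) : Submodule ℤ V :=
  B.dualSubmodule M ⊓ (Submodule.span ℚ (M : Set V)).restrictScalars ℤ

/-- The discriminant group `M'/M`. -/
abbrev DiscGroup (B : LinearMap.BilinForm ℚ V) (M : Submodule ℤ V) : Type _ :=
  ↥(dualLattice B M) ⧸ M.submoduleOf (dualLattice B M)

/-- `(γ, δ)` for `γ, δ ∈ M'/M`, computed on representatives; it is well defined modulo `1`. -/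
def discPair (B : LinearMap.BilinForm ℚ V) (M : Submodule ℤ V) (γ δ : DiscGroup B M) : ℚ :=
  B (Quotient.out γ : dualLattice B M) (Quotient.out δ : dualLattice B M)

/-- `γ² / 2` for `γ ∈ M'/M`, computed on a representative; it is well defined modulo `1` when
`M` is even. -/
def discHalfNorm (B : LinearMap.BilinForm ℚ V) (M : Submodule ℤ V) (γ : DiscGroup B M) : ℚ :=
  discPair B M γ γ / 2

/-- The quadratic form `v ↦ (v, v)` on the rational span `M ⊗ ℚ` of `M`. -/
def spanForm (B : LinearMap.BilinForm ℚ V) (M : Submodule ℤ V) :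
    QuadraticForm ℚ (Submodule.span ℚ (M : Set V)) :=
  QuadraticMap.restrict (LinearMap.BilinMap.toQuadraticMap B) (Submodule.span ℚ (M : Set V))

/-- `e(z) = exp(2πiz)`. -/
def e (z : ℂ) : ℂ := Complex.exp (2 * π * Complex.I * z)

/-- A function `F = ∑ F_γ e^γ` on the upper half plane with values in `ℂ[M'/M]` (given by its
components `F γ`) is a modular form of type `ρ_M` and integral weight `k`, in terms of the
generators `T : τ ↦ τ + 1` and `S : τ ↦ -1/τ`. The eighth root of unity `exp(πi/4)` is `√i`, and
`(sigPos, sigNeg) = (b⁺, b⁻)` is the signature of `M`. -/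
structure IsModularFormOfType (B : LinearMap.BilinForm ℚ V) (M : Submodule ℤ V) (k : ℤ)
    (F : DiscGroup B M → ℂ → ℂ) : Prop where
  finite_disc : Finite (DiscGroup B M)
  T_transform : ∀ (γ : DiscGroup B M) (τ : ℂ), 0 < τ.im →
    F γ (τ + 1) = e (discHalfNorm B M γ : ℚ) * F γ τ
  S_transform : ∀ (γ : DiscGroup B M) (τ : ℂ), 0 < τ.im →
    F γ (-1 / τ) =
      Complex.exp (π * Complex.I / 4) ^
          ((sigNeg (spanForm B M) : ℤ) - (sigPos (spanForm B M) : ℤ)) /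
        (Real.sqrt (Nat.card (DiscGroup B M)) : ℂ) * τ ^ k *
        ∑ᶠ δ : DiscGroup B M, e (-(discPair B M γ δ : ℚ)) * F δ τ

end Lattice

/-- `h` has, on the upper half plane, a Fourier expansion `∑ a(n) q^{n + r}`, `n ∈ ℤ`, with only
finitely many negative `n`. -/
def HasExpansionMod (r : ℚ) (h : ℂ → ℂ) : Prop :=
  ∃ (a : ℤ → ℂ) (n₀ : ℤ), (∀ n < n₀, a n = 0) ∧
    ∀ τ : ℂ, 0 < τ.im → HasSum (fun n : ℤ => a n * e (((n : ℂ) + (r : ℂ)) * τ)) (h τ)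

/-- `h` is holomorphic on the upper half plane and meromorphic at the cusp: it has an expansion in
rational powers of `q`, with bounded denominators and with exponents bounded from below. -/
def IsHolomorphicMeromorphicAtCusp (h : ℂ → ℂ) : Prop :=
  DifferentiableOn ℂ h {τ : ℂ | 0 < τ.im} ∧
    ∃ (N : ℕ) (a : ℤ → ℂ) (n₀ : ℤ), 0 < N ∧ (∀ n < n₀, a n = 0) ∧
      ∀ τ : ℂ, 0 < τ.im → HasSum (fun n : ℤ => a n * e ((n : ℂ) / (N : ℂ) * τ)) (h τ)

/-! ### The lattice `E_8^p(-1) ⊕ II_{1,1}(2p) ⊕ II_{1,1}` -/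

/-- `A` is (the matrix of) an automorphism of the lattice `E_8`, i.e. of `ℤ^8` with Gram matrix the
Cartan matrix of type `E_8`. -/
def IsE8Automorphism (A : Matrix (Fin 8) (Fin 8) ℤ) : Prop :=
  A.transpose * CartanMatrix.E₈ * A = CartanMatrix.E₈

/-- `A` has cycle shape `1^m p^m`: its characteristic polynomial is `(X - 1)^m (X^p - 1)^m`. -/
def HasCycleShape (A : Matrix (Fin 8) (Fin 8) ℤ) (p m : ℕ) : Prop :=
  A.charpoly = (Polynomial.X - 1) ^ m * (Polynomial.X ^ p - 1) ^ m

/-- The scalar product of `E_8 ⊗ ℚ`. -/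
def e8Form : LinearMap.BilinForm ℚ (Fin 8 → ℚ) :=
  Matrix.toBilin' (CartanMatrix.E₈.map (fun n : ℤ => (n : ℚ)))

/-- The scalar product of `II_{1,1}(n) ⊗ ℚ`, with norm `(m₁, m₂)² = -2 n m₁ m₂`. -/
def hyperbolicForm (n : ℚ) : LinearMap.BilinForm ℚ (ℚ × ℚ) :=
  LinearMap.mk₂ ℚ (fun x y => -n * (x.1 * y.2 + x.2 * y.1))
    (fun x y z => by simp only [Prod.fst_add, Prod.snd_add]; ring)
    (fun c x y => by simp only [Prod.smul_fst, Prod.smul_snd, smul_eq_mul]; ring)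
    (fun x y z => by simp only [Prod.fst_add, Prod.snd_add]; ring)
    (fun c x y => by simp only [Prod.smul_fst, Prod.smul_snd, smul_eq_mul]; ring)

/-- The rational vector space containing the lattices `E_8^p(-1) ⊕ II_{1,1}(2p) ⊕ II_{1,1}`. -/
abbrev Ambient : Type := (Fin 8 → ℚ) × (ℚ × ℚ) × (ℚ × ℚ)

/-- The scalar product of `(E_8(-1) ⊕ II_{1,1}(2p) ⊕ II_{1,1}) ⊗ ℚ`. -/
def ambientForm (p : ℕ) : LinearMap.BilinForm ℚ Ambient :=
  -e8Form.compl₁₂ (LinearMap.fst ℚ _ _) (LinearMap.fst ℚ _ _)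
  + (hyperbolicForm (2 * p)).compl₁₂
      (LinearMap.fst ℚ _ _ ∘ₗ LinearMap.snd ℚ _ _) (LinearMap.fst ℚ _ _ ∘ₗ LinearMap.snd ℚ _ _)
  + (hyperbolicForm 1).compl₁₂
      (LinearMap.snd ℚ _ _ ∘ₗ LinearMap.snd ℚ _ _) (LinearMap.snd ℚ _ _ ∘ₗ LinearMap.snd ℚ _ _)

/-- The sublattice of `E_8 = ℤ^8` fixed by `A`. -/
def fixedLattice (A : Matrix (Fin 8) (Fin 8) ℤ) : Submodule ℤ (Fin 8 → ℚ) where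
  carrier := {v | ∃ x : Fin 8 → ℤ, A.mulVec x = x ∧ v = fun i => (x i : ℚ)}
  zero_mem' := ⟨0, by simp, by ext; simp⟩
  add_mem' := by
    rintro _ _ ⟨x, hx, rfl⟩ ⟨y, hy, rfl⟩
    exact ⟨x + y, by rw [Matrix.mulVec_add, hx, hy], by ext; simp⟩
  smul_mem' := by
    rintro c _ ⟨x, hx, rfl⟩
    exact ⟨c • x, by rw [Matrix.mulVec_smul, hx], by ext; simp⟩

/-- The lattice `ℤ²` in `ℚ²`. -/
def integerPlane : Submodule ℤ (ℚ × ℚ) where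
  carrier := {v | ∃ a b : ℤ, v = ((a : ℚ), (b : ℚ))}
  zero_mem' := ⟨0, 0, by ext <;> simp⟩
  add_mem' := by
    rintro _ _ ⟨a, b, rfl⟩ ⟨c, d, rfl⟩
    exact ⟨a + c, b + d, by simp⟩
  smul_mem' := by
    rintro c _ ⟨a, b, rfl⟩
    exact ⟨c * a, c * b, by simp⟩

/-- With the scalar product `ambientForm p` this is `M = E_8^p(-1) ⊕ II_{1,1}(2p) ⊕ II_{1,1}`, where
`E_8^p` is the sublattice of `E_8` fixed by `A`. -/
def latticeM (A : Matrix (Fin 8) (Fin 8) ℤ) : Submodule ℤ Ambient :=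
  (fixedLattice A).prod (integerPlane.prod integerPlane)

/-! ### The scalar functions, for `p` prime and `m = 8 / (p + 1)` -/

open ModularForm (eta)

/-- `f(τ) = m (η(2pτ) η(2τ))^m / (η(pτ) η(τ))^{2m}`. -/
def f (p m : ℕ) (τ : ℂ) : ℂ :=
  m * (eta (2 * p * τ) * eta (2 * τ)) ^ m / (eta (p * τ) * eta τ) ^ (2 * m)

/-- `γ(τ) = (η(pτ/2) η(τ/2))^m / (η(pτ) η(τ))^{2m}`. -/
def gam (p m : ℕ) (τ : ℂ) : ℂ :=
  (eta (p * τ / 2) * eta (τ / 2)) ^ m / (eta (p * τ) * eta τ) ^ (2 * m)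

/-- `δ(τ) = f(τ) + γ(τ)`. -/
def delta (p m : ℕ) (τ : ℂ) : ℂ := f p m τ + gam p m τ

/-- For even `j`, the part of `f(τ/p)` with exponents in `j/2p + ℤ`. -/
def g (p m j : ℕ) (τ : ℂ) : ℂ :=
  (∑ k ∈ Finset.range p, e (-(j * k) / (2 * p)) * f p m ((τ + k) / p)) / p

/-- For odd `j`, the part of `δ(τ/p)` with exponents in `j/2p + ℤ`. -/
def lam (p m j : ℕ) (τ : ℂ) : ℂ :=
  (∑ k ∈ Finset.range p, e (-(j * k) / p) * delta p m ((τ + 2 * k) / p)) / p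

/-! ### The vector valued function -/

/-- The residue `j ∈ {0, …, 2p - 1}` with `γ² / 2 = j / 2p` modulo `1` (the lattice has level `2p`,
so that `2p γ² / 2` is an integer). -/
def normIndex (p : ℕ) (A : Matrix (Fin 8) (Fin 8) ℤ)
    (γ : DiscGroup (ambientForm p) (latticeM A)) : ℕ :=
  ⌊2 * p * Int.fract (discHalfNorm (ambientForm p) (latticeM A) γ)⌋₊

open Classical in
/-- The components of `F` for prime `p`. The six cases exhaust `M'/M`; the final value `0` is never
taken. -/
def superF (p m : ℕ) (A : Matrix (Fin 8) (Fin 8) ℤ)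
    (γ : DiscGroup (ambientForm p) (latticeM A)) (τ : ℂ) : ℂ :=
  let j := normIndex p A γ
  if γ = 0 then f p m τ + g p m 0 τ
  else if addOrderOf γ = 2 ∧ j = 0 then -f p m τ - g p m 0 τ
  else if addOrderOf γ = 2 ∧ j = p then delta p m τ + lam p m p τ
  else if addOrderOf γ = 2 * p ∧ Odd j then lam p m j τ
  else if addOrderOf γ = p ∧ Even j then g p m j τ
  else if addOrderOf γ = 2 * p ∧ Even j then -g p m j τ
  else 0

/-! ### The case `p = 1` -/

/-- `8 η(2τ)^8 / η(τ)^16`. -/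
def fOne (τ : ℂ) : ℂ := 8 * eta (2 * τ) ^ 8 / eta τ ^ 16

/-- `8 η(2τ)^8 / η(τ)^16 + η(τ/2)^8 / η(τ)^16`. -/
def deltaOne (τ : ℂ) : ℂ := fOne τ + eta (τ / 2) ^ 8 / eta τ ^ 16

open Classical in
/-- The components of `F` for `p = 1`, on the discriminant group of
`E_8(-1) ⊕ II_{1,1}(2) ⊕ II_{1,1}` (the identity matrix fixes all of `E_8`). This group has three
elements of order `2`, of which two have `γ² / 2 = 0` and one has `γ² / 2 = 1/2` modulo `1`. -/
def superFOne (γ : DiscGroup (ambientForm 1) (latticeM 1)) (τ : ℂ) : ℂ :=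
  if γ = 0 then fOne τ
  else if normIndex 1 1 γ = 0 then -fOne τ
  else deltaOne τ

end FakeMonster

end

/-! ### Eta products: behaviour under translations and the Fricke involution. -/

open scoped Real

noncomputable section

namespace FakeMonster

open ModularForm (eta)

/-! ### The eta product `(η(pτ) η(τ))^m` -/

/-! Write `h(τ) = (η(pτ) η(τ))^m` for `etaProd`. Then `2f = 2^m h(2τ) / h(τ)²` and `γ = h(τ/2) /
h(τ)²`, so everything rests on the weight `m` transformation law of `h` under Γ₀(p) and the Fricke
involution. On the matrices with lower left entry `p` the multipliers are cube roots of unity, times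
the character `(d/7)` when `p = 7`. In the quotients the cube roots cancel: the Fricke involution
and the matrices `(2k, -t; p, -2l)` with `4kl + 1 = pt` exchange `2f` and `γ` up to automorphy
factors of weight `-m` and, for the matrices, the sign `(-l/p)^m` (`twoF_fricke`, `twoF_exchange`,
`gam_exchange`).

Supersymmetry is the vanishing of `Ψ(τ) = 2f(τ) + γ(τ) + γ(τ + 1)`, which amounts to `δ(τ + 1) =
-δ(τ)`. The function `Ψ` is 1-periodic, has weight `-m` under the Fricke involution (and under `(4,
1; 7, 2)` when `p = 7`), and grows more slowly than `q⁻¹`, so it is a holomorphic function of `q` on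
the whole unit disc. These substitutions carry every point above height `1/20`. Hence `|Ψ|² / y^m`
is bounded, `Ψ` tends to zero at `|q| = 1`, and the maximum principle gives `Ψ = 0`
(`susyDefect_eq_zero`).

The group `M'/M` splits as `(ℤ/2)² × D` with `D` its `p`-part, carrying the quadratic character `ε`.
On `(ℤ/2)²` put `X = (f, -f, -f, δ)`. Supersymmetry gives the action of `T` on `X`, and the finite
Fourier transform of `X` is `2Z`, where `Z` is `X` with `2f` and `γ` exchanged. The function `F` is
then `F_(a,b)(τ) = [b = 0] X_a(τ) + (1/p) ∑_k ε(b)^(-2k) X_a((τ + 2k)/p)`, by `superF_eq`. Under `S`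
the isolated term and the term `k = 0` trade places, and the terms `k ≠ 0` are permuted by `k ↦
-1/(4k)`. After completing the square, the comparison with the Weil representation needs only the
Gauss sums `i^m ∑_y ε(y)^(-2l) = √p^(2+m) (-l/p)^m` for `p ∤ l` (`vectorForm_neg_one_div`).

The hyperbolic plane contributes `p` to this sum. The rest comes from the fixed lattice `L` of an
automorphism of which only the cycle shape is known. It has rank `2m`, and `pL' ⊆ L` because `E_8`
is unimodular. For `p = 3`, Minkowski's theorem excludes even unimodular positive definite lattices
of rank 4. This forces `|L'/L| = 9` and an anisotropic discriminant form, whose sum is `-3`. For `p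
= 7`, `L` is a binary lattice of determinant 7; reduction theory yields a generator of `L'/L` of
known norm, and the sum is the classical quadratic Gauss sum. For `p = 1` the group `D` is trivial
and `F = X`. -/

lemma e_add (x y : ℂ) : e (x + y) = e x * e y := by
  simp only [e, mul_add, Complex.exp_add]

lemma e_ne_zero (x : ℂ) : e x ≠ 0 := Complex.exp_ne_zero _

lemma e_neg (x : ℂ) : e (-x) = (e x)⁻¹ := by
  rw [e, e, ← Complex.exp_neg]; ring_nf

lemma e_intCast (n : ℤ) : e n = 1 := by
  rw [e, mul_comm]; exact Complex.exp_int_mul_two_pi_mul_I n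

lemma e_zero : e 0 = 1 := by simp [e]

lemma e_int_mul (n : ℤ) (x : ℂ) : e (n * x) = e x ^ n := by
  rw [e, e, ← Complex.exp_int_mul]; ring_nf

lemma e_nat_mul (n : ℕ) (x : ℂ) : e (n * x) = e x ^ n := by
  exact_mod_cast e_int_mul n x

lemma e_add_intCast (x : ℂ) (n : ℤ) : e (x + n) = e x := by
  rw [e_add, e_intCast, mul_one]

lemma norm_e (z : ℂ) : ‖e z‖ = Real.exp (-(2 * π * z.im)) := by
  rw [e, Complex.norm_exp]; congr 1; simp

lemma eta_add_one (τ : ℂ) : eta (τ + 1) = e (1 / 24) * eta τ := by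
  have h1 : Function.Periodic.qParam 1 (τ + 1) = Function.Periodic.qParam 1 τ := by
    simp only [Function.Periodic.qParam]
    rw [show 2 * π * Complex.I * (τ + 1) / (1 : ℝ) = 2 * π * Complex.I * τ / (1 : ℝ)
      + 2 * π * Complex.I by push_cast; ring, Complex.exp_periodic]
  have h2 : Function.Periodic.qParam 24 (τ + 1) = e (1 / 24) * Function.Periodic.qParam 24 τ := by
    simp only [Function.Periodic.qParam, e]
    rw [← Complex.exp_add]; congr 1; push_cast; ring
  simp only [eta, ModularForm.eta_q, h1, h2, mul_assoc]

lemma eta_neg_one_div {τ : ℂ} (hτ : 0 < τ.im) :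
    eta (-1 / τ) = (Complex.sqrt Complex.I)⁻¹ * (Complex.sqrt τ * eta τ) := by
  simpa using ModularForm.eta_comp_eq_csqrt_I_inv hτ

lemma csqrt_sq (z : ℂ) : Complex.sqrt z ^ 2 = z := by
  rw [Complex.sqrt, ← Complex.cpow_nat_mul]; norm_num

/-- A positive real factor does not change the argument, so the principal branch is multiplicative
here. -/
lemma csqrt_natCast_mul {p : ℕ} (hp : 0 < p) {τ : ℂ} (hτ : τ ≠ 0) :
    Complex.sqrt (p * τ) = (Real.sqrt p : ℂ) * Complex.sqrt τ := by
  have hp' : (0 : ℝ) < p := by exact_mod_cast hp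
  have h := Complex.log_ofReal_mul hp' hτ
  rw [Complex.ofReal_natCast] at h
  rw [sqrt_eq_exp hτ, sqrt_eq_exp (mul_ne_zero (by exact_mod_cast hp.ne') hτ), h,
    add_div, Complex.exp_add, ← Real.exp_log hp', ← Real.exp_half]
  simp

/-- The eta product `(η(pτ) η(τ))^m`. -/
def etaProd (p m : ℕ) (τ : ℂ) : ℂ := (eta (p * τ) * eta τ) ^ m

variable {p m : ℕ}

lemma im_natCast_mul (hp : 0 < p) {τ : ℂ} (hτ : 0 < τ.im) : 0 < (p * τ : ℂ).im := by
  simp; positivity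

lemma etaProd_ne_zero (hp : 0 < p) {τ : ℂ} (hτ : 0 < τ.im) : etaProd p m τ ≠ 0 :=
  pow_ne_zero _ (mul_ne_zero (ModularForm.eta_ne_zero (im_natCast_mul hp hτ))
    (ModularForm.eta_ne_zero hτ))

lemma differentiableAt_etaProd (hp : 0 < p) {τ : ℂ} (hτ : 0 < τ.im) :
    DifferentiableAt ℂ (etaProd p m) τ := by
  have h1 := ModularForm.differentiableAt_eta_of_mem_upperHalfPlaneSet (z := p * τ)
    (im_natCast_mul hp hτ)
  have h2 := ModularForm.differentiableAt_eta_of_mem_upperHalfPlaneSet (z := τ) hτ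
  have h3 : DifferentiableAt ℂ (fun z : ℂ => eta (p * z)) τ :=
    DifferentiableAt.comp (f := fun z : ℂ => p * z) τ h1 (by fun_prop)
  exact (h3.mul h2).pow m

lemma eta_add_natCast (τ : ℂ) (n : ℕ) : eta (τ + n) = e (1 / 24) ^ n * eta τ := by
  induction n with
  | zero => simp
  | succ n ih => rw [Nat.cast_succ, ← add_assoc, eta_add_one, ih]; ring

/-- The two etas contribute `e(1/24)^(p+1)`, and `m (p + 1) = 8` turns its `m`-th power into a cube
root of unity. -/
lemma etaProd_add_one (hpm : m * (p + 1) = 8) (τ : ℂ) :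
    etaProd p m (τ + 1) = e (1 / 3) * etaProd p m τ := by
  rw [etaProd, mul_add, mul_one, eta_add_natCast, eta_add_one, etaProd,
    show e (1 / 24) ^ p * eta (p * τ) * (e (1 / 24) * eta τ)
      = e (1 / 24) ^ (p + 1) * (eta (p * τ) * eta τ) by ring, mul_pow, ← pow_mul,
    mul_comm (p + 1), hpm, ← e_nat_mul]
  norm_num

lemma etaProd_add_intCast (hpm : m * (p + 1) = 8) (τ : ℂ) (n : ℤ) :
    etaProd p m (τ + n) = e (1 / 3) ^ n * etaProd p m τ := by
  induction n using Int.induction_on with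
  | zero => simp
  | succ n ih =>
    rw [Int.cast_add, Int.cast_one, ← add_assoc, etaProd_add_one hpm, ih,
      zpow_add_one₀ (e_ne_zero _)]; ring
  | pred n ih =>
    have := etaProd_add_one hpm (τ + ((-n - 1 : ℤ) : ℂ))
    rw [show τ + ((-n - 1 : ℤ) : ℂ) + 1 = τ + (-n : ℤ) by push_cast; ring, ih] at this
    rw [zpow_sub_one₀ (e_ne_zero _), mul_right_comm, this]
    field_simp [e_ne_zero]

lemma im_neg_one_div {τ : ℂ} (hτ : 0 < τ.im) : 0 < (-1 / τ).im := by
  rw [neg_div, one_div, Complex.neg_im, Complex.inv_im]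
  have : 0 < Complex.normSq τ := Complex.normSq_pos.2 (by rintro rfl; simp at hτ)
  rw [neg_div, neg_neg]; positivity

lemma ne_zero_of_im_pos {τ : ℂ} (hτ : 0 < τ.im) : τ ≠ 0 := by rintro rfl; simp at hτ

/-- The transformation of the eta product under the Fricke involution. -/
lemma etaProd_fricke (hp : 0 < p) {τ : ℂ} (hτ : 0 < τ.im) :
    etaProd p m (-1 / (p * τ)) = (Real.sqrt p * τ / Complex.I) ^ m * etaProd p m τ := by
  have hp' : (p : ℂ) ≠ 0 := by exact_mod_cast hp.ne'
  have h0 := ne_zero_of_im_pos hτ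
  rw [etaProd, show (p : ℂ) * (-1 / (p * τ)) = -1 / τ by field_simp, eta_neg_one_div hτ,
    eta_neg_one_div (im_natCast_mul hp hτ), csqrt_natCast_mul hp h0, etaProd, ← mul_pow]
  congr 1
  have h1 := csqrt_sq τ
  have h2 := csqrt_sq Complex.I
  have h3 : Complex.sqrt Complex.I ≠ 0 := by
    intro h; rw [h] at h2; simp at h2; exact Complex.I_ne_zero h2.symm
  trans Real.sqrt p * Complex.sqrt τ ^ 2 / Complex.sqrt Complex.I ^ 2 * (eta (p * τ) * eta τ)
  · field_simp
  · rw [h1, h2]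

/-- The weight `m` transformation law of the eta product under a substitution, with factor `X`. -/
def EtaProdTransforms (p m : ℕ) (a b c d : ℤ) (X : ℂ) : Prop :=
  ∀ τ : ℂ, 0 < τ.im →
    etaProd p m ((a * τ + b) / (c * τ + d)) = X * (c * τ + d) ^ m * etaProd p m τ

/-- Multiplication by `T^i` on the left and `T^j` on the right keeps the lower left entry `c`, and
each translation costs a factor `e(1/3)`. One matrix therefore determines the multiplier on its
whole double coset of translations. -/
lemma EtaProdTransforms.shift (hpm : m * (p + 1) = 8) {a b c d : ℤ} {X : ℂ}
    (h : EtaProdTransforms p m a b c d X) (hdet : a * d - b * c = 1) (i j a' b' d' : ℤ)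
    (ha : a' = a + i * c) (hb : b' = b + i * d + j * (a + i * c)) (hd : d' = d + j * c) :
    EtaProdTransforms p m a' b' c d' (X * e (1 / 3) ^ (i + j)) := by
  intro τ hτ
  have hτ' : 0 < (τ + j).im := by simpa using hτ
  have hne : (c : ℂ) * (τ + j) + d ≠ 0 := by
    intro h0
    have h1 := congrArg Complex.im h0
    have h2 := congrArg Complex.re h0
    simp at h1 h2
    rcases h1 with h1 | h1
    · simp [h1] at h2; simp [h1, h2] at hdet
    · exact hτ.ne' h1
  have h1 := h (τ + j) hτ'
  rw [etaProd_add_intCast hpm] at h1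
  have h2 := etaProd_add_intCast hpm ((a * (τ + j) + b) / (c * (τ + j) + d)) i
  rw [h1] at h2
  rw [zpow_add₀ (e_ne_zero _), show (c : ℂ) * τ + d' = c * (τ + j) + d by rw [hd]; push_cast; ring]
  rw [show X * (e (1 / 3) ^ i * e (1 / 3) ^ j) * (c * (τ + j) + d) ^ m * etaProd p m τ =
    e (1 / 3) ^ i * (X * (c * (τ + j) + d) ^ m * (e (1 / 3) ^ j * etaProd p m τ)) by ring, ← h2]
  congr 1
  rw [eq_comm, div_add' _ _ _ hne, ha, hb]
  push_cast
  ring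

lemma natCast_mul_add_intCast_ne_zero (hp : 0 < p) {τ : ℂ} (hτ : 0 < τ.im) (d : ℤ) :
    (p : ℂ) * τ + d ≠ 0 := by
  apply ne_zero_of_im_pos
  simp; positivity

/-- This matrix is `T⁻¹` conjugated by the Fricke involution. -/
lemma etaProdTransforms_one (hp : 0 < p) (hpm : m * (p + 1) = 8) :
    EtaProdTransforms p m 1 0 p 1 (e (1 / 3))⁻¹ := by
  intro τ hτ
  have hp' : (p : ℂ) ≠ 0 := by exact_mod_cast hp.ne'
  have h0 := ne_zero_of_im_pos hτ
  have h1 := natCast_mul_add_intCast_ne_zero hp hτ 1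
  have hu := etaProd_fricke (m := m) hp (τ := -1 / (p * τ) + (-1 : ℤ)) (by
    simpa using im_neg_one_div (im_natCast_mul hp hτ))
  rw [etaProd_add_intCast hpm, etaProd_fricke hp hτ] at hu
  push_cast at *
  rw [show (1 * τ + 0) / (p * τ + 1) = -1 / (p * (-1 / (p * τ) + -1)) by
    rw [show (p : ℂ) * (-1 / (p * τ) + -1) = - (p * τ + 1) / τ by field_simp; ring]
    field_simp; ring, hu, zpow_neg_one]
  have : (Real.sqrt p : ℂ) ^ 2 = p := by
    rw [← Complex.ofReal_pow, Real.sq_sqrt (by positivity)]; simp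
  rw [show (p : ℂ) * τ + 1 = (Real.sqrt p * (-1 / (p * τ) + -1) / Complex.I) *
    (Real.sqrt p * τ / Complex.I) by
      rw [div_mul_div_comm, Complex.I_mul_I]; field_simp; rw [this]; ring, mul_pow]
  ring

/-- Here `T` is conjugated by the Fricke involution. The automorphy factors multiply to `-(pτ - 1)`,
whence the sign `(-1)^m`. -/
lemma etaProdTransforms_neg_one (hp : 0 < p) (hpm : m * (p + 1) = 8) :
    EtaProdTransforms p m (-1) 0 p (-1) ((-1) ^ m * e (1 / 3)) := by
  intro τ hτ
  have hp' : (p : ℂ) ≠ 0 := by exact_mod_cast hp.ne'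
  have h0 := ne_zero_of_im_pos hτ
  have h1 := natCast_mul_add_intCast_ne_zero hp hτ (-1)
  have hu := etaProd_fricke (m := m) hp (τ := -1 / (p * τ) + (1 : ℤ)) (by
    simpa using im_neg_one_div (im_natCast_mul hp hτ))
  rw [etaProd_add_intCast hpm, etaProd_fricke hp hτ] at hu
  push_cast at *
  rw [show (-1 * τ + 0) / (p * τ + -1) = -1 / (p * (-1 / (p * τ) + 1)) by
    rw [show (p : ℂ) * (-1 / (p * τ) + 1) = (p * τ + -1) / τ by field_simp; ring]
    field_simp; ring, hu, zpow_one]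
  have : (Real.sqrt p : ℂ) ^ 2 = p := by
    rw [← Complex.ofReal_pow, Real.sq_sqrt (by positivity)]; simp
  rw [show (p : ℂ) * τ + -1 = -1 * ((Real.sqrt p * (-1 / (p * τ) + 1) / Complex.I) *
    (Real.sqrt p * τ / Complex.I)) by
      rw [div_mul_div_comm, Complex.I_mul_I]; field_simp; rw [this]; ring, mul_pow, mul_pow]
  have h4 : ((-1 : ℂ) ^ m) * (-1) ^ m = 1 := by rw [← mul_pow]; simp
  linear_combination (e (1 / 3) * (√p * (-1 / (p * τ) + 1) / Complex.I) ^ m * (√p * τ / Complex.I) ^ m * etaProd p m τ) * (-h4)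


/-! ### Existence of a multiplier on Γ₀(p). -/

open ModularForm UpperHalfPlane in
lemma eta_pow_comp {a b c d : ℤ} (hdet : a * d - b * c = 1) {τ : ℂ} (hτ : 0 < τ.im) :
    eta ((a * τ + b) / (c * τ + d)) ^ 24 = (c * τ + d) ^ 12 * eta τ ^ 24 := by
  let A : Matrix.SpecialLinearGroup (Fin 2) ℤ := ⟨!![a, b; c, d], by
    rw [Matrix.det_fin_two_of]; exact hdet⟩
  have h := congrFun (SlashInvariantForm.slash_action_generators_SL2Z discriminant_S_invariant
    discriminant_T_invariant A) ⟨τ, hτ⟩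
  rw [SL_slash_apply, discriminant, discriminant] at h
  have h1 : denom A (⟨τ, hτ⟩ : ℍ) ≠ 0 := denom_ne_zero _ _
  have h2 : denom A (⟨τ, hτ⟩ : ℍ) = c * τ + d := by
    rw [ModularGroup.denom_apply]; simp [A]
  have h3 : ((A • (⟨τ, hτ⟩ : ℍ) : ℍ) : ℂ) = (a * τ + b) / (c * τ + d) := by
    rw [specialLinearGroup_apply]; simp [A]
  rw [h2] at h1
  rw [h3, h2] at h
  rw [zpow_neg, show (12 : ℤ) = ((12 : ℕ) : ℤ) from rfl, zpow_natCast] at h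
  have h4 : (η τ) ^ 24 = η ((a * τ + b) / (c * τ + d)) ^ 24 * ((c * τ + d) ^ 12)⁻¹ := h.symm
  rw [h4, mul_left_comm, mul_inv_cancel₀ (pow_ne_zero 12 h1), mul_one]

lemma im_moebius_pos {a b c d : ℤ} (hdet : a * d - b * c = 1) {τ : ℂ} (hτ : 0 < τ.im) :
    c * τ + d ≠ (0 : ℂ) ∧ 0 < ((a * τ + b) / (c * τ + d)).im := by
  have hne : (c : ℂ) * τ + d ≠ 0 := by
    intro h0
    have h1 := congrArg Complex.im h0
    have h2 := congrArg Complex.re h0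
    simp at h1 h2
    rcases h1 with h1 | h1
    · simp [h1] at h2; simp [h1, h2] at hdet
    · exact hτ.ne' h1
  refine ⟨hne, ?_⟩
  have h3 : 0 < Complex.normSq (c * τ + d) := Complex.normSq_pos.2 hne
  have hdet' : (a : ℝ) * d - b * c = 1 := by exact_mod_cast hdet
  rw [Complex.div_im, ← sub_div]
  apply div_pos _ h3
  simp
  nlinarith

/-- The modularity of `η^24 = Δ`, used at `τ` and at `pτ` (where `p ∣ c` keeps the conjugated matrix
integral), makes the quotient of the two sides a 24th root of unity. A continuous function with
values in a finite set is constant on the connected half plane. -/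
lemma exists_etaProdTransforms (hp : 0 < p) {a b c c' d : ℤ} (hc : c = p * c')
    (hdet : a * d - b * c = 1) : ∃ X, EtaProdTransforms p m a b c d X := by
  have hp' : (p : ℂ) ≠ 0 := by exact_mod_cast hp.ne'
  set H : Set ℂ := {τ : ℂ | 0 < τ.im}
  let r : ℂ → ℂ := fun τ => etaProd p m ((a * τ + b) / (c * τ + d)) /
    ((c * τ + d) ^ m * etaProd p m τ)
  have hr : ContinuousOn r H := by
    intro τ hτ
    obtain ⟨h1, h2⟩ := im_moebius_pos hdet hτ
    apply ContinuousAt.continuousWithinAt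
    apply ContinuousAt.div
    · exact ContinuousAt.comp (f := fun τ : ℂ => (a * τ + b) / (c * τ + d))
        (differentiableAt_etaProd hp h2).continuousAt (by fun_prop (disch := assumption))
    · exact ContinuousAt.mul (by fun_prop) (differentiableAt_etaProd hp hτ).continuousAt
    · exact mul_ne_zero (pow_ne_zero _ h1) (etaProd_ne_zero hp hτ)
  have hr24 : ∀ τ ∈ H, r τ ∈ {z : ℂ | z ^ 24 = 1} := by
    intro τ hτ
    obtain ⟨h1, h2⟩ := im_moebius_pos hdet hτ
    have hpτ := im_natCast_mul hp hτ
    have h3 := eta_pow_comp hdet hτ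
    have h4 := eta_pow_comp (a := a) (b := p * b) (c := c') (d := d)
      (by rw [← hdet, hc]; ring) hpτ
    have h5 : etaProd p m ((a * τ + b) / (c * τ + d)) ^ 24 =
        ((c * τ + d) ^ m * etaProd p m τ) ^ 24 := by
      rw [etaProd, etaProd, ← mul_pow, ← pow_mul, ← pow_mul, mul_comm m, pow_mul, pow_mul,
        mul_pow, mul_pow, mul_pow, h3,
        show (p : ℂ) * ((a * τ + b) / (c * τ + d)) =
          (a * (p * τ) + (p * b : ℤ)) / (c' * (p * τ) + d) by
            rw [hc]; push_cast
            rw [show (c' : ℂ) * (p * τ) + d = p * c' * τ + d by ring]; ring, h4,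
        show (c' : ℂ) * (p * τ) + d = c * τ + d by rw [hc]; push_cast; ring]
      generalize (c : ℂ) * τ + d = x
      rw [← mul_pow, ← mul_pow]
      congr 1
      ring
    show r τ ^ 24 = 1
    rw [div_pow, h5, div_self]
    exact pow_ne_zero _ (mul_ne_zero (pow_ne_zero _ h1) (etaProd_ne_zero hp hτ))
  have hfin : {z : ℂ | z ^ 24 = 1}.Finite := by
    apply ((Polynomial.nthRoots 24 (1 : ℂ)).toFinset.finite_toSet).subset
    intro z hz
    simpa [Polynomial.mem_nthRoots] using hz
  have hI : Complex.I ∈ H := by simp [H]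
  refine ⟨r Complex.I, fun τ hτ => ?_⟩
  rw [← (Convex.isPreconnected (convex_halfSpace_im_gt 0)).constant_of_mapsTo
    hfin.isDiscrete hr hr24 hτ hI, mul_assoc, div_mul_cancel₀]
  exact mul_ne_zero (pow_ne_zero _ (im_moebius_pos hdet hτ).1) (etaProd_ne_zero hp hτ)

lemma EtaProdTransforms.comp {a b c d a' b' c' d' : ℤ} {X Y : ℂ}
    (h : EtaProdTransforms p m a b c d X) (h' : EtaProdTransforms p m a' b' c' d' Y)
    (hdet : a' * d' - b' * c' = 1) {A B C D : ℤ} (hA : A = a * a' + b * c')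
    (hB : B = a * b' + b * d') (hC : C = c * a' + d * c') (hD : D = c * b' + d * d') :
    EtaProdTransforms p m A B C D (X * Y) := by
  intro τ hτ
  obtain ⟨h1, h2⟩ := im_moebius_pos hdet hτ
  have h3 := h _ h2
  rw [h' τ hτ] at h3
  have e1 : (C : ℂ) * τ + D = (c * ((a' * τ + b') / (c' * τ + d')) + d) * (c' * τ + d') := by
    rw [hC, hD]; push_cast; field_simp; ring
  have e2 : (A : ℂ) * τ + B = (a * ((a' * τ + b') / (c' * τ + d')) + b) * (c' * τ + d') := by
    rw [hA, hB]; push_cast; field_simp; ring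
  rw [e2, e1, mul_div_mul_right _ _ h1, h3, mul_pow]
  ring

/-! ### The explicit multipliers for `p = 7` and `p = 3`. -/

lemma omega_sq_add : e (1 / 3) ^ 2 + e (1 / 3) + 1 = 0 := by
  have h : (e (1 / 3)).re = -1 / 2 ∧ (e (1 / 3)).im = √3 / 2 := by
    have : (2 * π * Complex.I * (1 / 3) : ℂ) = ((π - π / 3 : ℝ) : ℂ) * Complex.I := by
      push_cast; ring
    rw [e, this, Complex.exp_ofReal_mul_I_re, Complex.exp_ofReal_mul_I_im, Real.cos_pi_sub,
      Real.sin_pi_sub, Real.cos_pi_div_three, Real.sin_pi_div_three]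
    norm_num
  have h3 : √3 ^ 2 = 3 := Real.sq_sqrt (by norm_num)
  apply Complex.ext
  · rw [Complex.add_re, Complex.add_re, pow_two, Complex.mul_re, h.1, h.2]; norm_num; nlinarith
  · rw [Complex.add_im, Complex.add_im, pow_two, Complex.mul_im, h.1, h.2]; norm_num; ring

lemma omega_im_pos : 0 < (e (1 / 3)).im := by
  have : (2 * π * Complex.I * (1 / 3) : ℂ) = ((2 * π / 3 : ℝ) : ℂ) * Complex.I := by
    push_cast; ring
  rw [e, this, Complex.exp_ofReal_mul_I_im]
  exact Real.sin_pos_of_pos_of_lt_pi (by positivity) (by linarith [Real.pi_pos])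

lemma omega_pow_three : e (1 / 3) ^ 3 = 1 := by
  linear_combination (e (1 / 3) - 1) * omega_sq_add

lemma omega_zpow_add_three_mul (n k : ℤ) : e (1 / 3) ^ (n + 3 * k) = e (1 / 3) ^ n := by
  rw [zpow_add₀ (e_ne_zero _), zpow_mul]
  norm_cast
  rw [omega_pow_three]; simp

/-- An elliptic transformation acts by the inverse of its eigenvalue at the fixed point. -/
lemma etaProdTransforms_elliptic {a b d : ℤ} (hdet : a * d - b * 7 = 1) {u : ℂ}
    (hu : u ^ 2 - (a + d) * u + 1 = 0) (hu' : 0 < u.im) :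
    EtaProdTransforms 7 1 a b 7 d u⁻¹ := by
  obtain ⟨X, hX⟩ := exists_etaProdTransforms (p := 7) (m := 1) (by norm_num) (c' := 1) (by simp) hdet
  have hu0 := ne_zero_of_im_pos hu'
  have hz : 0 < ((u - d) / 7).im := by
    rw [show (u - d) / 7 = ((1 / 7 : ℝ) : ℂ) * (u - d) by push_cast; ring, Complex.im_ofReal_mul]
    simp; positivity
  have h := hX _ hz
  have hdet' : (a : ℂ) * d - b * 7 = 1 := by exact_mod_cast hdet
  have h1 : ((7 : ℤ) : ℂ) * ((u - d) / 7) + d = u := by push_cast; ring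
  have h2 : (a * ((u - d) / 7) + b) / u = (u - d) / 7 := by
    field_simp; linear_combination -hu - hdet'
  rw [h1, h2, pow_one] at h
  have h3 : X * u = 1 := by
    have := etaProd_ne_zero (p := 7) (m := 1) (by norm_num) hz
    apply mul_right_cancel₀ this
    rw [← h, one_mul]
  rwa [← eq_inv_of_mul_eq_one_left h3]

/-- Translations reduce the claim to one matrix for each residue of `d` mod 7. The residues `±1`
come from Fricke conjugates of `T⁻¹` and `T`. The other four have elliptic representatives of trace
`-1` or `1`, with eigenvalue `ω` or `-ω²` for `ω = e(1/3)`. -/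
lemma etaProdTransforms_seven {a b d : ℤ} (hdet : a * d - b * 7 = 1) :
    EtaProdTransforms 7 1 a b 7 d (jacobiSym d 7 * e (1 / 3) ^ (a + d)) := by
  have h3 := omega_pow_three
  have hω := e_ne_zero (1 / 3)
  have hjac : ∀ x : ℤ, jacobiSym x 7 = jacobiSym (x % 7) 7 := fun x => jacobiSym.mod_left x 7
  have key : ∀ (s : ℂ) (a₀ b₀ d₀ : ℤ), a₀ * d₀ - b₀ * 7 = 1 → a % 7 = a₀ % 7 → d % 7 = d₀ % 7 →
      (jacobiSym d₀ 7 : ℂ) = s →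
      EtaProdTransforms 7 1 a₀ b₀ 7 d₀ (s * e (1 / 3) ^ (a₀ + d₀)) →
      EtaProdTransforms 7 1 a b 7 d (jacobiSym d 7 * e (1 / 3) ^ (a + d)) := by
    intro s a₀ b₀ d₀ hdet₀ ha hd hs h
    obtain ⟨i, rfl⟩ : ∃ i, a = a₀ + i * 7 := ⟨(a - a₀) / 7, by omega⟩
    obtain ⟨j, rfl⟩ : ∃ j, d = d₀ + j * 7 := ⟨(d - d₀) / 7, by omega⟩
    have hb : b = b₀ + i * d₀ + j * (a₀ + i * 7) := by
      have : 7 * b = 7 * (b₀ + i * d₀ + j * (a₀ + i * 7)) := by linear_combination hdet₀ - hdet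
      omega
    have h5 := h.shift (by norm_num) hdet₀ i j _ b _ rfl hb rfl
    rw [mul_assoc, ← zpow_add₀ hω] at h5
    -- As `7 ≡ 1` mod 3, the exponent `a + d` changes under the shift by `i + j` mod 3, exactly as
    -- the multiplier does.
    rwa [hjac, hd, ← hjac, hs,
      show a₀ + i * 7 + (d₀ + j * 7) = a₀ + d₀ + (i + j) + 3 * (2 * (i + j)) by ring,
      omega_zpow_add_three_mul]
  have hquad := omega_sq_add
  have hquad' : (-e (1 / 3) ^ 2) ^ 2 - (-e (1 / 3) ^ 2) + 1 = 0 := by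
    linear_combination (e (1 / 3) ^ 2 - e (1 / 3) + 1) * hquad
  have him : 0 < (-e (1 / 3) ^ 2).im := by
    rw [show -e (1 / 3) ^ 2 = 1 + e (1 / 3) by linear_combination -hquad, Complex.add_im,
      Complex.one_im, zero_add]
    exact omega_im_pos
  have hi1 : (e (1 / 3))⁻¹ = e (1 / 3) ^ 2 := by
    exact inv_eq_of_mul_eq_one_right (by linear_combination h3)
  have hi2 : (-e (1 / 3) ^ 2)⁻¹ = -e (1 / 3) := by
    exact inv_eq_of_mul_eq_one_right (by linear_combination h3)
  have hmod : (a % 7) * (d % 7) % 7 = 1 := by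
    rw [← Int.mul_emod, show a * d = 1 + b * 7 by linarith]; omega
  have hd0 := Int.emod_nonneg d (show (7 : ℤ) ≠ 0 by norm_num)
  have hd7 := Int.emod_lt_of_pos d (show (0 : ℤ) < 7 by norm_num)
  generalize hd : d % 7 = d₁ at *
  interval_cases d₁
  · omega
  · refine key 1 1 0 1 (by norm_num) (by omega) (by omega) (by norm_num) ?_
    have h := etaProdTransforms_one (p := 7) (m := 1) (by norm_num) (by norm_num)
    rw [hi1] at h
    simpa using h
  · refine key 1 (-3) (-1) 2 (by norm_num) (by omega) (by omega) (by norm_num) ?_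
    convert etaProdTransforms_elliptic (a := -3) (b := -1) (d := 2) (by norm_num) (u := e (1 / 3))
      (by push_cast; linear_combination hquad) omega_im_pos using 1
    norm_num
  · refine key (-1) (-2) (-1) 3 (by norm_num) (by omega) (by omega) (by norm_num) ?_
    convert etaProdTransforms_elliptic (a := -2) (b := -1) (d := 3) (by norm_num)
      (u := -e (1 / 3) ^ 2) (by push_cast; linear_combination hquad') him using 1
    rw [hi2]; norm_num
  · refine key 1 2 (-1) (-3) (by norm_num) (by omega) (by omega) (by norm_num) ?_
    convert etaProdTransforms_elliptic (a := 2) (b := -1) (d := -3) (by norm_num) (u := e (1 / 3))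
      (by push_cast; linear_combination hquad) omega_im_pos using 1
    norm_num
  · refine key (-1) 3 (-1) (-2) (by norm_num) (by omega) (by omega) (by norm_num) ?_
    convert etaProdTransforms_elliptic (a := 3) (b := -1) (d := -2) (by norm_num)
      (u := -e (1 / 3) ^ 2) (by push_cast; linear_combination hquad') him using 1
    rw [hi2]; norm_num
  · refine key (-1) (-1) 0 (-1) (by norm_num) (by omega) (by omega) (by norm_num) ?_
    rw [show (-1 : ℤ) + -1 = 1 + 3 * (-1) by norm_num, omega_zpow_add_three_mul]
    simpa using etaProdTransforms_neg_one (p := 7) (m := 1) (by norm_num) (by norm_num)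

/-- The determinant forces `a ≡ d ≡ ±1` mod 3, so translations reduce everything to the conjugates
of `T⁻¹` and `T`; the sign `(-1)^m` is trivial since `m = 2`. -/
lemma etaProdTransforms_three {a b d s : ℤ} (hs : s = 1 ∨ s = -1) (i j : ℤ) (ha : a = s + i * 3)
    (hd : d = s + j * 3) (hdet : a * d - b * 3 = 1) :
    EtaProdTransforms 3 2 a b 3 d (e (1 / 3) ^ (i + j - s)) := by
  have hω := e_ne_zero (1 / 3)
  have h : EtaProdTransforms 3 2 s 0 3 s (e (1 / 3) ^ (-s)) := by
    rcases hs with rfl | rfl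
    · simpa using etaProdTransforms_one (p := 3) (m := 2) (by norm_num) (by norm_num)
    · simpa using etaProdTransforms_neg_one (p := 3) (m := 2) (by norm_num) (by norm_num)
  have hss : s * s = 1 := by rcases hs with rfl | rfl <;> rfl
  have hb : b = 0 + i * s + j * (s + i * 3) := by
    have : 3 * b = 3 * (0 + i * s + j * (s + i * 3)) := by
      rw [ha, hd] at hdet; linear_combination hss - hdet
    omega
  have h5 := h.shift (by norm_num) (by linarith) i j a b d ha hb hd
  rwa [← zpow_add₀ hω, show -s + (i + j) = i + j - s by ring] at h5

/-- The sign `(-l / p)^m`. -/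
def residueSign (p m : ℕ) (l : ℤ) : ℂ := (jacobiSym (-l) p : ℂ) ^ m

/-- The first matrix acts on `w`; the second acts on `w/2` and produces twice the image of `w`. In
`h(2τ) / h(τ)²` only the second multiplier divided by the square of the first matters. In it the
cube roots of unity cancel and a residue symbol remains. -/
lemma exists_etaProdTransforms_pair (hp : p.Prime) (hpm : m * (p + 1) = 8) {k l t : ℤ}
    (h : 4 * k * l + 1 = p * t) :
    ∃ X, X ≠ 0 ∧ EtaProdTransforms p m (2 * k) (-t) p (-(2 * l)) X ∧
      EtaProdTransforms p m (4 * k) (-t) p (-l) (residueSign p m l * X ^ 2) := by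
  have hp7 : p ≤ 7 := by nlinarith [Nat.pos_of_ne_zero (show m ≠ 0 by rintro rfl; omega)]
  have hω := e_ne_zero (1 / 3)
  have h2 := hp.two_le
  have hm8 : m ≤ 8 := by nlinarith
  interval_cases p <;> try omega
  · obtain rfl : m = 2 := by omega
    obtain ⟨s, hs, y, rfl⟩ : ∃ s : ℤ, (s = 1 ∨ s = -1) ∧ ∃ y, l = s + y * 3 := by
      rcases (by omega : l % 3 = 0 ∨ l % 3 = 1 ∨ l % 3 = 2) with h0 | h0 | h0
      · obtain ⟨y, rfl⟩ := Int.dvd_of_emod_eq_zero h0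
        exfalso
        have : 3 * (4 * k * y) + 1 = 3 * t := by push_cast at h; linarith
        omega
      · exact ⟨1, Or.inl rfl, l / 3, by omega⟩
      · exact ⟨-1, Or.inr rfl, l / 3 + 1, by omega⟩
    obtain ⟨x, rfl⟩ : ∃ x, k = -s + x * 3 := by
      push_cast at h
      have : 4 * k * s + 12 * (k * y) + 1 = 3 * t := by linear_combination h
      rcases hs with rfl | rfl
      · exact ⟨(k + 1) / 3, by omega⟩
      · exact ⟨(k - 1) / 3, by omega⟩
    push_cast at h ⊢
    have hsign : residueSign 3 2 (s + y * 3) = 1 := by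
      have h1 : IsCoprime (-(s + y * 3)) ((3 : ℕ) : ℤ) :=
        ⟨4 * (-s + x * 3), t, by push_cast; linear_combination -h⟩
      rw [residueSign, ← Int.cast_pow, jacobiSym.sq_one (Int.isCoprime_iff_gcd_eq_one.1 h1)]; simp
    refine ⟨e (1 / 3) ^ (2 * x - s + (-2 * y - s) - s), zpow_ne_zero _ hω,
      etaProdTransforms_three hs _ _ (by ring) (by ring) (by linear_combination -h), ?_⟩
    rw [hsign, one_mul, ← zpow_natCast, ← zpow_mul]
    convert etaProdTransforms_three (a := 4 * (-s + x * 3)) (b := -t) (d := -(s + y * 3)) (s := -s)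
      (by omega) (4 * x - s) (-y) (by ring) (by ring) (by linear_combination -h) using 1
    rw [← omega_zpow_add_three_mul _ (y + 2 * s)]
    congr 1
    push_cast; ring
  · obtain rfl : m = 1 := by omega
    push_cast at h ⊢
    have hj : jacobiSym (-(2 * l)) 7 ^ 2 = 1 := by
      apply jacobiSym.sq_one
      rw [← Int.isCoprime_iff_gcd_eq_one]
      exact ⟨2 * k, t, by push_cast; linear_combination -h⟩
    have hj' : (jacobiSym (-(2 * l)) 7 : ℂ) ^ 2 = 1 := by exact_mod_cast hj
    refine ⟨jacobiSym (-(2 * l)) 7 * e (1 / 3) ^ (2 * k + -(2 * l)), ?_,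
      etaProdTransforms_seven (by linear_combination -h), ?_⟩
    · refine mul_ne_zero (fun h0 => ?_) (zpow_ne_zero _ hω)
      rw [h0] at hj'; norm_num at hj'
    · convert etaProdTransforms_seven (a := 4 * k) (b := -t) (d := -l)
        (by linear_combination -h) using 1
      rw [residueSign, mul_pow, hj', one_mul, pow_one, ← zpow_natCast, ← zpow_mul,
        ← omega_zpow_add_three_mul _ l]
      congr 2
      push_cast; ring

end FakeMonster

end

open scoped Real

noncomputable section

namespace FakeMonster

open ModularForm (eta)

/-! ### Fourier expansions of periodic functions of exponential growth -/

/-- The function grows at most like `exp (K Im τ)` as `Im τ → ∞`. -/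
def ExpGrowth (K : ℝ) (φ : ℂ → ℂ) : Prop :=
  ∃ C y₀ : ℝ, 0 < y₀ ∧ 0 ≤ C ∧ ∀ τ : ℂ, y₀ ≤ τ.im → ‖φ τ‖ ≤ C * Real.exp (K * τ.im)

lemma ExpGrowth.mono {K K' : ℝ} {φ : ℂ → ℂ} (h : ExpGrowth K φ) (hK : K ≤ K') :
    ExpGrowth K' φ := by
  obtain ⟨C, y₀, hy, hC, h⟩ := h
  refine ⟨C, y₀, hy, hC, fun τ hτ => (h τ hτ).trans ?_⟩
  have : 0 < τ.im := hy.trans_le hτ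
  gcongr

lemma ExpGrowth.add {K : ℝ} {φ ψ : ℂ → ℂ} (h : ExpGrowth K φ) (h' : ExpGrowth K ψ) :
    ExpGrowth K (fun τ => φ τ + ψ τ) := by
  obtain ⟨C, y₀, hy, hC, h⟩ := h
  obtain ⟨C', y₀', hy', hC', h'⟩ := h'
  refine ⟨C + C', max y₀ y₀', lt_max_of_lt_left hy, by positivity, fun τ hτ => ?_⟩
  rw [add_mul]
  exact norm_add_le_of_le (h τ (le_of_max_le_left hτ)) (h' τ (le_of_max_le_right hτ))

lemma ExpGrowth.mul {K K' : ℝ} {φ ψ : ℂ → ℂ} (h : ExpGrowth K φ) (h' : ExpGrowth K' ψ) :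
    ExpGrowth (K + K') (fun τ => φ τ * ψ τ) := by
  obtain ⟨C, y₀, hy, hC, h⟩ := h
  obtain ⟨C', y₀', hy', hC', h'⟩ := h'
  refine ⟨C * C', max y₀ y₀', lt_max_of_lt_left hy, by positivity, fun τ hτ => ?_⟩
  rw [norm_mul, add_mul, Real.exp_add]
  calc _ ≤ (C * Real.exp (K * τ.im)) * (C' * Real.exp (K' * τ.im)) :=
        mul_le_mul (h τ (le_of_max_le_left hτ)) (h' τ (le_of_max_le_right hτ)) (norm_nonneg _)
          (by positivity)
    _ = _ := by ring

lemma ExpGrowth.const_mul {K : ℝ} {φ : ℂ → ℂ} (h : ExpGrowth K φ) (c : ℂ) :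
    ExpGrowth K (fun τ => c * φ τ) := by
  obtain ⟨C, y₀, hy, hC, h⟩ := h
  refine ⟨‖c‖ * C, y₀, hy, by positivity, fun τ hτ => ?_⟩
  rw [norm_mul, mul_assoc]
  gcongr
  exact h τ hτ

lemma ExpGrowth.sum {ι : Type*} {K : ℝ} (s : Finset ι) {φ : ι → ℂ → ℂ}
    (h : ∀ i ∈ s, ExpGrowth K (φ i)) : ExpGrowth K (fun τ => ∑ i ∈ s, φ i τ) := by
  classical
  induction s using Finset.induction_on with
  | empty => exact ⟨0, 1, one_pos, le_rfl, fun τ _ => by simp⟩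
  | insert i s hi ih =>
    simp only [Finset.sum_insert hi]
    exact (h i (Finset.mem_insert_self i s)).add
      (ih fun j hj => h j (Finset.mem_insert_of_mem hj))

lemma ExpGrowth.comp_affine {K : ℝ} {φ : ℂ → ℂ} (h : ExpGrowth K φ) {a : ℝ} (ha : 0 < a) (b : ℝ) :
    ExpGrowth (K * a) (fun τ => φ (a * τ + b)) := by
  obtain ⟨C, y₀, hy, hC, h⟩ := h
  refine ⟨C, y₀ / a, by positivity, hC, fun τ hτ => ?_⟩
  have him : (a * τ + b : ℂ).im = a * τ.im := by simp
  have := h (a * τ + b) (by rw [him]; rw [div_le_iff₀ ha] at hτ; linarith)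
  rwa [him, ← mul_assoc] at this

lemma expGrowth_e (r : ℝ) : ExpGrowth (-(2 * π * r)) (fun τ => e (r * τ)) := by
  refine ⟨1, 1, one_pos, one_pos.le, fun τ _ => le_of_eq ?_⟩
  rw [norm_e, one_mul]; congr 1; simp; ring

lemma differentiable_e_mul (r : ℂ) : Differentiable ℂ (fun τ => e (r * τ)) := by
  unfold e; fun_prop

lemma isOpen_im_pos : IsOpen {τ : ℂ | 0 < τ.im} := isOpen_lt continuous_const Complex.continuous_im

open Function Filter Topology in
/-- A `1`-periodic holomorphic function on the upper half plane growing more slowly than `q⁻¹` is a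
holomorphic function of `q`. -/
lemma exists_cusp_extension {K : ℝ} {φ : ℂ → ℂ} (hd : DifferentiableOn ℂ φ {τ : ℂ | 0 < τ.im})
    (hper : ∀ τ : ℂ, 0 < τ.im → φ (τ + 1) = φ τ) (hg : ExpGrowth K φ) (hK : K < 2 * π) :
    ∃ F : ℂ → ℂ, DifferentiableOn ℂ F (Metric.ball 0 1) ∧ ∀ τ : ℂ, 0 < τ.im → φ τ = F (e τ) := by
  classical
  set ψ : ℂ → ℂ := fun z => if 0 < z.im then φ z else 0 with hψ
  have hψper : Periodic ψ (1 : ℝ) := by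
    intro z
    simp only [hψ, Complex.add_im, Complex.ofReal_im, add_zero]
    split_ifs with h
    · simpa using hper z h
    · rfl
  have hψd : ∀ z : ℂ, 0 < z.im → DifferentiableAt ℂ ψ z := by
    intro z hz
    apply ((hd z hz).differentiableAt (isOpen_im_pos.mem_nhds hz)).congr_of_eventuallyEq
    filter_upwards [isOpen_im_pos.mem_nhds hz] with w hw
    exact if_pos hw
  set G := Periodic.cuspFunction 1 ψ with hG
  have hinv : ∀ q : ℂ, q ∈ Metric.ball (0 : ℂ) 1 → q ≠ 0 → 0 < (Periodic.invQParam 1 q).im := by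
    intro q hq hq0
    exact Periodic.im_invQParam_pos_of_norm_lt_one one_pos (by simpa using hq) hq0
  have hGd : DifferentiableOn ℂ G (Metric.ball 0 1 \ {0}) := by
    intro q hq
    have h1 := hinv q hq.1 hq.2
    have h2 := Periodic.differentiableAt_cuspFunction one_ne_zero hψper (hψd _ h1)
    rw [Periodic.qParam_right_inv one_ne_zero hq.2] at h2
    exact h2.differentiableWithinAt
  have hball : Metric.ball (0 : ℂ) 1 ∈ 𝓝 0 := Metric.ball_mem_nhds 0 one_pos
  obtain ⟨C, y₀, hy, hC, hg⟩ := hg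
  -- Removable singularity: the growth bound reads `|G(q)| ≤ C |q|^(-K/2π)` near zero, and `K < 2π`
  -- makes this `o(|q|⁻¹)`.
  have ho : (fun z => G z - G 0) =o[𝓝[≠] 0] fun z => (z - 0)⁻¹ := by
    have hid : Tendsto (fun z : ℂ => ‖z‖) (𝓝[≠] 0) (𝓝[>] 0) := tendsto_norm_nhdsNE_zero
    apply Asymptotics.IsLittleO.sub
    · have hlim : Tendsto (fun z : ℂ => C * ‖z‖ ^ (1 - K / (2 * π))) (𝓝[≠] 0) (𝓝 0) := by
        have h1 : 0 < 1 - K / (2 * π) := by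
          rw [sub_pos, div_lt_one (by positivity)]; exact hK
        have h2 := ((Real.continuousAt_rpow_const 0 _ (Or.inr h1.le)).tendsto).comp
          (hid.mono_right nhdsWithin_le_nhds)
        simpa [Real.zero_rpow h1.ne', Function.comp_def] using h2.const_mul C
      rw [Asymptotics.isLittleO_iff]
      intro c hc
      have h3 : ∀ᶠ z : ℂ in 𝓝[≠] 0, y₀ ≤ (Periodic.invQParam 1 z).im :=
        (tendsto_comap_iff.1 (Periodic.invQParam_tendsto one_pos)).eventually_ge_atTop y₀
      filter_upwards [hlim.eventually (gt_mem_nhds hc), h3, self_mem_nhdsWithin,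
        nhdsWithin_le_nhds hball] with z hz1 hz2 hz3 hz4
      have hz3' : z ≠ 0 := hz3
      have hn : 0 < ‖z‖ := norm_pos_iff.2 hz3'
      rw [hG, Periodic.cuspFunction_eq_of_nonzero _ _ hz3', hψ]
      simp only [if_pos (hinv z hz4 hz3'), sub_zero, norm_inv]
      have h5 := hg _ hz2
      rw [Periodic.im_invQParam] at h5
      have h6 : Real.exp (K * (-1 / (2 * π) * Real.log ‖z‖)) = ‖z‖ ^ (1 - K / (2 * π)) * ‖z‖⁻¹ := by
        rw [sub_eq_add_neg, Real.rpow_add hn, Real.rpow_one, mul_comm ‖z‖, mul_assoc,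
          mul_inv_cancel₀ hn.ne', mul_one, Real.rpow_def_of_pos hn]
        congr 1; ring
      rw [h6, ← mul_assoc] at h5
      exact h5.trans (by gcongr)
    · apply Asymptotics.isLittleO_const_left.2 (Or.inr _)
      simp only [sub_zero]
      exact tendsto_norm_inv_nhdsNE_zero_atTop
  refine ⟨_, Complex.differentiableOn_update_limUnder_of_isLittleO hball hGd ho, fun τ hτ => ?_⟩
  have h1 : e τ = Periodic.qParam 1 τ := by simp [e, Periodic.qParam]
  rw [h1, update_of_ne (Periodic.qParam_ne_zero τ), hG,
    Periodic.eq_cuspFunction one_ne_zero hψper, hψ]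
  simp [hτ]

/-- Multiplication by `e((N - r)τ)` removes the multiplier `e(r)` and, for large `N`, beats the
growth. The Taylor series in `q` of the resulting function, shifted back by `N - r`, is the
expansion. -/
lemma hasExpansionMod_of_expGrowth {K : ℝ} {r : ℚ} {φ : ℂ → ℂ}
    (hd : DifferentiableOn ℂ φ {τ : ℂ | 0 < τ.im})
    (hper : ∀ τ : ℂ, 0 < τ.im → φ (τ + 1) = e r * φ τ) (hg : ExpGrowth K φ) :
    HasExpansionMod r φ := by
  obtain ⟨N, hN⟩ := exists_nat_gt (K / (2 * π) + r)
  have hg' := hg.mul (expGrowth_e (N - r))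
  obtain ⟨F, hF, hφF⟩ := exists_cusp_extension (φ := fun τ => φ τ * e (((N - r : ℝ) : ℂ) * τ))
    (hd.mul (differentiable_e_mul _).differentiableOn) (fun τ hτ => by
      rw [hper τ hτ, mul_add, e_add, mul_one]
      push_cast
      rw [sub_eq_add_neg (N : ℂ), e_add (N : ℂ), e_neg]
      have := e_intCast N
      push_cast at this
      rw [this]
      field_simp [e_ne_zero]) hg' (by
      have : K / (2 * π) < N - r := by linarith
      rw [div_lt_iff₀ (by positivity)] at this
      nlinarith [Real.pi_pos])
  set c : ℕ → ℂ := fun n => (n.factorial : ℂ)⁻¹ * iteratedDeriv n F 0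
  refine ⟨fun n => if 0 ≤ n + N then c (n + N).toNat else 0, -N, fun n hn => if_neg (by omega),
    fun τ hτ => ?_⟩
  have hq : e τ ∈ Metric.ball (0 : ℂ) 1 := by
    rw [mem_ball_zero_iff, norm_e, Real.exp_lt_one_iff]
    have := Real.pi_pos
    nlinarith [mul_pos this hτ]
  have hs := (Complex.hasSum_taylorSeries_on_ball hF hq).mul_right (e (-((N : ℂ) - r) * τ))
  rw [← hφF τ hτ, mul_assoc, ← e_add] at hs
  push_cast at hs
  rw [show ((N : ℂ) - r) * τ + -((N : ℂ) - r) * τ = 0 by ring, e_zero, mul_one] at hs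
  have hinj : Function.Injective (fun n : ℕ => (n : ℤ) - N) := fun a b h => by
    simp only at h; omega
  rw [← hinj.hasSum_iff]
  · refine (congrArg (HasSum · (φ τ)) (funext fun n => ?_)).mpr hs
    simp only [Function.comp, sub_add_cancel, Int.natCast_nonneg, if_true, Int.toNat_natCast,
      sub_zero, smul_eq_mul, c]
    rw [show (((n : ℤ) - N : ℤ) : ℂ) + r = n + -((N : ℂ) - r) by push_cast; ring, add_mul, e_add,
      e_nat_mul]
    ring
  · intro n hn
    dsimp only
    rw [if_neg, zero_mul]
    intro h
    exact hn ⟨(n + N).toNat, by simp only; omega⟩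

/-- Substituting `Nτ` for `τ` reduces to period 1. -/
lemma isHolomorphicMeromorphicAtCusp_of_expGrowth {K : ℝ} {N : ℕ} (hN : 0 < N) {φ : ℂ → ℂ}
    (hd : DifferentiableOn ℂ φ {τ : ℂ | 0 < τ.im})
    (hper : ∀ τ : ℂ, 0 < τ.im → φ (τ + N) = φ τ) (hg : ExpGrowth K φ) :
    IsHolomorphicMeromorphicAtCusp φ := by
  have hN' : (0 : ℝ) < N := by exact_mod_cast hN
  have hN0 : (N : ℂ) ≠ 0 := by exact_mod_cast hN.ne'
  have him : ∀ τ : ℂ, 0 < τ.im → 0 < ((N : ℝ) * τ + (0 : ℝ) : ℂ).im := fun τ hτ => by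
    simp; positivity
  have hexp := hasExpansionMod_of_expGrowth (r := 0) (φ := fun τ => φ ((N : ℝ) * τ + (0 : ℝ)))
    (by
      refine DifferentiableOn.comp (g := φ) hd ?_ (fun τ hτ => him τ hτ)
      fun_prop)
    (fun τ hτ => by
      have := hper _ (him τ hτ)
      simp only [Rat.cast_zero, e_zero, one_mul]
      rw [← this]; congr 1; push_cast; ring) (hg.comp_affine hN' 0)
  obtain ⟨a, n₀, h0, ha⟩ := hexp
  refine ⟨hd, N, a, n₀, hN, h0, fun τ hτ => ?_⟩
  have h1 : 0 < (τ / N).im := by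
    rw [show τ / N = ((1 / N : ℝ) : ℂ) * τ by push_cast; ring, Complex.im_ofReal_mul]; positivity
  have := ha (τ / N) h1
  convert this using 1
  · funext n
    simp only [Rat.cast_zero, add_zero]
    congr 2; ring
  · congr 1; push_cast; field_simp; simp

end FakeMonster

end

open scoped Real

noncomputable section

namespace FakeMonster

open ModularForm (eta)

variable {p m : ℕ}

/-! ### The functions `2f` and `γ` as eta quotients -/

/-- High up the product in `Δ = q ∏ (1 - q^n)^24` lies within `1/2` of 1. -/
lemma exists_bounds_eta_prod : ∃ y₀ : ℝ, 0 < y₀ ∧ ∀ τ : ℂ, y₀ ≤ τ.im →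
    ‖eta τ‖ ^ 24 ≤ 2 * Real.exp (-(2 * π * τ.im)) ∧
    Real.exp (-(2 * π * τ.im)) ≤ 2 * ‖eta τ‖ ^ 24 := by
  have h := ModularForm.tendsto_atImInfty_tprod_one_sub_eta_q_pow.eventually
    (Metric.ball_mem_nhds 1 (by norm_num : (0 : ℝ) < 1 / 2))
  obtain ⟨A, hA⟩ := (UpperHalfPlane.atImInfty_mem _).1 h
  refine ⟨max A 1, by positivity, fun τ hτ => ?_⟩
  have hτ0 : 0 < τ.im := one_pos.trans_le (le_of_max_le_right hτ)
  have h1 := hA ⟨τ, hτ0⟩ (le_of_max_le_left hτ)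
  have h2 := ModularForm.discriminant_eq_q_prod ⟨τ, hτ0⟩
  rw [ModularForm.discriminant] at h2
  set P : ℂ := ∏' n : ℕ, (1 - ModularForm.eta_q n ((⟨τ, hτ0⟩ : UpperHalfPlane) : ℂ)) ^ 24
  have h3 : dist P 1 < 1 / 2 := h1
  have h4 : ‖eta τ‖ ^ 24 = Real.exp (-(2 * π * τ.im)) * ‖P‖ := by
    rw [← norm_pow]
    have h5 : eta τ ^ 24 = Function.Periodic.qParam 1 τ * P := h2
    rw [h5, norm_mul, Function.Periodic.norm_qParam]
    congr 2; ring
  rw [dist_eq_norm] at h3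
  have h5 : ‖P‖ ≤ 2 := by
    have := norm_add_le (P - 1) 1
    rw [sub_add_cancel, norm_one] at this; linarith
  have h6 : 1 ≤ 2 * ‖P‖ := by
    have := norm_sub_norm_le 1 P
    rw [norm_one, norm_sub_rev] at this; linarith
  have := Real.exp_pos (-(2 * π * τ.im))
  rw [h4]
  constructor <;> nlinarith

/-- The leading exponent of `h` is `m (p + 1) / 24 = 1/3`. The inequalities are compared after
raising to the 24th power, where `η^24` is controlled. -/
lemma exists_bounds_etaProd (hp : 0 < p) (hpm : m * (p + 1) = 8) : ∃ C y₀ : ℝ, 0 < C ∧ 0 < y₀ ∧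
    ∀ τ : ℂ, y₀ ≤ τ.im → ‖etaProd p m τ‖ ≤ C * Real.exp (-(2 * π / 3 * τ.im)) ∧
      Real.exp (-(2 * π / 3 * τ.im)) ≤ C * ‖etaProd p m τ‖ := by
  obtain ⟨y₀, hy, h⟩ := exists_bounds_eta_prod
  have h1 : (1 : ℝ) ≤ 4 ^ m := one_le_pow₀ (by norm_num)
  refine ⟨4 ^ m, y₀, by positivity, hy, fun τ hτ => ?_⟩
  have hτ0 := hy.trans_le hτ
  have hp1 : (1 : ℝ) ≤ p := by exact_mod_cast hp
  obtain ⟨ha, hb⟩ := h τ hτ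
  have him : (p * τ : ℂ).im = p * τ.im := by simp
  obtain ⟨hc, hd⟩ := h (p * τ) (by rw [him]; nlinarith)
  rw [him] at hc hd
  have hm8 : (m : ℝ) * (p + 1) = 8 := by exact_mod_cast hpm
  have hE : (Real.exp (-(2 * π * (p * τ.im))) * Real.exp (-(2 * π * τ.im))) ^ m
      = Real.exp (-(2 * π / 3 * τ.im)) ^ 24 := by
    rw [← Real.exp_add, ← Real.exp_nat_mul, ← Real.exp_nat_mul]
    congr 1
    push_cast
    linear_combination (-2 * π * τ.im) * hm8
  have hN : ‖etaProd p m τ‖ ^ 24 = (‖eta (p * τ)‖ ^ 24 * ‖eta τ‖ ^ 24) ^ m := by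
    rw [etaProd, norm_pow, norm_mul, ← mul_pow, ← pow_mul, ← pow_mul, mul_comm 24 m]
  have h4 : ((4 : ℝ) ^ m) ≤ (4 ^ m) ^ 24 := le_self_pow₀ h1 (by norm_num)
  constructor
  · rw [← pow_le_pow_iff_left₀ (norm_nonneg _) (by positivity) (show 24 ≠ 0 by norm_num), hN,
      mul_pow (4 ^ m : ℝ), ← hE]
    calc _ ≤ ((2 * Real.exp (-(2 * π * (p * τ.im)))) * (2 * Real.exp (-(2 * π * τ.im)))) ^ m := by
          gcongr
      _ = 4 ^ m * (Real.exp (-(2 * π * (p * τ.im))) * Real.exp (-(2 * π * τ.im))) ^ m := by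
          rw [← mul_pow]; congr 1; ring
      _ ≤ _ := by gcongr
  · rw [← pow_le_pow_iff_left₀ (by positivity) (by positivity) (show 24 ≠ 0 by norm_num),
      mul_pow (4 ^ m : ℝ), hN, ← hE]
    calc _ ≤ ((2 * ‖eta (p * τ)‖ ^ 24) * (2 * ‖eta τ‖ ^ 24)) ^ m := by gcongr
      _ = 4 ^ m * (‖eta (p * τ)‖ ^ 24 * ‖eta τ‖ ^ 24) ^ m := by
          rw [← mul_pow]; congr 1; ring
      _ ≤ _ := by gcongr

/-- The function `2f` (for all three values of `p`). -/
def twoF (p m : ℕ) (τ : ℂ) : ℂ := 2 ^ m * etaProd p m (2 * τ) / etaProd p m τ ^ 2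

lemma two_mul_f (hp : p.Prime) (hpm : m * (p + 1) = 8) (τ : ℂ) : 2 * f p m τ = twoF p m τ := by
  have h2 := hp.two_le
  have hm : (2 * m : ℂ) = 2 ^ m := by
    have h1 : m ≤ 8 := by nlinarith
    interval_cases m
    · omega
    · norm_num
    · norm_num
    all_goals omega
  rw [f, twoF, etaProd, etaProd, ← hm, ← pow_mul, mul_comm m 2,
    show (p : ℂ) * (2 * τ) = 2 * p * τ by ring]
  ring

lemma two_mul_fOne (τ : ℂ) : 2 * fOne τ = twoF 1 4 τ := by
  rw [fOne, twoF, etaProd, etaProd]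
  simp only [Nat.cast_one, one_mul]
  ring

lemma gam_eq (τ : ℂ) : gam p m τ = etaProd p m (τ / 2) / etaProd p m τ ^ 2 := by
  rw [gam, etaProd, etaProd, ← pow_mul, mul_comm m 2, mul_div_assoc]

lemma deltaOne_eq (τ : ℂ) : deltaOne τ = fOne τ + gam 1 4 τ := by
  rw [deltaOne, gam]
  norm_num
  ring

lemma im_two_mul {τ : ℂ} (hτ : 0 < τ.im) : 0 < (2 * τ).im := by simpa using hτ

lemma im_div_two {τ : ℂ} (hτ : 0 < τ.im) : 0 < (τ / 2).im := by simpa using hτ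

lemma differentiableOn_twoF (hp : 0 < p) : DifferentiableOn ℂ (twoF p m) {τ : ℂ | 0 < τ.im} := by
  intro τ hτ
  apply DifferentiableAt.differentiableWithinAt
  have h1 : DifferentiableAt ℂ (fun τ => etaProd p m (2 * τ)) τ :=
    DifferentiableAt.comp (f := fun τ : ℂ => 2 * τ) τ
      (differentiableAt_etaProd hp (im_two_mul hτ)) (by fun_prop)
  exact (h1.const_mul _).div ((differentiableAt_etaProd hp hτ).pow 2)
    (pow_ne_zero _ (etaProd_ne_zero hp hτ))

lemma differentiableOn_gam (hp : 0 < p) : DifferentiableOn ℂ (gam p m) {τ : ℂ | 0 < τ.im} := by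
  intro τ hτ
  apply DifferentiableAt.differentiableWithinAt
  have h1 : DifferentiableAt ℂ (fun τ => etaProd p m (τ / 2)) τ :=
    DifferentiableAt.comp (f := fun τ : ℂ => τ / 2) τ
      (differentiableAt_etaProd hp (im_div_two hτ)) (by fun_prop)
  rw [funext (fun τ => gam_eq (p := p) (m := m) τ)]
  exact h1.div ((differentiableAt_etaProd hp hτ).pow 2) (pow_ne_zero _ (etaProd_ne_zero hp hτ))

lemma norm_div_sq_le {x y : ℂ} {C s t : ℝ} (hC : 0 < C) (hx : ‖x‖ ≤ C * Real.exp s)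
    (hy : Real.exp t ≤ C * ‖y‖) : ‖x / y ^ 2‖ ≤ C ^ 3 * Real.exp (s - 2 * t) := by
  have hy0 : 0 < ‖y‖ := by
    have := Real.exp_pos t
    by_contra h
    nlinarith [norm_nonneg y]
  rw [norm_div, norm_pow, div_le_iff₀ (by positivity)]
  have h1 : Real.exp t ^ 2 ≤ (C * ‖y‖) ^ 2 := by gcongr
  have h2 : Real.exp s = Real.exp (s - 2 * t) * Real.exp t ^ 2 := by
    rw [← Real.exp_nat_mul, ← Real.exp_add]; congr 1; push_cast; ring
  calc _ ≤ C * Real.exp s := hx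
    _ ≤ C * (Real.exp (s - 2 * t) * (C * ‖y‖) ^ 2) := by rw [h2]; gcongr
    _ = _ := by ring

/-- The leading exponents of `h(2τ)` and `h(τ)²` are both `2/3`, so the quotient stays bounded. -/
lemma expGrowth_twoF (hp : 0 < p) (hpm : m * (p + 1) = 8) : ExpGrowth 0 (twoF p m) := by
  obtain ⟨C, y₀, hC, hy, h⟩ := exists_bounds_etaProd hp hpm
  refine ⟨2 ^ m * C ^ 3, y₀, hy, by positivity, fun τ hτ => ?_⟩
  have h1 := (h (2 * τ) (by simp; linarith)).1
  have h2 := norm_div_sq_le hC h1 (h τ hτ).2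
  rw [twoF, mul_div_assoc, norm_mul, norm_pow, mul_assoc]
  simp only [Complex.norm_ofNat]
  have h3 : -(2 * π / 3 * (2 * τ : ℂ).im) - 2 * -(2 * π / 3 * τ.im) = 0 * τ.im := by simp; ring
  rw [h3] at h2
  exact mul_le_mul_of_nonneg_left h2 (by positivity)

/-- The leading exponent is `1/6 - 2/3 = -1/2`. That the rate `π` is below `2π` is what lets the
defect of supersymmetry extend over `q = 0`. -/
lemma expGrowth_gam (hp : 0 < p) (hpm : m * (p + 1) = 8) : ExpGrowth π (gam p m) := by
  obtain ⟨C, y₀, hC, hy, h⟩ := exists_bounds_etaProd hp hpm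
  refine ⟨C ^ 3, 2 * y₀, by positivity, by positivity, fun τ hτ => ?_⟩
  have h1 := (h (τ / 2) (by simp; linarith)).1
  have h2 := norm_div_sq_le hC h1 (h τ (by linarith)).2
  rw [gam_eq]
  convert h2 using 3
  simp; ring

lemma twoF_add_one (hpm : m * (p + 1) = 8) (τ : ℂ) : twoF p m (τ + 1) = twoF p m τ := by
  have h2 := etaProd_add_intCast hpm (2 * τ) 2
  have h := e_ne_zero (1 / 3)
  rw [twoF, etaProd_add_one hpm, show 2 * (τ + 1) = 2 * τ + (2 : ℤ) by push_cast; ring, h2, twoF]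
  norm_cast
  field_simp

lemma gam_add_one (hpm : m * (p + 1) = 8) (τ : ℂ) :
    gam p m (τ + 1) = e (1 / 3) * (etaProd p m ((τ + 1) / 2) / etaProd p m τ ^ 2) := by
  have h := e_ne_zero (1 / 3)
  have h3 : (e (1 / 3) ^ 2)⁻¹ = e (1 / 3) :=
    inv_eq_of_mul_eq_one_right (by linear_combination omega_pow_three)
  have h4 : e (1 / 3) * (etaProd p m ((τ + 1) / 2) / etaProd p m τ ^ 2) =
      (e (1 / 3) ^ 2)⁻¹ * (etaProd p m ((τ + 1) / 2) / etaProd p m τ ^ 2) := by rw [h3]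
  rw [gam_eq, etaProd_add_one hpm, mul_pow, h4]
  ring

lemma gam_add_two (hpm : m * (p + 1) = 8) (τ : ℂ) : gam p m (τ + 2) = gam p m τ := by
  have h := e_ne_zero (1 / 3)
  have h1 := etaProd_add_intCast hpm τ 2
  have h3 := omega_pow_three
  push_cast at h1
  rw [gam_eq, gam_eq, h1, show (τ + 2) / 2 = τ / 2 + 1 by ring, etaProd_add_one hpm]
  norm_cast
  rw [mul_pow, ← pow_mul, show e (1 / 3) ^ (2 * 2) = e (1 / 3) by linear_combination e (1 / 3) * h3,
    mul_div_mul_left _ _ h]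

/-! ### Transformation under the Fricke involution -/

/-- Doubling `-1/(pτ)` amounts to halving `τ`, so `h(2τ)` turns into `h(τ/2)`; the factor `2^m` in
`twoF` cancels the halved automorphy factor. -/
lemma twoF_fricke (hp : 0 < p) {τ : ℂ} (hτ : 0 < τ.im) :
    twoF p m (-1 / (p * τ)) = ((Real.sqrt p * τ / Complex.I) ^ m)⁻¹ * gam p m τ := by
  have hp' : (p : ℂ) ≠ 0 := by exact_mod_cast hp.ne'
  have hs' : (Real.sqrt p : ℂ) ≠ 0 := by
    rw [Complex.ofReal_ne_zero]; positivity
  have h0 := ne_zero_of_im_pos hτ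
  rw [twoF, etaProd_fricke hp hτ,
    show 2 * (-1 / (p * τ)) = -1 / (p * (τ / 2)) by field_simp, etaProd_fricke hp (im_div_two hτ),
    gam_eq, show (Real.sqrt p * (τ / 2) / Complex.I) = (Real.sqrt p * τ / Complex.I) / 2 by ring]
  have h1 : Real.sqrt p * τ / Complex.I ≠ 0 := by simp [hs', h0]
  have := etaProd_ne_zero (m := m) hp hτ
  generalize (Real.sqrt p * τ / Complex.I) = x at *
  rw [div_pow]
  field_simp

lemma gam_fricke (hp : 0 < p) {τ : ℂ} (hτ : 0 < τ.im) :
    gam p m (-1 / (p * τ)) = ((Real.sqrt p * τ / Complex.I) ^ m)⁻¹ * twoF p m τ := by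
  have hp' : (p : ℂ) ≠ 0 := by exact_mod_cast hp.ne'
  have hs' : (Real.sqrt p : ℂ) ≠ 0 := by
    rw [Complex.ofReal_ne_zero]; positivity
  have h0 := ne_zero_of_im_pos hτ
  rw [twoF, gam_eq, etaProd_fricke hp hτ,
    show (-1 / (p * τ)) / 2 = -1 / (p * (2 * τ)) by field_simp, etaProd_fricke hp (im_two_mul hτ),
    show (Real.sqrt p * (2 * τ) / Complex.I) = 2 * (Real.sqrt p * τ / Complex.I) by ring]
  have h1 : Real.sqrt p * τ / Complex.I ≠ 0 := by simp [hs', h0]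
  have := etaProd_ne_zero (m := m) hp hτ
  generalize (Real.sqrt p * τ / Complex.I) = x at *
  rw [mul_pow]
  field_simp

/-! ### Transformation under matrices exchanging `2f` and `γ` -/

/-- Twice the image of `w` is the image of `w/2` under the second matrix of
`exists_etaProdTransforms_pair`. Its automorphy factor is half that of the first matrix, which
consumes the `2^m`. -/
lemma twoF_exchange (hp : p.Prime) (hpm : m * (p + 1) = 8) {k l t : ℤ}
    (h : 4 * k * l + 1 = p * t) {w : ℂ} (hw : 0 < w.im) :
    twoF p m ((2 * k * w - t) / (p * w - 2 * l)) =
      residueSign p m l * ((p * w - 2 * l) ^ m)⁻¹ * gam p m w := by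
  obtain ⟨X, hX, h1, h2⟩ := exists_etaProdTransforms_pair hp hpm h
  have e1 := h1 w hw
  have e2 := h2 (w / 2) (im_div_two hw)
  have hne := natCast_mul_add_intCast_ne_zero hp.pos hw (-(2 * l))
  push_cast at e1 e2 hne
  rw [← sub_eq_add_neg] at hne
  rw [show (4 * k * (w / 2) + -t) / (p * (w / 2) + -l) = 2 * ((2 * k * w - t) / (p * w - 2 * l)) by
    rw [show (p : ℂ) * (w / 2) + -l = (p * w - 2 * l) / 2 by ring]; field_simp; ring,
    show (p : ℂ) * (w / 2) + -l = (p * w - 2 * l) / 2 by ring] at e2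
  simp only [← sub_eq_add_neg] at e1
  have := etaProd_ne_zero (m := m) hp.pos hw
  rw [twoF, e1, e2, gam_eq]
  generalize (p : ℂ) * w - 2 * l = x at *
  rw [div_pow]
  field_simp

lemma prime_cases (hp : p.Prime) (hpm : m * (p + 1) = 8) : p = 3 ∧ m = 2 ∨ p = 7 ∧ m = 1 := by
  have hm : m ≠ 0 := by rintro rfl; omega
  have hp7 : p ≤ 7 := by nlinarith [Nat.pos_of_ne_zero hm]
  have h2 := hp.two_le
  interval_cases p <;> omega

/-- Since `4kl ≡ -1` mod `p`, the product of the two symbols is `(-1/p)`, and `p ≡ 3` mod 4. -/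
lemma residueSign_mul (hp : p.Prime) (hpm : m * (p + 1) = 8) {k l t : ℤ}
    (h : 4 * k * l + 1 = p * t) : residueSign p m k * residueSign p m l = (-1) ^ m := by
  have key : jacobiSym (-k) p * jacobiSym (-l) p = -1 := by
    have h4 : jacobiSym 4 p = 1 := by
      rcases prime_cases hp hpm with ⟨rfl, rfl⟩ | ⟨rfl, rfl⟩ <;> norm_num
    have h1 : jacobiSym (-1) p = -1 := by
      rcases prime_cases hp hpm with ⟨rfl, rfl⟩ | ⟨rfl, rfl⟩ <;> norm_num
    rw [← jacobiSym.mul_left, ← one_mul (jacobiSym (-k * -l) p), ← h4, ← jacobiSym.mul_left,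
      show 4 * (-k * -l) = -1 + p * t by linarith, jacobiSym.mod_left, Int.add_mul_emod_self_left,
      ← jacobiSym.mod_left, h1, h4]
  rw [residueSign, residueSign, ← mul_pow]
  congr 1
  exact_mod_cast key

/-- Up to the sign of the matrix, the inverse substitution has the same shape with `k` and `l`
interchanged. So this is `twoF_exchange` read backwards, the sign `(-1)^m` being absorbed by
`residueSign_mul`. -/
lemma gam_exchange (hp : p.Prime) (hpm : m * (p + 1) = 8) {k l t : ℤ}
    (h : 4 * k * l + 1 = p * t) {w : ℂ} (hw : 0 < w.im) :
    gam p m ((2 * k * w - t) / (p * w - 2 * l)) =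
      residueSign p m l * ((p * w - 2 * l) ^ m)⁻¹ * twoF p m w := by
  have hdet : (2 * k) * (-(2 * l)) - (-t) * p = 1 := by linarith
  obtain ⟨hne, him⟩ := im_moebius_pos hdet hw
  push_cast at hne him
  simp only [← sub_eq_add_neg] at hne him
  have h1 := twoF_exchange hp hpm (k := l) (l := k) (t := t) (by linarith) him
  have hp' : (p : ℂ) ≠ 0 := by exact_mod_cast hp.ne_zero
  have hC : (4 : ℂ) * k * l + 1 = p * t := by exact_mod_cast h
  have e1 : (p : ℂ) * ((2 * k * w - t) / (p * w - 2 * l)) - 2 * k = -1 / (p * w - 2 * l) := by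
    field_simp; linear_combination hC
  have e2 : (2 * l * ((2 * k * w - t) / (p * w - 2 * l)) - t) / (-1 / (p * w - 2 * l)) = w := by
    generalize hx : (p : ℂ) * w - 2 * l = x at hne
    field_simp
    linear_combination -w * hC - t * hx
  rw [e1, e2] at h1
  have hs := residueSign_mul hp hpm h
  have h3 : ((-1 : ℂ) ^ m) * (-1) ^ m = 1 := by rw [← mul_pow]; simp
  rw [h1, div_pow]
  have hx := pow_ne_zero m hne
  generalize gam p m _ = G
  generalize ((p : ℂ) * w - 2 * l) ^ m = x at *
  have h4 : ((-1 : ℂ) ^ m)⁻¹ = (-1) ^ m := inv_eq_of_mul_eq_one_right h3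
  rw [inv_div, div_eq_mul_inv, h4]
  field_simp
  linear_combination -G * ((-1) ^ m * hs + h3)

/-! ### Supersymmetry -/

/-- The function `2f(τ) + γ(τ) + γ(τ + 1)`, which vanishes by supersymmetry. -/
def susyDefect (p m : ℕ) (τ : ℂ) : ℂ := twoF p m τ + gam p m τ + gam p m (τ + 1)

lemma susyDefect_add_one (hpm : m * (p + 1) = 8) (τ : ℂ) :
    susyDefect p m (τ + 1) = susyDefect p m τ := by
  rw [susyDefect, twoF_add_one hpm, show τ + 1 + 1 = τ + 2 by ring, gam_add_two hpm, susyDefect]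
  ring

lemma susyDefect_add_intCast (hpm : m * (p + 1) = 8) (τ : ℂ) (n : ℤ) :
    susyDefect p m (τ + n) = susyDefect p m τ := by
  have h : Function.Periodic (susyDefect p m) 1 := fun τ => susyDefect_add_one hpm τ
  simpa using h.int_mul n τ

/-- The involution exchanges `2f(τ)` and `γ(τ)`. It carries `γ(τ + 1)` to itself because on the
argument `(τ + 1)/2` it acts as a Fricke involution followed by `(a, 1; p, 2)`, whose multiplier is
trivial by hypothesis. -/
lemma susyDefect_fricke (hp : 0 < p) (hpm : m * (p + 1) = 8) {a : ℤ} (ha : 2 * a = p + 1)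
    (h : EtaProdTransforms p m a 1 p 2 1) {τ : ℂ} (hτ : 0 < τ.im) :
    susyDefect p m (-1 / (p * τ)) =
      ((Real.sqrt p * τ / Complex.I) ^ m)⁻¹ * susyDefect p m τ := by
  have hp' : (p : ℂ) ≠ 0 := by exact_mod_cast hp.ne'
  have hs' : (Real.sqrt p : ℂ) ≠ 0 := by
    rw [Complex.ofReal_ne_zero]; positivity
  have h0 := ne_zero_of_im_pos hτ
  have ha' : (2 : ℂ) * a = p + 1 := by exact_mod_cast ha
  have hv : 0 < ((τ + 1) / 2).im := im_div_two (by simpa using hτ)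
  have h1 := ne_zero_of_im_pos (show 0 < (τ + 1).im by simpa using hτ)
  have e1 := h _ (im_neg_one_div (im_natCast_mul hp hv))
  rw [etaProd_fricke hp hv, show ((p : ℤ) : ℂ) * (-1 / (p * ((τ + 1) / 2))) + (2 : ℤ) =
    2 * τ / (τ + 1) by push_cast; field_simp; ring, one_mul, ← mul_assoc, ← mul_pow,
    show 2 * τ / (τ + 1) * (Real.sqrt p * ((τ + 1) / 2) / Complex.I) =
      Real.sqrt p * τ / Complex.I by field_simp] at e1
  have e2 : (a * (-1 / (p * ((τ + 1) / 2))) + (1 : ℤ)) / (2 * τ / (τ + 1)) =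
      (-1 / (p * τ) + 1) / 2 := by
    push_cast; field_simp; linear_combination -ha'
  rw [e2] at e1
  have e3 : gam p m (-1 / (p * τ) + 1) =
      ((Real.sqrt p * τ / Complex.I) ^ m)⁻¹ * gam p m (τ + 1) := by
    rw [gam_add_one hpm, gam_add_one hpm, e1, etaProd_fricke hp hτ]
    have h1 : Real.sqrt p * τ / Complex.I ≠ 0 := by simp [hs', h0]
    have := etaProd_ne_zero (m := m) hp hτ
    generalize (Real.sqrt p * τ / Complex.I) = x at *
    field_simp
  rw [susyDefect, e3, twoF_fricke hp hτ, gam_fricke hp hτ, susyDefect]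
  ring

/-- For `p = 7` the Fricke involution and translations do not raise all low points, and this matrix
treats those near real part `1/2`. It exchanges `2f` and `γ` (the case `k = 2`, `l = -1`) and
preserves `γ(τ + 1)`, since on `(w + 1)/2` it acts as `(11, -4; 14, -5)`. -/
lemma susyDefect_seven {w : ℂ} (hw : 0 < w.im) :
    susyDefect 7 1 ((4 * w + 1) / (7 * w + 2)) = (7 * w + 2)⁻¹ * susyDefect 7 1 w := by
  have h7 : Nat.Prime 7 := by norm_num
  have hne : 7 * w + 2 ≠ 0 := by
    simpa using natCast_mul_add_intCast_ne_zero (p := 7) (by norm_num) hw 2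
  have hs : residueSign 7 1 (-1) = 1 := by simp [residueSign]
  have e1 := twoF_exchange (m := 1) h7 (by norm_num) (k := 2) (l := -1) (t := -1) (by norm_num) hw
  have e2 := gam_exchange (m := 1) h7 (by norm_num) (k := 2) (l := -1) (t := -1) (by norm_num) hw
  rw [hs] at e1 e2
  norm_num at e1 e2
  -- The lower left entry 14 is reached by factoring into two matrices with lower left entry 7.
  have h11 : EtaProdTransforms 7 1 11 (-4) 14 (-5) 1 := by
    have h1 := etaProdTransforms_seven (a := 6) (b := -1) (d := -1) (by norm_num)
    have h2 := etaProdTransforms_seven (a := 3) (b := -1) (d := -2) (by norm_num)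
    have h3 := h1.comp h2 (by norm_num) (A := 11) (B := -4) (C := 14) (D := -5)
      (by norm_num) (by norm_num) (by norm_num) (by norm_num)
    convert h3 using 1
    norm_num
    norm_cast
    rw [← pow_succ, show 5 + 1 = 3 * 2 by norm_num, pow_mul]
    have : e (3⁻¹) ^ 3 = 1 := by rw [← one_div]; exact omega_pow_three
    simp [this]
  have e3 := h11 ((w + 1) / 2) (im_div_two (by simpa using hw))
  have e4 := etaProdTransforms_seven (a := 4) (b := 1) (d := 2) (by norm_num) w hw
  rw [show (4 : ℤ) + 2 = 0 + 3 * 2 by norm_num, omega_zpow_add_three_mul] at e4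
  norm_num at e3 e4
  have e5 : gam 7 1 ((4 * w + 1) / (7 * w + 2) + 1) = (7 * w + 2)⁻¹ * gam 7 1 (w + 1) := by
    rw [gam_add_one (by norm_num), gam_add_one (by norm_num), e4,
      show ((4 * w + 1) / (7 * w + 2) + 1) / 2 =
        (11 * ((w + 1) / 2) + -4) / (14 * ((w + 1) / 2) + -5) by
          rw [show 14 * ((w + 1) / 2) + -5 = 7 * w + 2 by ring, eq_div_iff hne]
          have h4 := div_mul_cancel₀ (4 * w + 1) hne
          linear_combination h4 / 2, e3,
      show 14 * ((w + 1) / 2) + -5 = 7 * w + 2 by ring]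
    have := etaProd_ne_zero (p := 7) (m := 1) (by norm_num) hw
    field_simp
  rw [susyDefect, susyDefect, e1, e2, e5]
  ring

/-! ### Raising the imaginary part. -/

lemma norm_sq_div_im_pow_eq {x y τ : ℂ} {Y r : ℝ} (hr : 0 < r) (hY : Y = τ.im / r)
    (h : ‖y‖ = (Real.sqrt r ^ m)⁻¹ * ‖x‖) : ‖y‖ ^ 2 / Y ^ m = ‖x‖ ^ 2 / τ.im ^ m := by
  have h1 : Real.sqrt r ^ 2 = r := Real.sq_sqrt hr.le
  rw [h, hY, mul_pow, inv_pow, ← pow_mul, mul_comm m 2, pow_mul, h1, div_pow]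
  have := pow_pos hr m
  field_simp

lemma exists_raise_fricke (hp : 0 < p) (hpm : m * (p + 1) = 8) {a : ℤ} (ha : 2 * a = p + 1)
    (h : EtaProdTransforms p m a 1 p 2 1) {τ : ℂ} (hτ : 0 < τ.im)
    (hle : p * Complex.normSq τ ≤ 7 / 8) :
    ∃ τ' : ℂ, 8 / 7 * τ.im ≤ τ'.im ∧
      ‖susyDefect p m τ'‖ ^ 2 / τ'.im ^ m = ‖susyDefect p m τ‖ ^ 2 / τ.im ^ m := by
  have hp' : (0 : ℝ) < p := by exact_mod_cast hp
  have hN : 0 < Complex.normSq τ := Complex.normSq_pos.2 (ne_zero_of_im_pos hτ)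
  have him : (-1 / (p * τ) : ℂ).im = τ.im / (p * Complex.normSq τ) := by
    rw [neg_div, one_div, Complex.neg_im, Complex.inv_im, Complex.normSq_mul]
    simp
    field_simp
  refine ⟨-1 / (p * τ), ?_, norm_sq_div_im_pow_eq (r := p * Complex.normSq τ) (by positivity) him ?_⟩
  · rw [him, le_div_iff₀ (by positivity)]
    nlinarith
  · rw [susyDefect_fricke hp hpm ha h hτ, norm_mul, norm_inv, norm_pow, norm_div, norm_mul,
      Complex.norm_I, div_one, Real.sqrt_mul hp'.le, Complex.norm_def τ, Complex.norm_real,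
      Real.norm_of_nonneg (Real.sqrt_nonneg _)]

/-- The Fricke involution followed by `(4, 1; 7, 2)` is `τ ↦ 1/2 - 1/(28(τ - 1/2))`, which divides
the height by `28 |τ - 1/2|²`. -/
lemma exists_raise_seven {τ : ℂ} (hτ : 0 < τ.im)
    (hle : 28 * Complex.normSq (τ - 1 / 2) ≤ 7 / 8) :
    ∃ τ' : ℂ, 8 / 7 * τ.im ≤ τ'.im ∧
      ‖susyDefect 7 1 τ'‖ ^ 2 / τ'.im ^ 1 = ‖susyDefect 7 1 τ‖ ^ 2 / τ.im ^ 1 := by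
  have h0 := ne_zero_of_im_pos hτ
  have hI := Complex.I_ne_zero
  have hs : (Real.sqrt 7 : ℂ) ≠ 0 := by
    rw [Complex.ofReal_ne_zero]; positivity
  have hτ' : 0 < (τ - 1 / 2).im := by simpa using hτ
  have h1 := ne_zero_of_im_pos hτ'
  have hN : 0 < Complex.normSq (τ - 1 / 2) := Complex.normSq_pos.2 h1
  have hE := etaProdTransforms_seven (a := 4) (b := 1) (d := 2) (by norm_num)
  rw [show (4 : ℤ) + 2 = 0 + 3 * 2 by norm_num, omega_zpow_add_three_mul] at hE
  norm_num at hE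
  have e1 := susyDefect_fricke (p := 7) (m := 1) (by norm_num) (by norm_num) (a := 4)
    (by norm_num) hE hτ
  have e2 := susyDefect_seven (im_neg_one_div (im_natCast_mul (p := 7) (by norm_num) hτ))
  rw [e1] at e2
  have h2 : (7 : ℂ) * (-1 / ((7 : ℕ) * τ)) + 2 = 2 * (τ - 1 / 2) / τ := by
    push_cast; field_simp; ring
  have h3 : (4 * (-1 / ((7 : ℕ) * τ)) + 1) / (7 * (-1 / ((7 : ℕ) * τ)) + 2) =
      1 / 2 - (28 * (τ - 1 / 2))⁻¹ := by
    rw [h2, div_div_eq_mul_div, div_eq_iff (mul_ne_zero two_ne_zero h1), sub_mul]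
    have h4 : (28 * (τ - 1 / 2))⁻¹ * (2 * (τ - 1 / 2)) = 1 / 14 := by
      generalize τ - 1 / 2 = x at *
      field_simp; norm_num
    have h5 : (4 * (-1 / ((7 : ℕ) * τ)) + 1) * τ = τ - 4 / 7 := by
      push_cast; field_simp; ring
    rw [h4, h5]
    ring
  rw [h3, h2] at e2
  have him : (1 / 2 - (28 * (τ - 1 / 2))⁻¹ : ℂ).im =
      τ.im / (28 * Complex.normSq (τ - 1 / 2)) := by
    rw [Complex.sub_im, Complex.inv_im, Complex.normSq_mul]
    have : ((1 / 2 : ℂ)).im = 0 := by simp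
    rw [this]
    simp
    field_simp
  refine ⟨_, ?_, norm_sq_div_im_pow_eq (r := 28 * Complex.normSq (τ - 1 / 2)) (by positivity)
    him ?_⟩
  · rw [him, le_div_iff₀ (by positivity)]
    nlinarith
  · have h5 : Real.sqrt 28 = 2 * Real.sqrt 7 := by
      rw [show (28 : ℝ) = 2 ^ 2 * 7 by norm_num, Real.sqrt_mul (by norm_num),
        Real.sqrt_sq (by norm_num)]
    have h6 : ‖τ - 1 / 2‖ ≠ 0 := norm_ne_zero_iff.2 h1
    have h7 : ‖τ‖ ≠ 0 := norm_ne_zero_iff.2 h0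
    rw [e2, Real.sqrt_mul (by norm_num), h5, ← Complex.norm_def]
    simp only [norm_mul, norm_inv, norm_div, Complex.norm_I, Complex.norm_real,
      Real.norm_of_nonneg (Real.sqrt_nonneg _), Complex.norm_ofNat, div_one, pow_one]
    push_cast
    field_simp

end FakeMonster

end

/-! ### Vanishing of the supersymmetry defect. -/

open scoped Real

noncomputable section

namespace FakeMonster

open ModularForm (eta)

variable {p m : ℕ}

lemma pair_cases (hp : 0 < p) (hpm : m * (p + 1) = 8) :
    p = 1 ∧ m = 4 ∨ p = 3 ∧ m = 2 ∨ p = 7 ∧ m = 1 := by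
  have hm : m ≠ 0 := by rintro rfl; omega
  have hp7 : p ≤ 7 := by nlinarith [Nat.pos_of_ne_zero hm]
  interval_cases p <;> omega

lemma exists_etaProdTransforms_half (hp : 0 < p) (hpm : m * (p + 1) = 8) :
    ∃ a : ℤ, 2 * a = p + 1 ∧ EtaProdTransforms p m a 1 p 2 1 := by
  have h0 := e_ne_zero (1 / 3)
  rcases pair_cases hp hpm with ⟨rfl, rfl⟩ | ⟨rfl, rfl⟩ | ⟨rfl, rfl⟩
  · refine ⟨1, by norm_num, ?_⟩
    have h := (etaProdTransforms_one (p := 1) (m := 4) (by norm_num) (by norm_num)).shift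
      (by norm_num) (by norm_num) 0 1 1 1 2 (by norm_num) (by norm_num) (by norm_num)
    rw [zero_add, zpow_one, inv_mul_cancel₀ h0] at h
    simpa using h
  · refine ⟨2, by norm_num, ?_⟩
    have h := etaProdTransforms_three (a := 2) (b := 1) (d := 2) (s := -1) (by norm_num) 1 1
      (by norm_num) (by norm_num) (by norm_num)
    rw [show (1 : ℤ) + 1 - -1 = 0 + 3 * 1 by norm_num, omega_zpow_add_three_mul] at h
    simpa using h
  · refine ⟨4, by norm_num, ?_⟩
    have h := etaProdTransforms_seven (a := 4) (b := 1) (d := 2) (by norm_num)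
    rw [show (4 : ℤ) + 2 = 0 + 3 * 2 by norm_num, omega_zpow_add_three_mul] at h
    norm_num at h
    exact h

lemma differentiableOn_susyDefect (hp : 0 < p) :
    DifferentiableOn ℂ (susyDefect p m) {τ : ℂ | 0 < τ.im} := by
  refine ((differentiableOn_twoF hp).add (differentiableOn_gam hp)).add ?_
  exact (differentiableOn_gam (m := m) hp).comp (f := fun τ : ℂ => τ + 1) (by fun_prop)
    (fun τ hτ => by simpa using hτ)

lemma expGrowth_susyDefect (hp : 0 < p) (hpm : m * (p + 1) = 8) :
    ExpGrowth π (susyDefect p m) := by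
  have h := (expGrowth_gam hp hpm).comp_affine one_pos 1
  simp only [mul_one, Complex.ofReal_one, one_mul] at h
  exact (((expGrowth_twoF hp hpm).mono Real.pi_pos.le).add (expGrowth_gam hp hpm)).add h

/-- Below height `1/20` there is an equivalent point of larger height. -/
lemma exists_raise (hp : 0 < p) (hpm : m * (p + 1) = 8) {τ : ℂ} (hτ : 0 < τ.im)
    (hle : τ.im ≤ 1 / 20) :
    ∃ τ' : ℂ, 8 / 7 * τ.im ≤ τ'.im ∧
      ‖susyDefect p m τ'‖ ^ 2 / τ'.im ^ m = ‖susyDefect p m τ‖ ^ 2 / τ.im ^ m := by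
  obtain ⟨a, ha, hE⟩ := exists_etaProdTransforms_half hp hpm
  have hy : τ.im * τ.im ≤ 1 / 400 := by nlinarith
  have key : ∃ n : ℤ, ∃ τ' : ℂ, 8 / 7 * (τ + n).im ≤ τ'.im ∧ ‖susyDefect p m τ'‖ ^ 2 / τ'.im ^ m =
      ‖susyDefect p m (τ + n)‖ ^ 2 / (τ + n).im ^ m := by
    have hF : ∀ n : ℤ, p * ((τ.re + n) * (τ.re + n) + 1 / 400) ≤ 7 / 8 →
        ∃ τ' : ℂ, 8 / 7 * (τ + n).im ≤ τ'.im ∧ ‖susyDefect p m τ'‖ ^ 2 / τ'.im ^ m =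
      ‖susyDefect p m (τ + n)‖ ^ 2 / (τ + n).im ^ m := fun n hn =>
      exists_raise_fricke hp hpm ha hE (by simpa using hτ) (by
        rw [Complex.normSq_apply]
        simp only [Complex.add_re, Complex.add_im, Complex.intCast_re, Complex.intCast_im, add_zero]
        refine le_trans (by gcongr) hn)
    -- For `p ≤ 3` the nearest integer translate has `|Re| ≤ 1/2`, and `3 (1/4 + 1/400) ≤ 7/8`, so
    -- the Fricke involution suffices.
    by_cases h3 : p ≤ 3
    · refine ⟨-round τ.re, hF _ ?_⟩
      have h1 := abs_le.1 (abs_sub_round τ.re)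
      have h2 : (p : ℝ) ≤ 3 := by exact_mod_cast h3
      push_cast
      have h4 : (τ.re - round τ.re) ^ 2 ≤ (1 / 2) ^ 2 := sq_le_sq' h1.1 h1.2
      calc _ ≤ (3 : ℝ) * ((1 / 2) ^ 2 + 1 / 400) := by
            refine mul_le_mul h2 ?_ (by nlinarith [sq_nonneg (τ.re + -round τ.re)]) (by norm_num)
            nlinarith
        _ ≤ _ := by norm_num
    · have h7 : p = 7 ∧ m = 1 := by rcases pair_cases hp hpm with h | h | h <;> omega
      obtain ⟨rfl, rfl⟩ := h7
      -- The real part is moved into `[-1/3, 2/3)`. Up to `1/3` the Fricke involution raises, as `7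
      -- (1/9 + 1/400) ≤ 7/8`. The remainder is within `1/6` of `1/2`, where `28 (1/36 + 1/400) ≤
      -- 7/8`.
      have h1 := Int.floor_le (τ.re + 1 / 3)
      have h2 := Int.lt_floor_add_one (τ.re + 1 / 3)
      refine ⟨-⌊τ.re + 1 / 3⌋, ?_⟩
      by_cases hx : τ.re - ⌊τ.re + 1 / 3⌋ ≤ 1 / 3
      · refine hF _ ?_
        push_cast
        nlinarith
      · refine exists_raise_seven (by simpa using hτ) ?_
        rw [Complex.normSq_apply]
        have e1 : (τ + (-⌊τ.re + 1 / 3⌋ : ℤ) - 1 / 2 : ℂ).re = τ.re - ⌊τ.re + 1 / 3⌋ - 1 / 2 := by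
          simp [sub_eq_add_neg]
        have e2 : (τ + (-⌊τ.re + 1 / 3⌋ : ℤ) - 1 / 2 : ℂ).im = τ.im := by simp
        rw [e1, e2]
        push Not at hx
        nlinarith
  obtain ⟨n, τ', h1, h2⟩ := key
  rw [susyDefect_add_intCast hpm] at h2
  simp only [Complex.add_im, Complex.intCast_im, add_zero] at h1 h2
  exact ⟨τ', h1, h2⟩

lemma im_eq_of_e_eq {τ q : ℂ} (h : e τ = q) : τ.im = -Real.log ‖q‖ / (2 * π) := by
  have := Real.pi_pos
  rw [← h, norm_e, Real.log_exp]
  field_simp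

lemma exists_e_eq {q : ℂ} (h0 : q ≠ 0) (h1 : ‖q‖ < 1) : ∃ τ : ℂ, 0 < τ.im ∧ e τ = q := by
  have hI := Complex.two_pi_I_ne_zero
  have h : e (Complex.log q / (2 * π * Complex.I)) = q := by
    rw [e, mul_div_cancel₀ _ hI, Complex.exp_log h0]
  refine ⟨_, ?_, h⟩
  rw [im_eq_of_e_eq h]
  have := Real.log_neg (norm_pos_iff.2 h0) h1
  have := Real.pi_pos
  apply div_pos <;> linarith

open Filter Topology in
-- Negative weight and holomorphy at the cusp force vanishing. The invariant `|Ψ|² / y^m` is bounded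
-- above height `1/20`, hence everywhere by raising. Thus `|Ψ|` is at most a multiple of `y^(m/2)`,
-- which tends to 0 as `|q| → 1`, and the maximum principle applies to `Ψ` as a function of `q`.
lemma susyDefect_eq_zero (hp : 0 < p) (hpm : m * (p + 1) = 8) {τ : ℂ} (hτ : 0 < τ.im) :
    susyDefect p m τ = 0 := by
  have hpi := Real.pi_pos
  have hm : m ≠ 0 := by rintro rfl; omega
  obtain ⟨F, hF, hφ⟩ := exists_cusp_extension (differentiableOn_susyDefect (m := m) hp)
    (fun τ _ => susyDefect_add_one hpm τ) (expGrowth_susyDefect hp hpm) (by linarith)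
  set r₀ := Real.exp (-(2 * π * (1 / 20))) with hr₀
  have hr₀1 : r₀ < 1 := by rw [hr₀, Real.exp_lt_one_iff]; nlinarith
  obtain ⟨C, hC⟩ := (isCompact_closedBall (0 : ℂ) r₀).exists_bound_of_continuousOn
    (hF.continuousOn.mono (Metric.closedBall_subset_ball hr₀1))
  have hhigh : ∀ τ : ℂ, 1 / 20 ≤ τ.im → ‖susyDefect p m τ‖ ^ 2 / τ.im ^ m ≤ C ^ 2 * 20 ^ m := by
    intro τ hτ
    have hτ0 : 0 < τ.im := by linarith
    have h1 : ‖susyDefect p m τ‖ ≤ C := by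
      rw [hφ τ hτ0]
      apply hC
      rw [mem_closedBall_zero_iff, norm_e, hr₀]
      gcongr
    have h2 : 1 ≤ 20 ^ m * τ.im ^ m := by
      rw [← mul_pow]; exact one_le_pow₀ (by linarith)
    rw [div_le_iff₀ (by positivity), mul_assoc]
    calc _ ≤ C ^ 2 * 1 := by rw [mul_one]; gcongr
      _ ≤ _ := by gcongr
  -- Induction on the number of raisings: each gains a factor `8/7`, so heights above `(7/8)^n / 20`
  -- need at most `n` of them.
  have hall : ∀ n : ℕ, ∀ τ : ℂ, (7 / 8) ^ n / 20 ≤ τ.im →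
      ‖susyDefect p m τ‖ ^ 2 / τ.im ^ m ≤ C ^ 2 * 20 ^ m := by
    intro n
    induction n with
    | zero => intro τ hτ; exact hhigh τ (by simpa using hτ)
    | succ n ih =>
      intro τ hτ
      rcases le_total (1 / 20) τ.im with h | h
      · exact hhigh τ h
      · have hτ0 : 0 < τ.im := lt_of_lt_of_le (by positivity) hτ
        obtain ⟨τ', h1, h2⟩ := exists_raise hp hpm hτ0 h
        rw [← h2]
        refine ih τ' ?_
        rw [pow_succ] at hτ
        linarith
  have hbound : ∀ q : ℂ, q ≠ 0 → ‖q‖ < 1 →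
      ‖F q‖ ≤ Real.sqrt (C ^ 2 * 20 ^ m * (-Real.log ‖q‖ / (2 * π)) ^ m) := by
    intro q hq0 hq1
    obtain ⟨τ, hτ, rfl⟩ := exists_e_eq hq0 hq1
    obtain ⟨n, hn⟩ := exists_pow_lt_of_lt_one (mul_pos hτ (by norm_num : (0 : ℝ) < 20))
      (by norm_num : (7 / 8 : ℝ) < 1)
    have h1 := hall n τ (by linarith)
    rw [div_le_iff₀ (by positivity)] at h1
    rw [← im_eq_of_e_eq rfl, ← hφ τ hτ]
    exact Real.le_sqrt_of_sq_le h1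
  have hmax : ∀ q : ℂ, ∀ r : ℝ, ‖q‖ < r → r < 1 →
      ‖F q‖ ≤ Real.sqrt (C ^ 2 * 20 ^ m * (-Real.log r / (2 * π)) ^ m) := by
    intro q r hqr hr1
    have hr : 0 < r := (norm_nonneg q).trans_lt hqr
    refine Complex.norm_le_of_forall_mem_frontier_norm_le (U := Metric.ball 0 r)
      Metric.isBounded_ball ?_ (fun z hz => ?_) (subset_closure (by simpa using hqr))
    · refine (hF.mono ?_).diffContOnCl
      rw [closure_ball _ hr.ne']
      exact Metric.closedBall_subset_ball hr1
    · rw [frontier_ball _ hr.ne', mem_sphere_zero_iff_norm] at hz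
      have := hbound z (norm_pos_iff.1 (hz ▸ hr)) (hz ▸ hr1)
      rwa [hz] at this
  have hzero : ∀ q : ℂ, ‖q‖ < 1 → F q = 0 := by
    intro q hq
    have hlim : Tendsto (fun r : ℝ => Real.sqrt (C ^ 2 * 20 ^ m * (-Real.log r / (2 * π)) ^ m))
        (𝓝[<] 1) (𝓝 0) := by
      have hc : ContinuousAt
          (fun r : ℝ => Real.sqrt (C ^ 2 * 20 ^ m * (-Real.log r / (2 * π)) ^ m)) 1 := by
        have := Real.continuousAt_log (one_ne_zero (α := ℝ))
        fun_prop
      have := hc.tendsto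
      simp only [Real.log_one, neg_zero, zero_div, zero_pow hm, mul_zero, Real.sqrt_zero] at this
      exact this.mono_left nhdsWithin_le_nhds
    have hev : ∀ᶠ r : ℝ in 𝓝[<] 1, ‖F q‖ ≤
        Real.sqrt (C ^ 2 * 20 ^ m * (-Real.log r / (2 * π)) ^ m) := by
      filter_upwards [Ioo_mem_nhdsLT hq] with r hr
      exact hmax q r hr.1 hr.2
    exact norm_le_zero_iff.1 (ge_of_tendsto hlim hev)
  rw [hφ τ hτ]
  apply hzero
  rw [norm_e, Real.exp_lt_one_iff]
  nlinarith [mul_pos hpi hτ]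

lemma gam_add_one_eq (hp : 0 < p) (hpm : m * (p + 1) = 8) {τ : ℂ} (hτ : 0 < τ.im) :
    gam p m (τ + 1) = -gam p m τ - twoF p m τ := by
  have := susyDefect_eq_zero hp hpm hτ
  rw [susyDefect] at this
  linear_combination this

end FakeMonster

end

open scoped Real

noncomputable section

namespace FakeMonster

open ModularForm (eta)

variable {p m : ℕ}

/-! ### Sums over residues -/

lemma sum_range_add_of_periodic {M : Type*} [AddCommGroup M] {φ : ℕ → M}
    (h : ∀ k, φ (k + p) = φ k) (c : ℕ) :
    ∑ k ∈ Finset.range p, φ (k + c) = ∑ k ∈ Finset.range p, φ k := by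
  induction c with
  | zero => simp
  | succ c ih =>
    have h1 := Finset.sum_range_succ (fun k => φ (k + c)) p
    rw [Finset.sum_range_succ'] at h1
    have h2 : φ (p + c) = φ (0 + c) := by rw [add_comm p c, h, zero_add]
    rw [h2] at h1
    rw [← ih, ← add_right_cancel h1]
    refine Finset.sum_congr rfl fun k _ => ?_
    congr 1
    ring

lemma sum_range_eq_sum_zmod {M : Type*} [AddCommMonoid M] [NeZero p] (φ : ℕ → M) :
    ∑ k ∈ Finset.range p, φ k = ∑ x : ZMod p, φ x.val :=
  Finset.sum_nbij' (fun k => (k : ZMod p)) ZMod.val (fun _ _ => Finset.mem_univ _)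
    (fun x _ => Finset.mem_range.2 x.val_lt)
    (fun _ hk => ZMod.val_cast_of_lt (Finset.mem_range.1 hk)) (fun x _ => ZMod.natCast_zmod_val x)
    (fun _ hk => by rw [ZMod.val_cast_of_lt (Finset.mem_range.1 hk)])

lemma eq_of_periodic_of_dvd {M : Type*} {φ : ℕ → M} (h : ∀ k, φ (k + p) = φ k) {a b : ℕ}
    (hab : a ≡ b [MOD p]) : φ a = φ b := by
  have h1 : ∀ a, φ (a % p) = φ a := fun a => Function.Periodic.map_mod_nat h a
  rw [← h1 a, ← h1 b, hab]

lemma sum_range_two_mul_of_periodic {M : Type*} [AddCommMonoid M] (hp : p.Prime) (h2 : p ≠ 2)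
    {φ : ℕ → M} (h : ∀ k, φ (k + p) = φ k) :
    ∑ k ∈ Finset.range p, φ (2 * k) = ∑ k ∈ Finset.range p, φ k := by
  have : Fact p.Prime := ⟨hp⟩
  have h20 : (2 : ZMod p) ≠ 0 := by
    intro h0
    have : p ∣ 2 := (ZMod.natCast_eq_zero_iff 2 p).1 (by exact_mod_cast h0)
    exact h2 ((Nat.prime_dvd_prime_iff_eq hp Nat.prime_two).1 this)
  rw [sum_range_eq_sum_zmod, sum_range_eq_sum_zmod]
  refine Fintype.sum_equiv (Equiv.mulLeft₀ (2 : ZMod p) h20) _ _ fun x => ?_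
  apply eq_of_periodic_of_dvd h
  rw [← ZMod.natCast_eq_natCast_iff]
  simp

lemma sum_range_filter_even {M : Type*} [AddCommMonoid M] (φ : ℕ → M) (n : ℕ) :
    ∑ j ∈ Finset.range (2 * n) with Even j, φ j = ∑ i ∈ Finset.range n, φ (2 * i) := by
  induction n with
  | zero => simp
  | succ n ih =>
    rw [Finset.sum_range_succ, ← ih, show 2 * (n + 1) = 2 * n + 1 + 1 by ring,
      Finset.sum_filter, Finset.sum_filter, Finset.sum_range_succ, Finset.sum_range_succ,
      if_pos (by simp), if_neg (by simp), add_zero]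

lemma sum_range_filter_odd {M : Type*} [AddCommMonoid M] (φ : ℕ → M) (n : ℕ) :
    ∑ j ∈ Finset.range (2 * n) with Odd j, φ j = ∑ i ∈ Finset.range n, φ (2 * i + 1) := by
  induction n with
  | zero => simp
  | succ n ih =>
    rw [Finset.sum_range_succ, ← ih, show 2 * (n + 1) = 2 * n + 1 + 1 by ring,
      Finset.sum_filter, Finset.sum_filter, Finset.sum_range_succ, Finset.sum_range_succ,
      if_neg (by simp), if_pos (by simp), add_zero]

lemma sum_range_pow_eq_zero {ζ : ℂ} (h1 : ζ ≠ 1) (hp : ζ ^ p = 1) :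
    ∑ i ∈ Finset.range p, ζ ^ i = 0 := by
  have h := mul_neg_geom_sum ζ p
  rw [hp, sub_self] at h
  exact (mul_eq_zero.1 h).resolve_left (sub_ne_zero.2 h1.symm)

lemma e_eq_one_iff {z : ℂ} : e z = 1 ↔ ∃ n : ℤ, z = n := by
  rw [e, Complex.exp_eq_one_iff]
  have := Complex.two_pi_I_ne_zero
  constructor
  · rintro ⟨n, hn⟩
    exact ⟨n, mul_left_cancel₀ this (by rw [hn, mul_comm])⟩
  · rintro ⟨n, rfl⟩
    exact ⟨n, by ring⟩

lemma e_rat_eq_one_iff {x : ℚ} : e x = 1 ↔ ∃ n : ℤ, x = n := by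
  rw [e_eq_one_iff]
  refine exists_congr fun n => ?_
  rw [← Rat.cast_intCast]
  exact Rat.cast_inj

lemma sum_range_e_eq_zero (hp : 0 < p) {k : ℤ} (hk : ¬ (p : ℤ) ∣ k) :
    ∑ i ∈ Finset.range p, e (i * (k / p)) = 0 := by
  have hp' : (p : ℂ) ≠ 0 := by exact_mod_cast hp.ne'
  simp_rw [e_nat_mul]
  refine sum_range_pow_eq_zero (fun h => hk ?_) ?_
  · obtain ⟨n, hn⟩ := e_eq_one_iff.1 h
    rw [div_eq_iff hp'] at hn
    exact ⟨n, by rw [mul_comm]; exact_mod_cast hn⟩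
  · rw [← e_nat_mul, mul_div_cancel₀ _ hp', e_intCast]

/-! ### The components of `X(τ/p)` -/

/-- The average of the functions `ε^(-2k) X((τ + 2k)/p)` over the residues `k` mod `p`. -/
def component (p : ℕ) (X : ℂ → ℂ) (ε : ℂ) (τ : ℂ) : ℂ :=
  (∑ k ∈ Finset.range p, (ε ^ (2 * k))⁻¹ * X ((τ + 2 * k) / p)) / p

lemma im_add_two_mul_div (hp : 0 < p) {τ : ℂ} (hτ : 0 < τ.im) (k : ℕ) :
    0 < ((τ + 2 * k) / p : ℂ).im := by
  have hp' : (0 : ℝ) < p := by exact_mod_cast hp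
  have : ((τ + 2 * k) / p : ℂ).im = τ.im / p := by simp
  rw [this]
  positivity

lemma lam_eq_component (p m j : ℕ) (τ : ℂ) :
    lam p m j τ = component p (delta p m) (e (j / (2 * p))) τ := by
  rw [lam, component]
  congr 1
  refine Finset.sum_congr rfl fun k _ => ?_
  rw [← e_nat_mul, ← e_neg]
  congr 2
  push_cast
  rcases eq_or_ne (p : ℂ) 0 with h | h
  · simp [h]
  · field_simp

/-- The index `k` is replaced by `2k`, a bijection mod the odd prime `p`. The summand has period `p`
in `k` because `f` has period 1 and `j` is even. -/
lemma g_eq_component (hp : p.Prime) (h2 : p ≠ 2)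
    (hf : ∀ τ : ℂ, 0 < τ.im → f p m (τ + 1) = f p m τ) {j : ℕ} (hj : Even j) {τ : ℂ}
    (hτ : 0 < τ.im) : g p m j τ = component p (f p m) (e (j / (2 * p))) τ := by
  have hp' : (p : ℂ) ≠ 0 := by exact_mod_cast hp.ne_zero
  obtain ⟨i, rfl⟩ := hj
  rw [g, component]
  congr 1
  rw [← sum_range_two_mul_of_periodic hp h2]
  · refine Finset.sum_congr rfl fun k _ => ?_
    rw [← e_nat_mul, ← e_neg]
    push_cast
    congr 2
    ring
  · intro k
    have him : 0 < ((τ + k) / p : ℂ).im := by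
      have hp' : (0 : ℝ) < p := by exact_mod_cast hp.pos
      have : ((τ + k) / p : ℂ).im = τ.im / p := by simp
      rw [this]
      positivity
    rw [show (τ + ((k + p : ℕ) : ℂ)) / p = (τ + k) / p + 1 by push_cast; field_simp; ring,
      hf _ him]
    congr 1
    rw [← e_add_intCast _ i]
    congr 1
    push_cast
    field_simp
    ring

/-- With `p = 2r + 1` one has `(τ + 1 + 2k)/p + 1 = (τ + 2(k + r + 1))/p`, so translation by 1 moves
the index by `r + 1`. -/
lemma component_add_one (hp : 0 < p) (hodd : Odd p) {X : ℂ → ℂ} {ε : ℂ} (hε : ε ^ (2 * p) = 1)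
    (hX : ∀ τ : ℂ, 0 < τ.im → X (τ + 1) = ε ^ p * X τ) {τ : ℂ} (hτ : 0 < τ.im) :
    component p X ε (τ + 1) = ε * component p X ε τ := by
  have hp' : (p : ℂ) ≠ 0 := by exact_mod_cast hp.ne'
  have hε0 : ε ≠ 0 := by
    rintro rfl
    rw [zero_pow (by omega)] at hε
    exact zero_ne_one hε
  obtain ⟨r, hr⟩ := hodd
  have hrC : (p : ℂ) = 2 * r + 1 := by exact_mod_cast hr
  rw [component, component, mul_div_assoc', Finset.mul_sum]
  congr 1
  rw [← sum_range_add_of_periodic (φ := fun k => ε * ((ε ^ (2 * k))⁻¹ * X ((τ + 2 * k) / p)))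
    _ (r + 1)]
  · refine Finset.sum_congr rfl fun k _ => ?_
    have h1 := hX _ (im_add_two_mul_div hp (show 0 < (τ + 1).im by simpa using hτ) k)
    rw [show (τ + 1 + 2 * k) / p + 1 = (τ + 2 * ((k + (r + 1) : ℕ) : ℂ)) / p by
      push_cast; field_simp; rw [hrC]; ring] at h1
    rw [h1, show 2 * (k + (r + 1)) = 2 * k + (p + 1) by omega, pow_add, pow_succ]
    field_simp
  · intro k
    have h1 := hX _ (im_add_two_mul_div hp hτ k)
    have h2 := hX _ (show 0 < ((τ + 2 * k) / p + 1 : ℂ).im by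
      simpa using im_add_two_mul_div hp hτ k)
    rw [h1, ← mul_assoc, ← pow_add, ← two_mul, hε, one_mul] at h2
    rw [show (τ + 2 * ((k + p : ℕ) : ℂ)) / p = (τ + 2 * k) / p + 1 + 1 by
      push_cast; field_simp; ring, h2, mul_add, pow_add, hε, mul_one]

lemma component_differentiableOn (hp : 0 < p) {X : ℂ → ℂ}
    (hX : DifferentiableOn ℂ X {τ : ℂ | 0 < τ.im}) (ε : ℂ) :
    DifferentiableOn ℂ (component p X ε) {τ : ℂ | 0 < τ.im} := by
  unfold component
  refine DifferentiableOn.div_const (DifferentiableOn.fun_sum fun k _ => ?_) _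
  exact (hX.comp (f := fun τ : ℂ => (τ + 2 * k) / p) (by fun_prop)
    (fun τ hτ => im_add_two_mul_div hp hτ k)).const_mul _

lemma expGrowth_component (hp : 0 < p) {K : ℝ} (hK : 0 ≤ K) {X : ℂ → ℂ} (hX : ExpGrowth K X)
    (ε : ℂ) : ExpGrowth K (component p X ε) := by
  have hp' : (0 : ℝ) < p := by exact_mod_cast hp
  have hp1 : (1 : ℝ) ≤ p := by exact_mod_cast hp
  have h : ∀ k ∈ Finset.range p,
      ExpGrowth K (fun τ => (ε ^ (2 * k))⁻¹ * X ((τ + 2 * k) / p)) := fun k _ => by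
    have h1 := (hX.comp_affine (inv_pos.2 hp') (2 * k / p)).mono
      (K' := K) (mul_le_of_le_one_right hK (inv_le_one_of_one_le₀ hp1))
    have h2 := h1.const_mul (ε ^ (2 * k))⁻¹
    convert h2 using 4
    push_cast
    ring
  have h3 := (ExpGrowth.sum _ h).const_mul (p : ℂ)⁻¹
  have h4 : component p X ε = fun τ => (p : ℂ)⁻¹ *
      ∑ k ∈ Finset.range p, (ε ^ (2 * k))⁻¹ * X ((τ + 2 * k) / p) := by
    ext τ
    rw [component, div_eq_inv_mul]
  rwa [h4]

/-! ### The functions `f`, `-f`, `-f`, `δ` attached to the elements of `(ℤ/2)²` -/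

/-- The components of the vector valued function for `II_{1,1}(2)`. -/
def xFun (p m : ℕ) (a : ZMod 2 × ZMod 2) (τ : ℂ) : ℂ :=
  if a = 0 then twoF p m τ / 2
  else if a = (1, 1) then twoF p m τ / 2 + gam p m τ
  else -(twoF p m τ / 2)

/-- The image of `xFun` under the involution `S`. -/
def zFun (p m : ℕ) (a : ZMod 2 × ZMod 2) (τ : ℂ) : ℂ :=
  if a = 0 then gam p m τ / 2
  else if a = (1, 1) then twoF p m τ + gam p m τ / 2
  else -(gam p m τ / 2)

lemma f_eq_xFun (hp : p.Prime) (hpm : m * (p + 1) = 8) : f p m = xFun p m 0 := by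
  ext τ
  rw [xFun, if_pos rfl, ← two_mul_f hp hpm]
  ring

lemma delta_eq_xFun (hp : p.Prime) (hpm : m * (p + 1) = 8) : delta p m = xFun p m (1, 1) := by
  ext τ
  rw [xFun, if_neg (by decide), if_pos rfl, ← two_mul_f hp hpm, delta]
  ring

lemma fOne_eq_xFun : fOne = xFun 1 4 0 := by
  ext τ
  rw [xFun, if_pos rfl, ← two_mul_fOne]
  ring

lemma deltaOne_eq_xFun : deltaOne = xFun 1 4 (1, 1) := by
  ext τ
  rw [xFun, if_neg (by decide), if_pos rfl, ← two_mul_fOne, deltaOne_eq]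
  ring

lemma xFun_eq_neg {a : ZMod 2 × ZMod 2} (h0 : a ≠ 0) (h1 : a ≠ (1, 1)) (τ : ℂ) :
    xFun p m a τ = -xFun p m 0 τ := by
  rw [xFun, if_neg h0, if_neg h1, xFun, if_pos rfl]

lemma xFun_add_one (hp : 0 < p) (hpm : m * (p + 1) = 8) (a : ZMod 2 × ZMod 2) {τ : ℂ}
    (hτ : 0 < τ.im) : xFun p m a (τ + 1) = (if a = (1, 1) then -1 else 1) * xFun p m a τ := by
  simp only [xFun, twoF_add_one hpm, gam_add_one_eq hp hpm hτ]
  rcases eq_or_ne a (1, 1) with rfl | h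
  · simp; ring
  · simp [h]

lemma xFun_differentiableOn (hp : 0 < p) (a : ZMod 2 × ZMod 2) :
    DifferentiableOn ℂ (xFun p m a) {τ : ℂ | 0 < τ.im} := by
  have h1 := differentiableOn_twoF (m := m) hp
  have h2 := differentiableOn_gam (m := m) hp
  unfold xFun
  split_ifs
  · exact h1.div_const 2
  · exact (h1.div_const 2).add h2
  · exact (h1.div_const 2).neg

lemma expGrowth_xFun (hp : 0 < p) (hpm : m * (p + 1) = 8) (a : ZMod 2 × ZMod 2) :
    ExpGrowth π (xFun p m a) := by
  have h1 := (expGrowth_twoF hp hpm).mono Real.pi_pos.le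
  have h2 := expGrowth_gam hp hpm
  unfold xFun
  split_ifs
  · simpa only [div_eq_inv_mul] using h1.const_mul 2⁻¹
  · simpa only [div_eq_inv_mul] using (h1.const_mul 2⁻¹).add h2
  · simpa only [div_eq_inv_mul, neg_mul] using h1.const_mul (-2⁻¹)

lemma xFun_fricke (hp : 0 < p) (a : ZMod 2 × ZMod 2) {τ : ℂ} (hτ : 0 < τ.im) :
    xFun p m a (-1 / (p * τ)) = ((Real.sqrt p * τ / Complex.I) ^ m)⁻¹ * zFun p m a τ := by
  simp only [xFun, zFun, twoF_fricke hp hτ, gam_fricke hp hτ]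
  split_ifs <;> ring

/-- If `4kl + 1 = pt`, then `(-1/τ + 2k)/p` is the image of `(τ + 2l)/p` under `(2k, -t; p, -2l)`,
which exchanges `2f` and `γ`. -/
lemma xFun_exchange (hp : p.Prime) (hpm : m * (p + 1) = 8) {k l : ℕ} (h : p ∣ 4 * k * l + 1)
    (a : ZMod 2 × ZMod 2) {τ : ℂ} (hτ : 0 < τ.im) :
    xFun p m a ((-1 / τ + 2 * k) / p) =
      residueSign p m l * (τ ^ m)⁻¹ * zFun p m a ((τ + 2 * l) / p) := by
  obtain ⟨t, ht⟩ := h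
  have hp' : (p : ℂ) ≠ 0 := by exact_mod_cast hp.ne_zero
  have h0 := ne_zero_of_im_pos hτ
  have hw := im_add_two_mul_div hp.pos hτ l
  have h1 := twoF_exchange hp hpm (k := k) (l := l) (t := t) (by exact_mod_cast ht) hw
  have h2 := gam_exchange hp hpm (k := k) (l := l) (t := t) (by exact_mod_cast ht) hw
  have htC : (4 : ℂ) * k * l + 1 = p * t := by exact_mod_cast ht
  have e1 : p * ((τ + 2 * l) / p) - 2 * (l : ℤ) = τ := by push_cast; field_simp; ring
  have e2 : (2 * (k : ℤ) * ((τ + 2 * l) / p) - (t : ℤ)) / τ = (-1 / τ + 2 * k) / p := by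
    push_cast; field_simp; linear_combination htC
  rw [e1, e2] at h1 h2
  simp only [xFun, zFun, h1, h2]
  split_ifs <;> ring

lemma xFun_neg_one_div (hp : 0 < p) (a : ZMod 2 × ZMod 2) {τ : ℂ} (hτ : 0 < τ.im) :
    xFun p m a (-1 / τ) =
      (Real.sqrt p : ℂ) ^ m * Complex.I ^ m * (τ ^ m)⁻¹ * zFun p m a (τ / p) := by
  have hp' : (p : ℂ) ≠ 0 := by exact_mod_cast hp.ne'
  have hs : (Real.sqrt p : ℂ) * Real.sqrt p = p := by
    rw [← Complex.ofReal_mul, Real.mul_self_sqrt (by positivity), Complex.ofReal_natCast]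
  have hs' : (Real.sqrt p : ℂ) ≠ 0 := fun h => hp' (by rw [← hs, h, zero_mul])
  have him : 0 < (τ / p).im := by simpa using im_add_two_mul_div hp hτ 0
  have h0 := ne_zero_of_im_pos hτ
  have h := xFun_fricke (m := m) hp a him
  rw [mul_div_cancel₀ _ hp', show Real.sqrt p * (τ / p) / Complex.I =
    (Real.sqrt p * Complex.I * τ⁻¹)⁻¹ by
      rw [← hs]; field_simp, inv_pow, inv_inv] at h
  rw [h]
  ring

/-- The bicharacter of the discriminant form of `II_{1,1}(2)`. -/
def planeBeta (a a' : ZMod 2 × ZMod 2) : ℂ := if a.1 * a'.2 + a.2 * a'.1 = 0 then 1 else -1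

/-- This explains the values `f, -f, -f, f + γ`: their finite Fourier transform is, up to the factor
2, the same vector with `2f` and `γ` exchanged, which is also what the substitutions underlying `S`
produce. -/
lemma sum_planeBeta_xFun (a : ZMod 2 × ZMod 2) (τ : ℂ) :
    ∑ a', planeBeta a a' * xFun p m a' τ = 2 * zFun p m a τ := by
  have h : (Finset.univ : Finset (ZMod 2 × ZMod 2)) = {0, (1, 0), (0, 1), (1, 1)} := by decide
  rw [h, Finset.sum_insert (by decide), Finset.sum_insert (by decide),
    Finset.sum_insert (by decide), Finset.sum_singleton]
  have ha : a ∈ (Finset.univ : Finset (ZMod 2 × ZMod 2)) := Finset.mem_univ a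
  rw [h] at ha
  simp only [Finset.mem_insert, Finset.mem_singleton] at ha
  rcases ha with rfl | rfl | rfl | rfl <;>
    simp +decide [xFun, zFun, planeBeta] <;> ring

end FakeMonster

end

open scoped Real

noncomputable section

namespace FakeMonster

variable {p m : ℕ}

/-! ### Quadratic characters of finite abelian groups -/

/-- A nondegenerate quadratic function `ε` with values in `ℂˣ` and its bicharacter `β`. -/
structure IsQuadraticCharacter {G : Type*} [AddCommGroup G] (ε : G → ℂ) (β : G → G → ℂ) :
    Prop where
  add : ∀ x y, ε (x + y) = ε x * ε y * β x y
  beta_add : ∀ x y z, β x (y + z) = β x y * β x z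
  beta_comm : ∀ x y, β x y = β y x
  beta_self : ∀ x, β x x = ε x ^ 2
  ne_zero : ∀ x, ε x ≠ 0
  nondegenerate : ∀ x, (∀ y, β x y = 1) → x = 0

namespace IsQuadraticCharacter

variable {G : Type*} [AddCommGroup G] {ε : G → ℂ} {β : G → G → ℂ} (h : IsQuadraticCharacter ε β)

include h

lemma beta_ne_zero (x y : G) : β x y ≠ 0 := by
  intro h0
  have := h.add x y
  rw [h0, mul_zero] at this
  exact h.ne_zero _ this

lemma beta_zero (x : G) : β x 0 = 1 := by
  have h1 := h.beta_add x 0 0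
  rw [add_zero] at h1
  exact mul_left_cancel₀ (h.beta_ne_zero x 0) (by rw [← h1, mul_one])

lemma zero_beta (x : G) : β 0 x = 1 := by rw [h.beta_comm, h.beta_zero]

lemma eps_zero : ε 0 = 1 := by
  have h1 := h.add 0 0
  rw [add_zero, h.beta_zero, mul_one] at h1
  exact mul_left_cancel₀ (h.ne_zero 0) (by rw [← h1, mul_one])

lemma beta_nsmul (x y : G) (n : ℕ) : β x (n • y) = β x y ^ n := by
  induction n with
  | zero => simp [h.beta_zero]
  | succ n ih => rw [succ_nsmul, h.beta_add, ih, pow_succ]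

lemma eps_nsmul (x : G) (n : ℕ) : ε (n • x) = ε x ^ (n ^ 2) := by
  induction n with
  | zero => simp [h.eps_zero]
  | succ n ih =>
    rw [succ_nsmul, h.add, ih, h.beta_comm, h.beta_nsmul, h.beta_self]
    ring

lemma beta_pow_eq_one {n : ℕ} (hn : ∀ x, ε x ^ n = 1) (x y : G) : β x y ^ n = 1 := by
  have h1 := congrArg (· ^ n) (h.add x y)
  simp only [mul_pow, hn, one_mul] at h1
  exact h1.symm

lemma sum_beta_inv [Fintype G] [DecidableEq G] (x : G) :
    ∑ y, (β x y)⁻¹ = if x = 0 then (Fintype.card G : ℂ) else 0 := by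
  split_ifs with hx
  · simp [hx, h.zero_beta]
  · have h1 : ∃ y, β x y ≠ 1 := by
      by_contra! h1
      exact hx (h.nondegenerate x h1)
    obtain ⟨z, hz⟩ := h1
    have h2 : ∑ y, (β x y)⁻¹ = (β x z)⁻¹ * ∑ y, (β x y)⁻¹ := by
      conv_lhs => rw [← Equiv.sum_comp (Equiv.addRight z)]
      simp only [Equiv.coe_addRight, h.beta_add, mul_inv, ← Finset.sum_mul]
      ring
    have h3 : ((β x z)⁻¹ - 1) * ∑ y, (β x y)⁻¹ = 0 := by rw [sub_mul, ← h2]; ring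
    refine (mul_eq_zero.1 h3).resolve_left (sub_ne_zero.2 fun h4 => hz ?_)
    rw [inv_eq_one] at h4
    exact h4

/-- Completing the square in a Gauss sum. -/
lemma sum_gauss [Fintype G] (hexp : ∀ x, ε x ^ p = 1) {k l : ℕ} (hkl : p ∣ 4 * k * l + 1) (x : G) :
    ∑ y, (β x y)⁻¹ * (ε y ^ (2 * l))⁻¹ = (ε x ^ (2 * k))⁻¹ * ∑ y, (ε y ^ (2 * l))⁻¹ := by
  obtain ⟨t, ht⟩ := hkl
  -- Replacing `y` by `y + 2kx` creates the cross term `β(x,y)^(4kl)` beside `β(x,y)`; their product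
  -- is 1 because `p ∣ 4kl + 1`.
  rw [← Equiv.sum_comp (Equiv.addRight ((2 * k) • x)), Finset.mul_sum]
  refine Finset.sum_congr rfl fun y _ => ?_
  rw [Equiv.coe_addRight, h.beta_add, h.add, h.beta_nsmul, h.beta_nsmul, h.eps_nsmul, h.beta_self,
    h.beta_comm y x, ← mul_inv, ← mul_inv, inv_inj]
  have e1 : β x y * (β x y ^ (2 * k)) ^ (2 * l) = 1 := by
    rw [← pow_mul, ← pow_succ', show 2 * k * (2 * l) + 1 = 4 * k * l + 1 by ring, ht, pow_mul,
      h.beta_pow_eq_one hexp, one_pow]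
  have e2 : (ε x ^ 2) ^ (2 * k) * (ε x ^ (2 * k) ^ 2) ^ (2 * l) = ε x ^ (2 * k) := by
    rw [← pow_mul, ← pow_mul, ← pow_add,
      show 2 * (2 * k) + (2 * k) ^ 2 * (2 * l) = (4 * k * l + 1) * (2 * k) + 2 * k by ring, ht,
      pow_add, mul_assoc, pow_mul, hexp, one_pow, one_mul]
  linear_combination (ε y ^ (2 * l) * (ε x ^ 2) ^ (2 * k) * (ε x ^ (2 * k) ^ 2) ^ (2 * l)) * e1 +
    ε y ^ (2 * l) * e2

end IsQuadraticCharacter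

/-! ### The vector valued modular form attached to a quadratic character -/

variable {G : Type*} [AddCommGroup G] [DecidableEq G]

/-- The vector valued function with components indexed by `(ℤ/2)² × G`. -/
def vectorForm (p m : ℕ) (ε : G → ℂ) (a : ZMod 2 × ZMod 2) (b : G) (τ : ℂ) : ℂ :=
  (if b = 0 then xFun p m a τ else 0) + component p (xFun p m a) (ε b) τ

lemma sum_planeBeta_component (ε : ℂ) (a : ZMod 2 × ZMod 2) (τ : ℂ) :
    ∑ a', planeBeta a a' * component p (xFun p m a') ε τ =
      2 * component p (zFun p m a) ε τ := by
  simp only [component, ← mul_div_assoc, Finset.mul_sum, ← Finset.sum_div]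
  rw [Finset.sum_comm]
  congr 1
  refine Finset.sum_congr rfl fun k _ => ?_
  rw [mul_left_comm, ← sum_planeBeta_xFun, Finset.mul_sum]
  refine Finset.sum_congr rfl fun a' _ => ?_
  ring

open IsQuadraticCharacter in
/-- The transformation under `S` of the vector valued function, in terms of Gauss sums. -/
theorem vectorForm_neg_one_div [Fintype G] (hp : p.Prime) (hpm : m * (p + 1) = 8) {ε : G → ℂ}
    {β : G → G → ℂ} (h : IsQuadraticCharacter ε β) (hexp : ∀ x, ε x ^ p = 1)
    (hcard : Fintype.card G = p ^ (2 + m))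
    (hgauss : ∀ l : ℕ, ¬ p ∣ l → Complex.I ^ m * ∑ y, (ε y ^ (2 * l))⁻¹ =
      (Real.sqrt p : ℂ) ^ (2 + m) * residueSign p m l)
    (a : ZMod 2 × ZMod 2) (b : G) {τ : ℂ} (hτ : 0 < τ.im) :
    vectorForm p m ε a b (-1 / τ) =
      Complex.I ^ m / (2 * (Real.sqrt p : ℂ) ^ (2 + m)) * (τ ^ m)⁻¹ *
        ∑ a', ∑ b', planeBeta a a' * (β b b')⁻¹ * vectorForm p m ε a' b' τ := by
  have hp' : (p : ℂ) ≠ 0 := by exact_mod_cast hp.ne_zero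
  have : Fact p.Prime := ⟨hp⟩
  have hs : (Real.sqrt p : ℂ) ^ 2 = p := by
    rw [← Complex.ofReal_pow, Real.sq_sqrt (by positivity), Complex.ofReal_natCast]
  have hs' : (Real.sqrt p : ℂ) ≠ 0 := fun h => hp' (by rw [← hs, h]; simp)
  have h0 := ne_zero_of_im_pos hτ
  have hI := Complex.I_ne_zero
  set R := (Real.sqrt p : ℂ) ^ (2 + m) with hR
  have hR0 : R ≠ 0 := pow_ne_zero _ hs'
  have h4 : (4 : ZMod p) ≠ 0 := by
    have h2 : p ≠ 2 := by rcases prime_cases hp hpm with h | h <;> omega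
    intro h4
    have h5 : p ∣ 2 ^ 2 := (ZMod.natCast_eq_zero_iff 4 p).1 (by exact_mod_cast h4)
    exact h2 ((Nat.prime_dvd_prime_iff_eq hp Nat.prime_two).1 (hp.dvd_of_dvd_pow h5))
  -- the sum over `a'` and the terms coming from `b' = 0`
  have hsum : ∑ a', ∑ b', planeBeta a a' * (β b b')⁻¹ * vectorForm p m ε a' b' τ =
      2 * (zFun p m a τ + ∑ b', (β b b')⁻¹ * component p (zFun p m a) (ε b') τ) := by
    rw [Finset.sum_comm]
    have e1 : ∀ b', ∑ a', planeBeta a a' * (β b b')⁻¹ * vectorForm p m ε a' b' τ =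
        2 * ((if b' = 0 then zFun p m a τ else 0) +
          (β b b')⁻¹ * component p (zFun p m a) (ε b') τ) := by
      intro b'
      simp only [vectorForm, mul_add, Finset.sum_add_distrib]
      have e2 := sum_planeBeta_component (p := p) (m := m) (ε b') a τ
      have e3 : ∑ a', planeBeta a a' * (β b b')⁻¹ * component p (xFun p m a') (ε b') τ =
          2 * ((β b b')⁻¹ * component p (zFun p m a) (ε b') τ) := by
        rw [mul_left_comm, ← e2, Finset.mul_sum]
        exact Finset.sum_congr rfl fun _ _ => by ring
      rw [e3]
      congr 1
      split_ifs with hb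
      · rw [← sum_planeBeta_xFun, hb, h.beta_zero]
        simp
      · simp
    simp_rw [e1]
    rw [← Finset.mul_sum, Finset.sum_add_distrib, Finset.sum_ite_eq' Finset.univ 0]
    simp
  rw [hsum]
  -- the sum over `b'` for a fixed residue
  set Φ : ZMod p → ℂ := fun k => (∑ b', (β b b')⁻¹ * (ε b' ^ (2 * k.val))⁻¹) *
    zFun p m a ((τ + 2 * k.val) / p) with hΦ
  have hcomp : ∑ b', (β b b')⁻¹ * component p (zFun p m a) (ε b') τ = (∑ k, Φ k) / p := by
    simp only [component, ← mul_div_assoc, Finset.mul_sum, ← Finset.sum_div]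
    rw [Finset.sum_comm, sum_range_eq_sum_zmod (p := p) (fun k => ∑ b', (β b b')⁻¹ *
      ((ε b' ^ (2 * k))⁻¹ * zFun p m a ((τ + 2 * k) / p)))]
    congr 1
    refine Finset.sum_congr rfl fun k _ => ?_
    simp only [hΦ, Finset.sum_mul]
    exact Finset.sum_congr rfl fun _ _ => by ring
  set Ψ : ZMod p → ℂ := fun k => (ε b ^ (2 * k.val))⁻¹ *
    xFun p m a ((-1 / τ + 2 * k.val) / p) with hΨ
  have hleft : component p (xFun p m a) (ε b) (-1 / τ) = (∑ k, Ψ k) / p := by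
    rw [component, sum_range_eq_sum_zmod (p := p) (fun k => (ε b ^ (2 * k))⁻¹ *
      xFun p m a ((-1 / τ + 2 * k) / p))]
  -- The pairing `4kl ≡ -1` of residues in `xFun_exchange`. The convention `0⁻¹ = 0` makes it an
  -- involution of all of `ZMod p` that fixes 0.
  let σ : Equiv.Perm (ZMod p) := Function.Involutive.toPerm (fun k => -(4 * k)⁻¹) (fun k => by
    rcases eq_or_ne k 0 with rfl | hk
    · simp
    · field_simp)
  have hσ : ∀ k, σ k = -(4 * k)⁻¹ := fun k => rfl
  have hσ0 : σ 0 = 0 := by simp [hσ]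
  have hterm : ∀ k, k ≠ 0 → Ψ k = Complex.I ^ m / R * (τ ^ m)⁻¹ * Φ (σ k) := by
    intro k hk
    have hσk : σ k ≠ 0 := by rw [hσ]; simp [h4, hk]
    have hdvd : p ∣ 4 * k.val * (σ k).val + 1 := by
      rw [← ZMod.natCast_eq_zero_iff]
      push_cast
      rw [ZMod.natCast_zmod_val, ZMod.natCast_zmod_val, hσ, mul_neg,
        mul_inv_cancel₀ (mul_ne_zero h4 hk)]
      ring
    have hnd : ¬ p ∣ (σ k).val := by
      rw [← ZMod.natCast_eq_zero_iff, ZMod.natCast_zmod_val]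
      exact hσk
    simp only [hΦ, hΨ]
    rw [xFun_exchange hp hpm hdvd a hτ, h.sum_gauss hexp hdvd]
    have hg := hgauss _ hnd
    rw [div_mul_eq_mul_div, div_mul_eq_mul_div, eq_div_iff hR0]
    linear_combination -((ε b ^ (2 * k.val))⁻¹ * (τ ^ m)⁻¹ *
      zFun p m a ((τ + 2 * (σ k).val) / p)) * hg
  have hsplitΨ : ∑ k, Ψ k = Ψ 0 + ∑ k ∈ Finset.univ.erase 0, Ψ k :=
    (Finset.add_sum_erase _ _ (Finset.mem_univ 0)).symm
  have hsplitΦ : ∑ k, Φ k = Φ 0 + ∑ k ∈ Finset.univ.erase 0, Φ (σ k) := by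
    rw [← Equiv.sum_comp σ, ← Finset.add_sum_erase _ _ (Finset.mem_univ 0), hσ0]
  have hterms : ∑ k ∈ Finset.univ.erase 0, Ψ k =
      Complex.I ^ m / R * (τ ^ m)⁻¹ * ∑ k ∈ Finset.univ.erase 0, Φ (σ k) := by
    rw [Finset.mul_sum]
    exact Finset.sum_congr rfl fun k hk => hterm k (Finset.ne_of_mem_erase hk)
  -- the terms of residue zero
  have hΨ0 : Ψ 0 = p * (Complex.I ^ m / R * (τ ^ m)⁻¹ * zFun p m a τ) := by
    simp only [hΨ, ZMod.val_zero, Nat.cast_zero, mul_zero, pow_zero, add_zero, inv_one, one_mul]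
    rw [show -1 / τ / p = -1 / (p * τ) by field_simp, xFun_fricke hp.pos a hτ, hR, pow_add, hs,
      div_pow, mul_pow]
    field_simp
  -- The reason for the extra term at `b = 0`: by orthogonality of characters the residue zero sum
  -- on the right is supported at `b = 0` and matches the isolated term on the left. Conversely,
  -- `hΨ0` matches the residue zero term on the left with the isolated term on the right.
  have hΦ0 : (if b = 0 then xFun p m a (-1 / τ) else 0) =
      Complex.I ^ m / R * (τ ^ m)⁻¹ * (Φ 0 / p) := by
    simp only [hΦ, ZMod.val_zero, Nat.cast_zero, mul_zero, pow_zero, add_zero, inv_one, mul_one]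
    rw [h.sum_beta_inv]
    split_ifs with hb
    · rw [xFun_neg_one_div hp.pos a hτ, hcard, hR]
      push_cast
      rw [pow_add (p : ℂ), ← hs]
      field_simp
      ring
    · simp
  rw [vectorForm, hleft, hcomp, hsplitΨ, hsplitΦ, hterms, hΨ0, hΦ0]
  field_simp
  ring

end FakeMonster

end

open scoped Real

noncomputable section

namespace FakeMonster

variable {p m : ℕ}

/-! ### Supersymmetry and the decompositions of `f(τ/p)` and `δ(τ/p)` -/

lemma e_half : e (1 / 2) = -1 := by
  rw [e, show 2 * (π : ℂ) * Complex.I * (1 / 2) = π * Complex.I by ring, Complex.exp_pi_mul_I]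

lemma e_div_pow (hp : 0 < p) (j : ℕ) : e (j / (2 * p)) ^ p = (-1) ^ j := by
  have hp' : (p : ℂ) ≠ 0 := by exact_mod_cast hp.ne'
  rw [← e_nat_mul, ← e_half, ← e_nat_mul]
  congr 1
  field_simp

lemma e_div_pow_two_mul (hp : 0 < p) (j : ℕ) : e (j / (2 * p)) ^ (2 * p) = 1 := by
  rw [mul_comm 2 p, pow_mul, e_div_pow hp, ← pow_mul, mul_comm, pow_mul]
  simp

lemma xFun_hasExpansionMod (hp : 0 < p) (hpm : m * (p + 1) = 8) :
    HasExpansionMod (1 / 2) (xFun p m (1, 1)) := by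
  refine hasExpansionMod_of_expGrowth (xFun_differentiableOn hp _) (fun τ hτ => ?_)
    (expGrowth_xFun hp hpm _)
  rw [xFun_add_one hp hpm _ hτ, if_pos rfl]
  push_cast
  rw [e_half]

theorem delta_hasExpansionMod (hp : p.Prime) (hpm : m * (p + 1) = 8) :
    HasExpansionMod (1 / 2) (delta p m) := by
  rw [delta_eq_xFun hp hpm]
  exact xFun_hasExpansionMod hp.pos hpm

theorem deltaOne_hasExpansionMod : HasExpansionMod (1 / 2) deltaOne := by
  rw [deltaOne_eq_xFun]
  exact xFun_hasExpansionMod one_pos (by norm_num)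

lemma f_add_one (hp : p.Prime) (hpm : m * (p + 1) = 8) {τ : ℂ} (hτ : 0 < τ.im) :
    f p m (τ + 1) = f p m τ := by
  rw [f_eq_xFun hp hpm, xFun_add_one hp.pos hpm _ hτ, if_neg (by decide), one_mul]

lemma odd_of_pair (hp : p.Prime) (hpm : m * (p + 1) = 8) : Odd p := by
  rcases prime_cases hp hpm with ⟨rfl, rfl⟩ | ⟨rfl, rfl⟩ <;> decide

lemma g_eq (hp : p.Prime) (hpm : m * (p + 1) = 8) {j : ℕ} (hj : Even j) {τ : ℂ} (hτ : 0 < τ.im) :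
    g p m j τ = component p (xFun p m 0) (e (j / (2 * p))) τ := by
  rw [← f_eq_xFun hp hpm]
  refine g_eq_component hp ?_ (fun τ hτ => f_add_one hp hpm hτ) hj hτ
  rintro rfl
  exact absurd (odd_of_pair hp hpm) (by decide)

lemma lam_eq (hp : p.Prime) (hpm : m * (p + 1) = 8) (j : ℕ) (τ : ℂ) :
    lam p m j τ = component p (xFun p m (1, 1)) (e (j / (2 * p))) τ := by
  rw [← delta_eq_xFun hp hpm, lam_eq_component]

lemma hasExpansionMod_congr {r : ℚ} {φ ψ : ℂ → ℂ} (h : HasExpansionMod r φ)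
    (hφ : ∀ τ : ℂ, 0 < τ.im → ψ τ = φ τ) : HasExpansionMod r ψ := by
  obtain ⟨a, n₀, ha, hs⟩ := h
  exact ⟨a, n₀, ha, fun τ hτ => by rw [hφ τ hτ]; exact hs τ hτ⟩

lemma component_hasExpansionMod (hp : p.Prime) (hpm : m * (p + 1) = 8) (j : ℕ)
    (a : ZMod 2 × ZMod 2) (ha : (if a = (1, 1) then -1 else 1 : ℂ) = (-1) ^ j) :
    HasExpansionMod ((j : ℚ) / (2 * p)) (component p (xFun p m a) (e (j / (2 * p)))) := by
  refine hasExpansionMod_of_expGrowth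
    (component_differentiableOn hp.pos (xFun_differentiableOn hp.pos _) _) (fun τ hτ => ?_)
    (expGrowth_component hp.pos Real.pi_pos.le (expGrowth_xFun hp.pos hpm a) _)
  rw [component_add_one hp.pos (odd_of_pair hp hpm) (e_div_pow_two_mul hp.pos j) _ hτ]
  · push_cast; rfl
  · intro τ hτ
    rw [xFun_add_one hp.pos hpm _ hτ, e_div_pow hp.pos, ha]

theorem g_hasExpansionMod (hp : p.Prime) (hpm : m * (p + 1) = 8) {j : ℕ} (hj : Even j) :
    HasExpansionMod ((j : ℚ) / (2 * p)) (g p m j) :=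
  hasExpansionMod_congr (component_hasExpansionMod hp hpm j 0
    (by rw [if_neg (by decide), hj.neg_one_pow])) fun _ hτ => g_eq hp hpm hj hτ

theorem lam_hasExpansionMod (hp : p.Prime) (hpm : m * (p + 1) = 8) {j : ℕ} (hj : Odd j) :
    HasExpansionMod ((j : ℚ) / (2 * p)) (lam p m j) :=
  hasExpansionMod_congr (component_hasExpansionMod hp hpm j (1, 1)
    (by rw [if_pos rfl, hj.neg_one_pow])) fun τ _ => lam_eq hp hpm j τ

/-- After interchanging the sums, the sum over `p`-th roots of unity kills every `k ≠ 0`. -/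
lemma sum_sum_range_eq (hp : 0 < p) {c : ℕ → ℤ} (hc0 : c 0 = 0)
    (hc : ∀ k ∈ Finset.range p, k ≠ 0 → ¬ (p : ℤ) ∣ c k) {φ ψ : ℕ → ℂ} (hψ : ψ 0 = 1) :
    ∑ i ∈ Finset.range p, (∑ k ∈ Finset.range p, ψ k * e (i * (c k / p)) * φ k) / p = φ 0 := by
  have hp' : (p : ℂ) ≠ 0 := by exact_mod_cast hp.ne'
  rw [← Finset.sum_div, Finset.sum_comm, div_eq_iff hp',
    Finset.sum_eq_single_of_mem 0 (Finset.mem_range.2 hp)]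
  · simp [hc0, hψ, e_zero, mul_comm]
  · intro k hk hk0
    rw [← Finset.sum_mul, ← Finset.mul_sum, sum_range_e_eq_zero hp (hc k hk hk0)]
    simp

theorem f_div_eq_sum (hp : p.Prime) (τ : ℂ) :
    f p m (τ / p) = ∑ j ∈ Finset.range (2 * p) with Even j, g p m j τ := by
  have hp' : (p : ℂ) ≠ 0 := by exact_mod_cast hp.ne_zero
  rw [sum_range_filter_even]
  have h := sum_sum_range_eq hp.pos (c := fun k => -(k : ℤ)) (by simp)
    (fun k hk hk0 hd => by
      rw [Int.dvd_neg, Int.natCast_dvd_natCast] at hd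
      exact absurd (Nat.le_of_dvd (Nat.pos_of_ne_zero hk0) hd)
        (not_le.2 (Finset.mem_range.1 hk)))
    (φ := fun k => f p m ((τ + k) / p)) (ψ := fun _ => 1) rfl
  simp only [Nat.cast_zero, add_zero] at h
  rw [← h]
  refine Finset.sum_congr rfl fun i _ => ?_
  rw [g]
  congr 1
  refine Finset.sum_congr rfl fun k _ => ?_
  rw [one_mul]
  congr 2
  push_cast
  field_simp

theorem delta_div_eq_sum (hp : p.Prime) (hpm : m * (p + 1) = 8) (τ : ℂ) :
    delta p m (τ / p) = ∑ j ∈ Finset.range (2 * p) with Odd j, lam p m j τ := by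
  have hp' : (p : ℂ) ≠ 0 := by exact_mod_cast hp.ne_zero
  rw [sum_range_filter_odd]
  -- For `j = 2i + 1` the phase `e(-jk/p)` splits into `e(-k/p)`, which becomes `ψ`, and
  -- `e(-2ik/p)`, over which the sum on `i` runs.
  have h := sum_sum_range_eq hp.pos (c := fun k => -(2 * k : ℤ)) (by simp)
    (fun k hk hk0 hd => by
      rw [Int.dvd_neg] at hd
      have hd : p ∣ 2 * k := by exact_mod_cast hd
      rcases hp.dvd_mul.1 hd with h2 | hd
      · have := (Nat.prime_dvd_prime_iff_eq hp Nat.prime_two).1 h2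
        rcases prime_cases hp hpm with h | h <;> omega
      · exact absurd (Nat.le_of_dvd (Nat.pos_of_ne_zero hk0) hd)
          (not_le.2 (Finset.mem_range.1 hk)))
    (φ := fun k => delta p m ((τ + 2 * k) / p)) (ψ := fun k => e (-k / p)) (by simp [e_zero])
  simp only [Nat.cast_zero, mul_zero, add_zero] at h
  rw [← h]
  refine Finset.sum_congr rfl fun i _ => ?_
  rw [lam]
  congr 1
  refine Finset.sum_congr rfl fun k _ => ?_
  rw [← e_add]
  congr 2
  push_cast
  field_simp
  ring

/-! ### The transformation of the vector valued function under `T` -/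

variable {G : Type*} [AddCommGroup G] [DecidableEq G]

lemma vectorForm_add_one (hp : p.Prime) (hpm : m * (p + 1) = 8) {ε : G → ℂ} (h0 : ε 0 = 1)
    (hexp : ∀ x, ε x ^ p = 1) (a : ZMod 2 × ZMod 2) (b : G) {τ : ℂ} (hτ : 0 < τ.im) :
    vectorForm p m ε a b (τ + 1) =
      (if a = (1, 1) then -1 else 1) * ε b * vectorForm p m ε a b τ := by
  have hodd := odd_of_pair hp hpm
  set s : ℂ := if a = (1, 1) then -1 else 1 with hs
  have hsp : s ^ p = s := by
    rw [hs]; split_ifs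
    · exact hodd.neg_one_pow
    · exact one_pow p
  have hs2 : s ^ 2 = 1 := by rw [hs]; split_ifs <;> norm_num
  have h1 : component p (xFun p m a) (ε b) (τ + 1) =
      s * ε b * component p (xFun p m a) (ε b) τ := by
    -- A component depends only on the square of its parameter. The sign `s` can thus be inserted,
    -- and `(s ε(b))^p = s` is the multiplier of `xFun`.
    have h2 : ∀ τ, component p (xFun p m a) (ε b) τ =
        component p (xFun p m a) (s * ε b) τ := by
      intro τ
      rw [component, component]
      congr 1
      refine Finset.sum_congr rfl fun k _ => ?_
      rw [mul_pow, pow_mul s, hs2, one_pow, one_mul]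
    rw [h2, h2]
    refine component_add_one hp.pos hodd ?_ (fun τ hτ => ?_) hτ
    · rw [mul_pow, pow_mul s, hs2, one_pow, one_mul, mul_comm, pow_mul, hexp, one_pow]
    · rw [xFun_add_one hp.pos hpm _ hτ, mul_pow, hexp, mul_one, hsp]
  rw [vectorForm, vectorForm, h1, mul_add]
  congr 1
  split_ifs with hb
  · rw [xFun_add_one hp.pos hpm _ hτ, hb, h0, mul_one]
  · simp

lemma vectorForm_isHolomorphic (hp : p.Prime) (hpm : m * (p + 1) = 8) {ε : G → ℂ} (h0 : ε 0 = 1)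
    (hexp : ∀ x, ε x ^ p = 1) (a : ZMod 2 × ZMod 2) (b : G) :
    IsHolomorphicMeromorphicAtCusp (vectorForm p m ε a b) := by
  refine isHolomorphicMeromorphicAtCusp_of_expGrowth (N := 2 * p) (K := π)
    (by have := hp.pos; omega) ?_ (fun τ hτ => ?_) ?_
  · have h1 := component_differentiableOn hp.pos (xFun_differentiableOn (m := m) hp.pos a) (ε b)
    have h2 := xFun_differentiableOn (m := m) hp.pos a
    unfold vectorForm
    split_ifs
    · exact h2.add h1
    · simpa using h1
  · have h1 : ∀ n : ℕ, vectorForm p m ε a b (τ + n) =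
        ((if a = (1, 1) then -1 else 1) * ε b) ^ n * vectorForm p m ε a b τ := by
      intro n
      induction n with
      | zero => simp
      | succ n ih =>
        rw [Nat.cast_succ, ← add_assoc, vectorForm_add_one hp hpm h0 hexp _ _ (by simpa using hτ),
          ih]
        ring
    have h2 : ((if a = (1, 1) then -1 else 1 : ℂ)) ^ 2 = 1 := by split_ifs <;> norm_num
    rw [h1, mul_pow, pow_mul, h2, one_pow, mul_comm 2 p, pow_mul, hexp, one_pow, one_mul, one_mul]
  · have h1 := expGrowth_component hp.pos Real.pi_pos.le (expGrowth_xFun hp.pos hpm a) (ε b)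
    have h2 := expGrowth_xFun hp.pos hpm a
    unfold vectorForm
    split_ifs
    · exact h2.add h1
    · simpa using h1

end FakeMonster

end

open scoped Real

noncomputable section

namespace FakeMonster

/-! ### Discriminant forms of even lattices -/

section Discriminant

variable {V : Type*} [AddCommGroup V] [Module ℚ V] {B : LinearMap.BilinForm ℚ V}
  {M : Submodule ℤ V}

lemma mem_dualLattice {x : V} : x ∈ dualLattice B M ↔
    (∀ y ∈ M, ∃ n : ℤ, B x y = n) ∧ x ∈ Submodule.span ℚ (M : Set V) := by
  rw [dualLattice, Submodule.mem_inf, LinearMap.BilinForm.mem_dualSubmodule]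
  refine and_congr (forall₂_congr fun y _ => ?_) (Submodule.restrictScalars_mem ..)
  rw [Submodule.mem_one]
  exact exists_congr fun n => eq_comm

lemma mem_submoduleOf_iff {x : dualLattice B M} :
    x ∈ M.submoduleOf (dualLattice B M) ↔ (x : V) ∈ M := Iff.rfl

/-- `M` is an even lattice with respect to the symmetric form `B`. -/
structure IsEvenLattice (B : LinearMap.BilinForm ℚ V) (M : Submodule ℤ V) : Prop where
  symm : ∀ x y, B x y = B y x
  even : ∀ x ∈ M, ∃ n : ℤ, B x x = 2 * n

lemma e_ratCast_add (x y : ℚ) : e ((x + y : ℚ) : ℂ) = e x * e y := by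
  push_cast; exact e_add _ _

lemma e_eq_of_sub_eq {x y : ℚ} (h : ∃ n : ℤ, x - y = n) : e x = e y := by
  obtain ⟨n, hn⟩ := h
  rw [show (x : ℂ) = y + n by rw [← Rat.cast_intCast, ← hn]; push_cast; ring, e_add_intCast]

/-- The function `γ ↦ e(γ²/2)` on the discriminant group. -/
def discEps (B : LinearMap.BilinForm ℚ V) (M : Submodule ℤ V) (γ : DiscGroup B M) : ℂ :=
  e (discHalfNorm B M γ : ℚ)

/-- The function `(γ, δ) ↦ e((γ, δ))` on the discriminant group. -/
def discBeta (B : LinearMap.BilinForm ℚ V) (M : Submodule ℤ V) (γ δ : DiscGroup B M) : ℂ :=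
  e (discPair B M γ δ : ℚ)

namespace IsEvenLattice

variable (h : IsEvenLattice B M)

include h

lemma integral {x y : V} (hx : x ∈ M) (hy : y ∈ M) : ∃ n : ℤ, B x y = n := by
  obtain ⟨a, ha⟩ := h.even _ (M.add_mem hx hy)
  obtain ⟨b, hb⟩ := h.even _ hx
  obtain ⟨c, hc⟩ := h.even _ hy
  refine ⟨a - b - c, ?_⟩
  simp only [map_add, LinearMap.add_apply] at ha
  have := h.symm x y
  push_cast
  linarith

omit h in
lemma exists_out_eq (x : dualLattice B M) :
    ∃ z ∈ M, ((Quotient.out (Submodule.Quotient.mk x : DiscGroup B M) : dualLattice B M) : V) =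
      x + z := by
  have h1 : (Submodule.Quotient.mk (Quotient.out (Submodule.Quotient.mk x : DiscGroup B M)) :
      DiscGroup B M) = Submodule.Quotient.mk x := Quotient.out_eq _
  rw [Submodule.Quotient.eq, mem_submoduleOf_iff] at h1
  exact ⟨_, h1, by simp⟩

/-- The representative chosen by `Quotient.out` differs from the given one by a lattice vector,
which changes the pairing by an integer. -/
lemma discBeta_mk (x y : dualLattice B M) :
    discBeta B M (Submodule.Quotient.mk x) (Submodule.Quotient.mk y) = e (B x y : ℚ) := by
  obtain ⟨z, hz, h1⟩ := exists_out_eq x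
  obtain ⟨w, hw, h2⟩ := exists_out_eq y
  obtain ⟨a, ha⟩ := (mem_dualLattice.1 x.2).1 w hw
  obtain ⟨b, hb⟩ := (mem_dualLattice.1 y.2).1 z hz
  obtain ⟨c, hc⟩ := h.integral hz hw
  rw [discBeta, discPair, h1, h2]
  refine e_eq_of_sub_eq ⟨a + b + c, ?_⟩
  simp only [map_add, LinearMap.add_apply, h.symm z y, ha, hb, hc]
  push_cast
  ring

lemma discEps_mk (x : dualLattice B M) :
    discEps B M (Submodule.Quotient.mk x) = e ((B x x / 2 : ℚ) : ℂ) := by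
  obtain ⟨z, hz, h1⟩ := exists_out_eq x
  obtain ⟨a, ha⟩ := (mem_dualLattice.1 x.2).1 z hz
  obtain ⟨c, hc⟩ := h.even _ hz
  rw [discEps, discHalfNorm, discPair, h1]
  refine e_eq_of_sub_eq ⟨a + c, ?_⟩
  simp only [map_add, LinearMap.add_apply, h.symm z x, ha, hc]
  push_cast
  ring

lemma discEps_add (γ δ : DiscGroup B M) :
    discEps B M (γ + δ) = discEps B M γ * discEps B M δ * discBeta B M γ δ := by
  obtain ⟨x, rfl⟩ := Submodule.Quotient.mk_surjective _ γ
  obtain ⟨y, rfl⟩ := Submodule.Quotient.mk_surjective _ δ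
  rw [← Submodule.Quotient.mk_add, h.discEps_mk, h.discEps_mk, h.discEps_mk, h.discBeta_mk,
    ← e_ratCast_add, ← e_ratCast_add]
  congr 2
  simp only [Submodule.coe_add, map_add, LinearMap.add_apply, h.symm y x]
  ring

/-- The hypothesis says that the bidual of `M` is `M`; it is precisely nondegeneracy. -/
lemma isQuadraticCharacter
    (hdd : ∀ x ∈ dualLattice B M, (∀ y ∈ dualLattice B M, ∃ n : ℤ, B x y = n) → x ∈ M) :
    IsQuadraticCharacter (discEps B M) (discBeta B M) where
  add := h.discEps_add
  beta_add γ δ κ := by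
    obtain ⟨x, rfl⟩ := Submodule.Quotient.mk_surjective _ γ
    obtain ⟨y, rfl⟩ := Submodule.Quotient.mk_surjective _ δ
    obtain ⟨z, rfl⟩ := Submodule.Quotient.mk_surjective _ κ
    rw [← Submodule.Quotient.mk_add, h.discBeta_mk, h.discBeta_mk, h.discBeta_mk,
      ← e_ratCast_add]
    congr 2
    simp only [Submodule.coe_add, map_add]
  beta_comm γ δ := by
    obtain ⟨x, rfl⟩ := Submodule.Quotient.mk_surjective _ γ
    obtain ⟨y, rfl⟩ := Submodule.Quotient.mk_surjective _ δ
    rw [h.discBeta_mk, h.discBeta_mk, h.symm]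
  beta_self γ := by
    obtain ⟨x, rfl⟩ := Submodule.Quotient.mk_surjective _ γ
    rw [h.discBeta_mk, h.discEps_mk, sq, ← e_ratCast_add]
    congr 2
    ring
  ne_zero γ := e_ne_zero _
  nondegenerate γ hγ := by
    obtain ⟨x, rfl⟩ := Submodule.Quotient.mk_surjective _ γ
    rw [Submodule.Quotient.mk_eq_zero, mem_submoduleOf_iff]
    refine hdd _ x.2 fun y hy => ?_
    have h1 := hγ (Submodule.Quotient.mk ⟨y, hy⟩)
    rw [h.discBeta_mk, e_rat_eq_one_iff] at h1
    exact h1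

end IsEvenLattice

end Discriminant

/-! ### Isometries of `E_8` -/

lemma e8Form_apply (x y : Fin 8 → ℚ) :
    e8Form x y = x ⬝ᵥ (CartanMatrix.E₈.map (fun n : ℤ => (n : ℚ))).mulVec y := by
  rw [e8Form, Matrix.toBilin'_apply']

lemma e8Form_symm (x y : Fin 8 → ℚ) : e8Form x y = e8Form y x := by
  rw [e8Form_apply, e8Form_apply, Matrix.dotProduct_mulVec, ← Matrix.mulVec_transpose,
    ← Matrix.transpose_map, CartanMatrix.E₈_transpose, dotProduct_comm]

lemma e8Form_self (x : Fin 8 → ℚ) : e8Form x x =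
    2 * (x 0 ^ 2 + x 1 ^ 2 + x 2 ^ 2 + x 3 ^ 2 + x 4 ^ 2 + x 5 ^ 2 + x 6 ^ 2 + x 7 ^ 2
      - x 0 * x 2 - x 1 * x 3 - x 2 * x 3 - x 3 * x 4 - x 4 * x 5 - x 5 * x 6 - x 6 * x 7) := by
  rw [e8Form_apply]
  simp [Matrix.mulVec, dotProduct, Fin.sum_univ_succ, CartanMatrix.E₈, Fin.succ]
  ring

end FakeMonster

end

/-! ### `E_8` is positive definite and unimodular; its isometries. -/

open scoped Real

noncomputable section

namespace FakeMonster

/-- Squares are completed along the three arms of the Dynkin diagram towards the branch node 3. The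
arms consume `1/4`, `1/3` and `2/5` of its coefficient and leave `1/60`. -/
lemma e8Form_self_eq_sum_sq (x : Fin 8 → ℚ) : e8Form x x =
    2 * ((x 1 - x 3 / 2) ^ 2 + (x 0 - x 2 / 2) ^ 2 + 3 / 4 * (x 2 - 2 / 3 * x 3) ^ 2 +
      (x 7 - x 6 / 2) ^ 2 + 3 / 4 * (x 6 - 2 / 3 * x 5) ^ 2 + 2 / 3 * (x 5 - 3 / 4 * x 4) ^ 2 +
      5 / 8 * (x 4 - 4 / 5 * x 3) ^ 2 + 1 / 60 * x 3 ^ 2) := by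
  rw [e8Form_self]
  ring

lemma e8Form_self_nonneg (x : Fin 8 → ℚ) : 0 ≤ e8Form x x := by
  rw [e8Form_self_eq_sum_sq]
  positivity

lemma eq_zero_of_e8Form_self {x : Fin 8 → ℚ} (h : e8Form x x = 0) : x = 0 := by
  rw [e8Form_self_eq_sum_sq] at h
  have s3 := sq_nonneg (x 3)
  have s1 := sq_nonneg (x 1 - x 3 / 2)
  have s2 := sq_nonneg (x 2 - 2 / 3 * x 3)
  have s0 := sq_nonneg (x 0 - x 2 / 2)
  have s4 := sq_nonneg (x 4 - 4 / 5 * x 3)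
  have s5 := sq_nonneg (x 5 - 3 / 4 * x 4)
  have s6 := sq_nonneg (x 6 - 2 / 3 * x 5)
  have s7 := sq_nonneg (x 7 - x 6 / 2)
  have h3 : x 3 = 0 := by rw [← sq_eq_zero_iff]; linarith
  have h1 : x 1 - x 3 / 2 = 0 := by rw [← sq_eq_zero_iff]; linarith
  have h2 : x 2 - 2 / 3 * x 3 = 0 := by rw [← sq_eq_zero_iff]; linarith
  have h0 : x 0 - x 2 / 2 = 0 := by rw [← sq_eq_zero_iff]; linarith
  have h4 : x 4 - 4 / 5 * x 3 = 0 := by rw [← sq_eq_zero_iff]; linarith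
  have h5 : x 5 - 3 / 4 * x 4 = 0 := by rw [← sq_eq_zero_iff]; linarith
  have h6 : x 6 - 2 / 3 * x 5 = 0 := by rw [← sq_eq_zero_iff]; linarith
  have h7 : x 7 - x 6 / 2 = 0 := by rw [← sq_eq_zero_iff]; linarith
  ext i
  fin_cases i <;> simp <;> linarith

lemma e8Form_self_pos {x : Fin 8 → ℚ} (h : x ≠ 0) : 0 < e8Form x x :=
  (e8Form_self_nonneg x).lt_of_ne fun h0 => h (eq_zero_of_e8Form_self h0.symm)

/-- The lattice `E_8 = ℤ^8`. -/
def IsIntegral8 (v : Fin 8 → ℚ) : Prop := ∃ x : Fin 8 → ℤ, v = fun i => (x i : ℚ)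

lemma e8Form_integral {v w : Fin 8 → ℚ} (hv : IsIntegral8 v) (hw : IsIntegral8 w) :
    ∃ n : ℤ, e8Form v w = n := by
  obtain ⟨x, rfl⟩ := hv
  obtain ⟨y, rfl⟩ := hw
  refine ⟨x ⬝ᵥ CartanMatrix.E₈.mulVec y, ?_⟩
  rw [e8Form_apply]
  simp [dotProduct, Matrix.mulVec]

lemma e8Form_self_even {v : Fin 8 → ℚ} (hv : IsIntegral8 v) : ∃ n : ℤ, e8Form v v = 2 * n := by
  obtain ⟨x, rfl⟩ := hv
  refine ⟨x 0 ^ 2 + x 1 ^ 2 + x 2 ^ 2 + x 3 ^ 2 + x 4 ^ 2 + x 5 ^ 2 + x 6 ^ 2 + x 7 ^ 2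
      - x 0 * x 2 - x 1 * x 3 - x 2 * x 3 - x 3 * x 4 - x 4 * x 5 - x 5 * x 6 - x 6 * x 7, ?_⟩
  rw [e8Form_self]
  push_cast
  rfl

lemma isIntegral8_single (i : Fin 8) : IsIntegral8 (Pi.single i 1) :=
  ⟨Pi.single i 1, by ext j; rcases eq_or_ne j i with rfl | h <;> simp [*]⟩

/-- The lattice `E_8` is unimodular. -/
lemma isIntegral8_of_forall {v : Fin 8 → ℚ}
    (h : ∀ w, IsIntegral8 w → ∃ n : ℤ, e8Form v w = n) : IsIntegral8 v := by
  choose c hc using fun i => h _ (isIntegral8_single i)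
  set E : Matrix (Fin 8) (Fin 8) ℤ := CartanMatrix.E₈ with hE
  have hu : IsUnit E.det := by rw [hE, CartanMatrix.E₈_det]; exact isUnit_one
  have h1 : (E.map (fun n : ℤ => (n : ℚ))).mulVec v = fun i => (c i : ℚ) := by
    ext i
    rw [← hc i, e8Form_symm, e8Form_apply, single_one_dotProduct]
  refine ⟨E⁻¹.mulVec c, ?_⟩
  have h2 : (E⁻¹.map (fun n : ℤ => (n : ℚ))) * (E.map (fun n : ℤ => (n : ℚ))) = 1 := by
    have h3 := congrArg (fun X : Matrix (Fin 8) (Fin 8) ℤ => X.map (Int.castRingHom ℚ))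
      (Matrix.nonsing_inv_mul E hu)
    simp only [Matrix.map_mul] at h3
    rw [Matrix.map_one _ (map_zero _) (map_one _)] at h3
    exact h3
  have h4 : v = (E⁻¹.map (fun n : ℤ => (n : ℚ))).mulVec (fun i => (c i : ℚ)) := by
    rw [← h1, Matrix.mulVec_mulVec, h2, Matrix.one_mulVec]
  rw [h4]
  ext i
  simp [Matrix.mulVec, dotProduct]

/-! ### Isometries of a positive definite space -/

/-- The linear map attached to an integral matrix. -/
def rationalEnd (A : Matrix (Fin 8) (Fin 8) ℤ) : Module.End ℚ (Fin 8 → ℚ) :=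
  Matrix.toLin' (A.map (Int.castRingHom ℚ))

variable {A : Matrix (Fin 8) (Fin 8) ℤ} {p m : ℕ}

lemma rationalEnd_intCast (x : Fin 8 → ℤ) :
    rationalEnd A (fun i => (x i : ℚ)) = fun i => (A.mulVec x i : ℚ) := by
  ext i
  simp [rationalEnd, Matrix.mulVec, dotProduct]

lemma rationalEnd_isometry (hA : IsE8Automorphism A) (x y : Fin 8 → ℚ) :
    e8Form (rationalEnd A x) (rationalEnd A y) = e8Form x y := by
  have h := congrArg (fun X : Matrix (Fin 8) (Fin 8) ℤ => X.map (Int.castRingHom ℚ)) hA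
  simp only [Matrix.map_mul, Matrix.transpose_map] at h
  rw [e8Form_apply, e8Form_apply, rationalEnd, Matrix.toLin'_apply, Matrix.toLin'_apply,
    Matrix.dotProduct_mulVec, Matrix.dotProduct_mulVec, Matrix.dotProduct_mulVec,
    Matrix.vecMul_mulVec, Matrix.vecMul_vecMul]
  change _ = (Matrix.vecMul x (CartanMatrix.E₈.map (Int.castRingHom ℚ))) ⬝ᵥ y
  rw [← h]
  simp only [← Matrix.vecMul_vecMul]
  rfl

lemma isometry_pow {g : Module.End ℚ (Fin 8 → ℚ)} (hg : ∀ x y, e8Form (g x) (g y) = e8Form x y)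
    (n : ℕ) (x y : Fin 8 → ℚ) : e8Form ((g ^ n) x) ((g ^ n) y) = e8Form x y := by
  induction n with
  | zero => rfl
  | succ n ih => rw [pow_succ', Module.End.mul_apply, Module.End.mul_apply, hg, ih]

/-- An isometry is semisimple at the eigenvalue `1`. -/
lemma isometry_fixed_of_pow {g : Module.End ℚ (Fin 8 → ℚ)}
    (hg : ∀ x y, e8Form (g x) (g y) = e8Form x y) {n : ℕ} (x : Fin 8 → ℚ)
    (h : ((g - 1) ^ n) x = 0) : g x = x := by
  induction n with
  | zero => rw [show x = 0 from h, map_zero]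
  | succ n ih =>
    rcases Nat.eq_zero_or_pos n with rfl | hn
    · rw [zero_add, pow_one, LinearMap.sub_apply, Module.End.one_apply, sub_eq_zero] at h
      exact h
    · apply ih
      obtain ⟨n, rfl⟩ : ∃ k, n = k + 1 := ⟨n - 1, by omega⟩
      rw [pow_succ', Module.End.mul_apply, LinearMap.sub_apply, Module.End.one_apply,
        sub_eq_zero] at h
      set w := ((g - 1) ^ (n + 1)) x with hw
      rw [pow_succ', Module.End.mul_apply, LinearMap.sub_apply, Module.End.one_apply] at hw
      set v := ((g - 1) ^ n) x
      -- A fixed vector in the image of `g - 1` is orthogonal to itself.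
      apply eq_zero_of_e8Form_self
      calc e8Form w w = e8Form w (g v) - e8Form w v := by rw [← map_sub, ← hw]
        _ = e8Form (g w) (g v) - e8Form w v := by rw [h]
        _ = 0 := by rw [hg, sub_self]

lemma rationalEnd_charpoly (hs : HasCycleShape A p m) :
    (rationalEnd A).charpoly = (Polynomial.X - 1) ^ m * (Polynomial.X ^ p - 1) ^ m := by
  rw [rationalEnd, Matrix.charpoly_toLin', Matrix.charpoly_map, hs]
  simp

/-- By Cayley–Hamilton the `p`-th power is unipotent, and a unipotent isometry of a definite space
is the identity. -/
lemma rationalEnd_pow_eq_one (hA : IsE8Automorphism A) (hs : HasCycleShape A p m) :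
    rationalEnd A ^ p = 1 := by
  set φ := rationalEnd A
  have h1 := LinearMap.aeval_self_charpoly φ
  rw [rationalEnd_charpoly hs] at h1
  simp only [map_mul, map_pow, map_sub, Polynomial.aeval_X, map_one] at h1
  have h2 : (φ ^ p - 1) ^ (m + m) = 0 := by
    have h3 : (φ ^ p - 1) ^ m = (∑ i ∈ Finset.range p, φ ^ i) ^ m * (φ - 1) ^ m := by
      rw [← geom_sum_mul]
      apply Commute.mul_pow
      refine Commute.sum_left _ _ _ fun i _ => ?_
      exact (Commute.pow_left (Commute.refl φ) i).sub_right (Commute.one_right _)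
    rw [pow_add]
    nth_rewrite 1 [h3]
    rw [mul_assoc, h1, mul_zero]
  refine LinearMap.ext fun x => ?_
  exact isometry_fixed_of_pow (isometry_pow (rationalEnd_isometry hA) p) (n := m + m) _
    (by rw [h2]; rfl)

end FakeMonster

end

open scoped Real

noncomputable section

namespace FakeMonster

variable {A : Matrix (Fin 8) (Fin 8) ℤ} {p m : ℕ}

/-! ### The fixed lattice -/

lemma mem_fixedLattice {v : Fin 8 → ℚ} :
    v ∈ fixedLattice A ↔ IsIntegral8 v ∧ rationalEnd A v = v := by
  constructor
  · rintro ⟨x, hx, rfl⟩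
    exact ⟨⟨x, rfl⟩, by rw [rationalEnd_intCast, hx]⟩
  · rintro ⟨⟨x, rfl⟩, h⟩
    refine ⟨x, ?_, rfl⟩
    rw [rationalEnd_intCast] at h
    ext i
    exact_mod_cast congrFun h i

lemma exists_mul_isIntegral8 (v : Fin 8 → ℚ) : ∃ n : ℕ, n ≠ 0 ∧ IsIntegral8 ((n : ℚ) • v) := by
  refine ⟨∏ i, (v i).den, Finset.prod_ne_zero_iff.2 fun i _ => (v i).den_nz, ?_⟩
  refine ⟨fun i => (∏ j ∈ Finset.univ.erase i, ((v j).den : ℤ)) * (v i).num, ?_⟩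
  ext i
  rw [Pi.smul_apply, smul_eq_mul, ← Finset.mul_prod_erase _ _ (Finset.mem_univ i)]
  push_cast
  have h := Rat.den_mul_eq_num (v i)
  rw [← h]
  ring

lemma mem_span_fixedLattice {v : Fin 8 → ℚ} :
    v ∈ Submodule.span ℚ (fixedLattice A : Set (Fin 8 → ℚ)) ↔ rationalEnd A v = v := by
  constructor
  · intro hv
    have h : Submodule.span ℚ (fixedLattice A : Set (Fin 8 → ℚ)) ≤
        LinearMap.eqLocus (rationalEnd A) LinearMap.id :=
      Submodule.span_le.2 fun x hx => (mem_fixedLattice.1 hx).2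
    exact h hv
  · intro hv
    obtain ⟨n, hn, hi⟩ := exists_mul_isIntegral8 v
    have hn' : (n : ℚ) ≠ 0 := by exact_mod_cast hn
    have h1 : (n : ℚ) • v ∈ fixedLattice A := mem_fixedLattice.2 ⟨hi, by rw [map_smul, hv]⟩
    have h2 := Submodule.smul_mem _ (n : ℚ)⁻¹ (Submodule.subset_span (R := ℚ) h1)
    rwa [smul_smul, inv_mul_cancel₀ hn', one_smul] at h2

lemma fixedLattice_isEvenLattice : IsEvenLattice (-e8Form) (fixedLattice A) where
  symm x y := by rw [LinearMap.neg_apply, LinearMap.neg_apply, LinearMap.neg_apply,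
    LinearMap.neg_apply, e8Form_symm]
  even x hx := by
    obtain ⟨n, hn⟩ := e8Form_self_even (mem_fixedLattice.1 hx).1
    exact ⟨-n, by rw [LinearMap.neg_apply, LinearMap.neg_apply, hn]; push_cast; ring⟩

/-- The dual of the fixed lattice. -/
def fixedDual (A : Matrix (Fin 8) (Fin 8) ℤ) : Submodule ℤ (Fin 8 → ℚ) :=
  dualLattice (-e8Form) (fixedLattice A)

lemma mem_fixedDual {v : Fin 8 → ℚ} : v ∈ fixedDual A ↔
    (∀ y ∈ fixedLattice A, ∃ n : ℤ, e8Form v y = n) ∧ rationalEnd A v = v := by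
  rw [fixedDual, mem_dualLattice, mem_span_fixedLattice]
  refine and_congr_left fun _ => forall₂_congr fun y _ => ?_
  rw [LinearMap.neg_apply, LinearMap.neg_apply]
  constructor <;> rintro ⟨n, hn⟩ <;> exact ⟨-n, by push_cast; linarith⟩

lemma isIntegral8_rationalEnd {v : Fin 8 → ℚ} (hv : IsIntegral8 v) :
    IsIntegral8 (rationalEnd A v) := by
  obtain ⟨x, rfl⟩ := hv
  exact ⟨A.mulVec x, rationalEnd_intCast x⟩

lemma isIntegral8_add {v w : Fin 8 → ℚ} (hv : IsIntegral8 v) (hw : IsIntegral8 w) :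
    IsIntegral8 (v + w) := by
  obtain ⟨x, rfl⟩ := hv
  obtain ⟨y, rfl⟩ := hw
  exact ⟨x + y, by ext; simp⟩

/-- The sum over the orbit of a vector. -/
def orbitSum (A : Matrix (Fin 8) (Fin 8) ℤ) (p : ℕ) (v : Fin 8 → ℚ) : Fin 8 → ℚ :=
  ∑ i ∈ Finset.range p, (rationalEnd A ^ i) v

lemma orbitSum_mem (hA : IsE8Automorphism A) (hs : HasCycleShape A p m) {v : Fin 8 → ℚ}
    (hv : IsIntegral8 v) : orbitSum A p v ∈ fixedLattice A := by
  rw [mem_fixedLattice]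
  constructor
  · have h : ∀ i, IsIntegral8 ((rationalEnd A ^ i) v) := by
      intro i
      induction i with
      | zero => exact hv
      | succ i ih => rw [pow_succ']; exact isIntegral8_rationalEnd ih
    exact Finset.sum_induction _ _ (fun _ _ => isIntegral8_add) ⟨0, by ext; simp⟩ fun i _ => h i
  · have h1 := Finset.sum_range_succ (fun i => (rationalEnd A ^ i) v) p
    rw [Finset.sum_range_succ', rationalEnd_pow_eq_one hA hs, pow_zero] at h1
    rw [orbitSum, map_sum, ← add_right_cancel h1]
    exact Finset.sum_congr rfl fun i _ => by rw [pow_succ', Module.End.mul_apply]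

lemma e8Form_orbitSum (hA : IsE8Automorphism A) {x : Fin 8 → ℚ} (hx : rationalEnd A x = x)
    (v : Fin 8 → ℚ) : e8Form x (orbitSum A p v) = p * e8Form x v := by
  have h : ∀ i, e8Form x ((rationalEnd A ^ i) v) = e8Form x v := by
    intro i
    have h1 : (rationalEnd A ^ i) x = x := by
      induction i with
      | zero => rfl
      | succ i ih => rw [pow_succ', Module.End.mul_apply, ih, hx]
    conv_lhs => rw [← h1]
    exact isometry_pow (rationalEnd_isometry hA) i x v
  rw [orbitSum, map_sum, Finset.sum_congr rfl fun i _ => h i]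
  simp

/-- For `w` in `E_8` the pairing of `px` with `w` equals that of `x` with the orbit sum of `w`,
which lies in the fixed lattice. Unimodularity of `E_8` then gives integrality of `px`. -/
lemma smul_mem_fixedLattice (hA : IsE8Automorphism A) (hs : HasCycleShape A p m) {x : Fin 8 → ℚ}
    (hx : x ∈ fixedDual A) : (p : ℚ) • x ∈ fixedLattice A := by
  obtain ⟨h1, h2⟩ := mem_fixedDual.1 hx
  refine mem_fixedLattice.2 ⟨isIntegral8_of_forall fun w hw => ?_, by rw [map_smul, h2]⟩
  obtain ⟨n, hn⟩ := h1 _ (orbitSum_mem hA hs hw)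
  exact ⟨n, by rw [← hn, e8Form_orbitSum hA h2, map_smul]; rfl⟩

/-- The orbit sum of `w` divided by `p` is the orthogonal projection of `w` to the fixed space. It
lies in the dual and pairs with `x` as `w` does, so unimodularity applies again. -/
lemma mem_fixedLattice_of_forall (hp : 0 < p) (hA : IsE8Automorphism A)
    (hs : HasCycleShape A p m) {x : Fin 8 → ℚ} (hx : x ∈ fixedDual A)
    (h : ∀ y ∈ fixedDual A, ∃ n : ℤ, e8Form x y = n) : x ∈ fixedLattice A := by
  have hp' : (p : ℚ) ≠ 0 := by exact_mod_cast hp.ne'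
  obtain ⟨h1, h2⟩ := mem_fixedDual.1 hx
  refine mem_fixedLattice.2 ⟨isIntegral8_of_forall fun w hw => ?_, h2⟩
  have h3 := orbitSum_mem hA hs hw
  have h4 : (p : ℚ)⁻¹ • orbitSum A p w ∈ fixedDual A := by
    refine mem_fixedDual.2 ⟨fun y hy => ?_, by rw [map_smul, (mem_fixedLattice.1 h3).2]⟩
    obtain ⟨hy1, hy2⟩ := mem_fixedLattice.1 hy
    rw [e8Form_symm, map_smul, e8Form_orbitSum hA hy2, smul_eq_mul, inv_mul_cancel_left₀ hp']
    exact e8Form_integral hy1 hw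
  obtain ⟨n, hn⟩ := h _ h4
  rw [map_smul, e8Form_orbitSum hA h2, smul_eq_mul, inv_mul_cancel_left₀ hp'] at hn
  exact ⟨n, hn⟩

/-- The discriminant group of `E_8^p(-1)`. -/
abbrev FixedDisc (A : Matrix (Fin 8) (Fin 8) ℤ) : Type := DiscGroup (-e8Form) (fixedLattice A)

lemma fixedDisc_isQuadraticCharacter (hp : 0 < p) (hA : IsE8Automorphism A)
    (hs : HasCycleShape A p m) :
    IsQuadraticCharacter (discEps (-e8Form) (fixedLattice A))
      (discBeta (-e8Form) (fixedLattice A)) := by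
  refine fixedLattice_isEvenLattice.isQuadraticCharacter fun x hx h => ?_
  refine mem_fixedLattice_of_forall hp hA hs hx fun y hy => ?_
  obtain ⟨n, hn⟩ := h y hy
  rw [LinearMap.neg_apply, LinearMap.neg_apply] at hn
  exact ⟨-n, by push_cast; linarith⟩

/-- With `p = 2r + 1`, `p x²/2 = (px)²/2 - r (x, px)`; the first term is integral because `px` lies
in the even lattice. Oddness of `p` is what removes the denominator 2. -/
lemma exists_mul_half_norm (hodd : Odd p) (hA : IsE8Automorphism A)
    (hs : HasCycleShape A p m) {x : Fin 8 → ℚ} (hx : x ∈ fixedDual A) :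
    ∃ n : ℤ, p * (e8Form x x / 2) = n := by
  have h1 := smul_mem_fixedLattice hA hs hx
  obtain ⟨a, ha⟩ := (mem_fixedDual.1 hx).1 _ h1
  obtain ⟨b, hb⟩ := e8Form_self_even (mem_fixedLattice.1 h1).1
  obtain ⟨r, rfl⟩ := hodd
  simp only [map_smul, LinearMap.smul_apply, smul_eq_mul] at ha hb
  refine ⟨b - r * a, ?_⟩
  push_cast at ha hb ⊢
  rw [← ha]
  linear_combination hb / 2

lemma fixedDisc_eps_pow (hodd : Odd p) (hA : IsE8Automorphism A) (hs : HasCycleShape A p m)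
    (γ : FixedDisc A) : discEps (-e8Form) (fixedLattice A) γ ^ p = 1 := by
  obtain ⟨x, rfl⟩ := Submodule.Quotient.mk_surjective _ γ
  obtain ⟨n, hn⟩ := exists_mul_half_norm hodd hA hs x.2
  rw [fixedLattice_isEvenLattice.discEps_mk, ← e_nat_mul, e_eq_one_iff]
  refine ⟨-n, ?_⟩
  rw [LinearMap.neg_apply, LinearMap.neg_apply, ← Rat.cast_natCast, ← Rat.cast_mul,
    ← Rat.cast_intCast]
  congr 1
  push_cast
  linarith

lemma fixedDisc_nsmul (hA : IsE8Automorphism A) (hs : HasCycleShape A p m)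
    (γ : FixedDisc A) : p • γ = 0 := by
  obtain ⟨x, rfl⟩ := Submodule.Quotient.mk_surjective _ γ
  rw [← Submodule.Quotient.mk_smul, Submodule.Quotient.mk_eq_zero, mem_submoduleOf_iff]
  have := smul_mem_fixedLattice hA hs x.2
  rwa [Nat.cast_smul_eq_nsmul] at this

/-! ### The rank -/

/-- By semisimplicity the fixed space is the generalized eigenspace at 1, whose dimension is a root
multiplicity: `m` from `(X - 1)^m`, and `m` from `(X^p - 1)^m` because `(X^p - 1)/(X - 1)` takes the
value `p ≠ 0` at 1. -/
lemma finrank_span_fixedLattice (hp : 0 < p) (hA : IsE8Automorphism A)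
    (hs : HasCycleShape A p m) :
    Module.finrank ℚ (Submodule.span ℚ (fixedLattice A : Set (Fin 8 → ℚ))) = 2 * m := by
  set φ := rationalEnd A with hφ
  have h1 : Submodule.span ℚ (fixedLattice A : Set (Fin 8 → ℚ)) = φ.maxGenEigenspace 1 := by
    ext v
    rw [mem_span_fixedLattice, Module.End.mem_maxGenEigenspace, one_smul]
    constructor
    · intro h
      exact ⟨1, by rw [pow_one, LinearMap.sub_apply, Module.End.one_apply, hφ, h, sub_self]⟩
    · rintro ⟨k, hk⟩
      exact isometry_fixed_of_pow (rationalEnd_isometry hA) v hk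
  rw [h1, LinearMap.finrank_maxGenEigenspace_eq, hφ, rationalEnd_charpoly hs]
  have h2 : (Polynomial.X ^ p - 1 : Polynomial ℚ) =
      (∑ i ∈ Finset.range p, Polynomial.X ^ i) * (Polynomial.X - 1) := (geom_sum_mul _ _).symm
  set q : Polynomial ℚ := ∑ i ∈ Finset.range p, Polynomial.X ^ i with hq
  have h3 : q.eval 1 ≠ 0 := by
    rw [hq, Polynomial.eval_finsetSum]
    simp [hp.ne']
  have hX : (Polynomial.X - 1 : Polynomial ℚ) = Polynomial.X - Polynomial.C 1 := by simp
  have hX0 : (Polynomial.X - Polynomial.C 1 : Polynomial ℚ) ≠ 0 := Polynomial.X_sub_C_ne_zero 1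
  have hq0 : q ^ m ≠ 0 := pow_ne_zero _ (by rintro h; rw [h] at h3; simp at h3)
  rw [h2, mul_pow, mul_left_comm, ← pow_add, ← two_mul, hX, mul_comm,
    Polynomial.rootMultiplicity_mul (mul_ne_zero (pow_ne_zero _ hX0) hq0),
    Polynomial.rootMultiplicity_X_sub_C_pow, Polynomial.rootMultiplicity_eq_zero, add_zero]
  rw [Polynomial.IsRoot.def, Polynomial.eval_pow]
  exact pow_ne_zero _ h3

end FakeMonster

end

open scoped Real

noncomputable section

namespace FakeMonster

/-! ### Gram matrices -/

section Gram

variable {V : Type*} [AddCommGroup V] [Module ℚ V] {B : LinearMap.BilinForm ℚ V}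
  {M : Submodule ℤ V} {n : ℕ}

/-- The vectors `b i` form a basis of the lattice `M`, with Gram matrix `S`. -/
structure IsGram (B : LinearMap.BilinForm ℚ V) (M : Submodule ℤ V) (b : Fin n → V)
    (S : Matrix (Fin n) (Fin n) ℤ) : Prop where
  gram : ∀ i j, B (b i) (b j) = S i j
  mem_iff : ∀ x, x ∈ M ↔ ∃ z : Fin n → ℤ, x = ∑ i, (z i : ℚ) • b i
  mem_span_iff : ∀ x, x ∈ Submodule.span ℚ (M : Set V) ↔ ∃ r : Fin n → ℚ, x = ∑ i, r i • b i
  indep : ∀ r : Fin n → ℚ, ∑ i, r i • b i = 0 → r = 0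

lemma exists_isGram (h : IsEvenLattice B M) (hfg : M.FG)
    (hn : Module.finrank ℚ (Submodule.span ℚ (M : Set V)) = n) :
    ∃ (b : Fin n → V) (S : Matrix (Fin n) (Fin n) ℤ), IsGram B M b S := by
  have : Module.Finite ℤ M := Module.Finite.iff_fg.2 hfg
  have : Module.IsTorsionFree ℤ V := Module.IsTorsionFree.trans_faithfulSMul ℤ ℚ V
  have : Module.Free ℤ M := inferInstance
  set b := Module.finBasis ℤ M
  have hli : LinearIndependent ℚ (fun i => (b i : V)) :=
    (LinearIndependent.iff_fractionRing ℤ ℚ).1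
      (b.linearIndependent.map' M.subtype (Submodule.ker_subtype M))
  have hmem : ∀ x, x ∈ M ↔ ∃ z : Fin (Module.finrank ℤ M) → ℤ, x = ∑ i, (z i : ℚ) • (b i : V) := by
    intro x
    constructor
    · intro hx
      refine ⟨b.repr ⟨x, hx⟩, ?_⟩
      have h1 := congrArg (Subtype.val) (b.sum_repr ⟨x, hx⟩)
      rw [Submodule.coe_sum] at h1
      refine h1.symm.trans (Finset.sum_congr rfl fun i _ => ?_)
      rw [Int.cast_smul_eq_zsmul]
      rfl
    · rintro ⟨z, rfl⟩
      refine M.sum_mem fun i _ => ?_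
      rw [Int.cast_smul_eq_zsmul]
      exact M.smul_mem _ (b i).2
  have hspan : Submodule.span ℚ (M : Set V) = Submodule.span ℚ (Set.range fun i => (b i : V)) := by
    apply le_antisymm
    · refine Submodule.span_le.2 fun x hx => ?_
      obtain ⟨z, rfl⟩ := (hmem x).1 hx
      exact Submodule.sum_mem _ fun i _ => Submodule.smul_mem _ _
        (Submodule.subset_span (Set.mem_range_self i))
    · refine Submodule.span_mono ?_
      rintro _ ⟨i, rfl⟩
      exact (b i).2
  have hrank : Module.finrank ℤ M = n := by
    rw [← hn, hspan, finrank_span_eq_card hli, Fintype.card_fin]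
  choose S hS using fun i j => h.integral (b i).2 (b j).2
  subst hrank
  refine ⟨fun i => b i, Matrix.of S, ⟨hS, hmem, fun x => ?_, fun r hr => ?_⟩⟩
  · rw [hspan, Submodule.mem_span_range_iff_exists_fun]
    exact exists_congr fun _ => eq_comm
  · exact funext fun i => Fintype.linearIndependent_iff.1 hli r hr i

namespace IsGram

variable {b : Fin n → V} {S : Matrix (Fin n) (Fin n) ℤ} (hG : IsGram B M b S)

include hG

lemma bilin_basis (r : Fin n → ℚ) (i : Fin n) :
    B (b i) (∑ j, r j • b j) = ((S.map (Int.cast : ℤ → ℚ)).mulVec r) i := by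
  simp only [map_sum, map_smul, hG.gram, smul_eq_mul, Matrix.mulVec, dotProduct, Matrix.map_apply]
  exact Finset.sum_congr rfl fun _ _ => mul_comm _ _

lemma bilin (r s : Fin n → ℚ) : B (∑ i, r i • b i) (∑ j, s j • b j) =
    r ⬝ᵥ (S.map (Int.cast : ℤ → ℚ)).mulVec s := by
  rw [LinearMap.BilinForm.sum_left, dotProduct]
  refine Finset.sum_congr rfl fun i _ => ?_
  rw [map_smul, LinearMap.smul_apply, hG.bilin_basis, smul_eq_mul]

lemma isSymm (h : IsEvenLattice B M) : S.IsSymm := by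
  ext i j
  have := h.symm (b i) (b j)
  rw [hG.gram, hG.gram] at this
  exact_mod_cast this.symm

lemma basis_mem (i : Fin n) : b i ∈ M := (hG.mem_iff _).2 ⟨Pi.single i 1, by
  rw [Finset.sum_eq_single i]
  · simp
  · intro j _ hj; simp [hj]
  · simp⟩

lemma even_diag (h : IsEvenLattice B M) (i : Fin n) : ∃ k : ℤ, S i i = 2 * k := by
  obtain ⟨k, hk⟩ := h.even _ (hG.basis_mem i)
  rw [hG.gram] at hk
  exact ⟨k, by exact_mod_cast hk⟩

lemma det_ne_zero (hpos : ∀ x, x ≠ 0 → 0 < B x x) : S.det ≠ 0 := by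
  intro h0
  have h1 : (S.map (Int.cast : ℤ → ℚ)).det = 0 := by
    have := Int.cast_det (R := ℚ) S
    rw [h0] at this
    exact_mod_cast this.symm
  obtain ⟨r, hr, h2⟩ := Matrix.exists_mulVec_eq_zero_iff.2 h1
  have h3 := hG.bilin r r
  rw [h2, dotProduct_zero] at h3
  by_cases h4 : ∑ i, r i • b i = 0
  · exact hr (hG.indep r h4)
  · exact (hpos _ h4).ne' h3

/-- Density of `ℚ` gives only semidefiniteness over `ℝ`; the nonzero determinant upgrades it. -/
lemma posDef (h : IsEvenLattice B M) (hpos : ∀ x, x ≠ 0 → 0 < B x x) :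
    (S.map (Int.cast : ℤ → ℝ)).PosDef := by
  have hsymm := hG.isSymm h
  have hdet : IsUnit (S.map (Int.cast : ℤ → ℝ)).det := by
    rw [isUnit_iff_ne_zero]
    have := Int.cast_det (R := ℝ) S
    rw [show (S.map (Int.cast : ℤ → ℝ)).det = (S.det : ℝ) from this.symm]
    exact_mod_cast hG.det_ne_zero hpos
  have hsemi : (S.map (Int.cast : ℤ → ℝ)).PosSemidef := by
    refine Matrix.PosSemidef.of_dotProduct_mulVec_nonneg ?_ fun x => ?_
    · ext i j
      have := hsymm.apply i j
      simp [this]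
    · have hd : DenseRange (fun r : Fin n → ℚ => fun i => (r i : ℝ)) :=
        DenseRange.piMap fun _ => Rat.denseRange_cast
      refine hd.induction_on (p := fun x : Fin n → ℝ =>
        0 ≤ star x ⬝ᵥ (S.map (Int.cast : ℤ → ℝ)).mulVec x) x ?_ fun r => ?_
      · refine isClosed_le continuous_const ?_
        simp only [dotProduct, Matrix.mulVec]
        fun_prop
      · have h1 : (0 : ℚ) ≤ r ⬝ᵥ (S.map (Int.cast : ℤ → ℚ)).mulVec r := by
          rw [← hG.bilin]
          rcases eq_or_ne (∑ i, r i • b i) 0 with h0 | h0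
          · rw [h0]; simp
          · exact (hpos _ h0).le
        have h2 : ((r ⬝ᵥ (S.map (Int.cast : ℤ → ℚ)).mulVec r : ℚ) : ℝ) =
            star (fun i => (r i : ℝ)) ⬝ᵥ
              (S.map (Int.cast : ℤ → ℝ)).mulVec (fun i => (r i : ℝ)) := by
          simp [dotProduct, Matrix.mulVec]
        rw [← h2]
        exact_mod_cast h1
  exact hsemi.posDef_iff_isUnit.2 ((Matrix.isUnit_iff_isUnit_det _).2 hdet)

lemma det_pos (h : IsEvenLattice B M) (hpos : ∀ x, x ≠ 0 → 0 < B x x) : 0 < S.det := by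
  have h1 := (hG.posDef h hpos).det_pos
  have h2 := Int.cast_det (R := ℝ) S
  rw [show (S.map (Int.cast : ℤ → ℝ)).det = (S.det : ℝ) from h2.symm] at h1
  exact_mod_cast h1

lemma sum_mem_dual_iff (h : IsEvenLattice B M) (r : Fin n → ℚ) :
    ∑ i, r i • b i ∈ dualLattice B M ↔
      ∃ c : Fin n → ℤ, (S.map (Int.cast : ℤ → ℚ)).mulVec r = fun i => (c i : ℚ) := by
  rw [mem_dualLattice]
  constructor
  · rintro ⟨h1, -⟩
    choose c hc using fun i => h1 _ (hG.basis_mem i)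
    refine ⟨c, funext fun i => ?_⟩
    rw [← hG.bilin_basis, h.symm, hc]
  · rintro ⟨c, hc⟩
    refine ⟨fun y hy => ?_, (hG.mem_span_iff _).2 ⟨r, rfl⟩⟩
    obtain ⟨z, rfl⟩ := (hG.mem_iff y).1 hy
    refine ⟨z ⬝ᵥ c, ?_⟩
    rw [h.symm, hG.bilin, hc]
    simp [dotProduct]

lemma coords_eq {r s : Fin n → ℚ} (h : ∑ i, r i • b i = ∑ i, s i • b i) : r = s := by
  have h1 := hG.indep (r - s) (by simp [sub_smul, h])
  exact sub_eq_zero.1 h1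

/-- The order of the discriminant group is the determinant of the lattice. -/
lemma card_discGroup (h : IsEvenLattice B M) (hpos : ∀ x, x ≠ 0 → 0 < B x x) :
    Nat.card (DiscGroup B M) = S.det.natAbs := by
  set SQ : Matrix (Fin n) (Fin n) ℚ := S.map (Int.cast : ℤ → ℚ) with hSQ
  have hdet : IsUnit SQ.det := by
    rw [isUnit_iff_ne_zero]
    have := Int.cast_det (R := ℚ) S
    rw [show SQ.det = (S.det : ℚ) from this.symm]
    exact_mod_cast hG.det_ne_zero hpos
  have hcast : ∀ z : Fin n → ℤ, SQ.mulVec (fun i => (z i : ℚ)) =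
      fun i => ((S.mulVec z i : ℤ) : ℚ) := by
    intro z; ext i; simp [hSQ, Matrix.mulVec, dotProduct]
  -- the dual lattice is isomorphic to `ℤⁿ` by pairing with the basis
  choose c hc using fun (x : dualLattice B M) (i : Fin n) =>
    (mem_dualLattice.1 x.2).1 _ (hG.basis_mem i)
  let φ : dualLattice B M →ₗ[ℤ] (Fin n → ℤ) :=
    { toFun := c
      map_add' := fun x y => by
        ext i
        have h1 := hc (x + y) i
        rw [Submodule.coe_add, map_add, LinearMap.add_apply, hc, hc] at h1
        exact_mod_cast h1.symm
      map_smul' := fun k x => by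
        ext i
        have h1 := hc (k • x) i
        rw [Submodule.coe_smul, map_zsmul, LinearMap.smul_apply, hc] at h1
        simp only [zsmul_eq_mul] at h1
        rw [RingHom.id_apply, Pi.smul_apply, smul_eq_mul]
        exact_mod_cast h1.symm }
  have hφ : ∀ (r : Fin n → ℚ) (hr : ∑ i, r i • b i ∈ dualLattice B M),
      SQ.mulVec r = fun i => (φ ⟨_, hr⟩ i : ℚ) := by
    intro r hr
    ext i
    rw [hSQ, ← hG.bilin_basis, h.symm]
    exact hc ⟨_, hr⟩ i
  have hsurj : Function.Surjective φ := by
    intro z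
    have h1 : SQ.mulVec (SQ⁻¹.mulVec fun i => (z i : ℚ)) = fun i => (z i : ℚ) := by
      rw [Matrix.mulVec_mulVec, Matrix.mul_nonsing_inv _ hdet, Matrix.one_mulVec]
    have h2 := (hG.sum_mem_dual_iff h (SQ⁻¹.mulVec fun i => (z i : ℚ))).2 ⟨z, h1⟩
    refine ⟨⟨_, h2⟩, ?_⟩
    have h3 := hφ _ h2
    rw [h1] at h3
    ext i
    exact_mod_cast (congrFun h3 i).symm
  -- In the dual coordinates `φ` the lattice `M` becomes the column lattice of `S`, so `M'/M ≅ ℤⁿ /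
  -- Sℤⁿ`, of order `|det S|`.
  set N : Submodule ℤ (Fin n → ℤ) := LinearMap.range (Matrix.toLin' S) with hN
  have hker : M.submoduleOf (dualLattice B M) = N.comap φ := by
    ext x
    rw [mem_submoduleOf_iff, Submodule.mem_comap, hN, LinearMap.mem_range]
    obtain ⟨x, hx⟩ := x
    obtain ⟨r, rfl⟩ := (hG.mem_span_iff x).1 (mem_dualLattice.1 hx).2
    have h1 := hφ r hx
    rw [hG.mem_iff]
    constructor
    · rintro ⟨z, hz⟩
      refine ⟨z, ?_⟩
      have h2 : SQ.mulVec r = fun i => ((S.mulVec z i : ℤ) : ℚ) := by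
        rw [hG.coords_eq hz, hcast]
      rw [h1] at h2
      ext i
      rw [Matrix.toLin'_apply]
      exact_mod_cast (congrFun h2 i).symm
    · rintro ⟨z, hz⟩
      refine ⟨z, ?_⟩
      rw [← hz, Matrix.toLin'_apply, ← hcast] at h1
      have h2 := congrArg (SQ⁻¹.mulVec) h1
      rw [Matrix.mulVec_mulVec, Matrix.mulVec_mulVec, Matrix.nonsing_inv_mul _ hdet,
        Matrix.one_mulVec, Matrix.one_mulVec] at h2
      change ∑ i, r i • b i = _
      rw [h2]
  have e1 : DiscGroup B M ≃ₗ[ℤ] ((Fin n → ℤ) ⧸ N) :=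
    (Submodule.quotEquivOfEq _ _ (by
      rw [hker, LinearMap.ker_comp, Submodule.ker_mkQ])).trans
      ((N.mkQ ∘ₗ φ).quotKerEquivOfSurjective
        ((Submodule.mkQ_surjective N).comp hsurj))
  rw [Nat.card_congr e1.toEquiv]
  have hinj : Function.Injective (Matrix.toLin' S) := by
    rw [← LinearMap.ker_eq_bot, LinearMap.ker_eq_bot']
    intro z hz
    by_contra h0
    exact hG.det_ne_zero hpos (Matrix.exists_mulVec_eq_zero_iff.1 ⟨z, h0, hz⟩)
  rw [← Submodule.natAbs_det_equiv N (LinearEquiv.ofInjective _ hinj),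
    ← LinearMap.det_toLin' S]
  rfl

end IsGram

end Gram

end FakeMonster

end

open scoped Real

noncomputable section

namespace FakeMonster

/-! ### There is no even unimodular positive definite lattice of rank `4` -/

lemma setOf_sum_sq_lt_two : {y : Fin 4 → ℝ | ∑ i, y i ^ 2 < 2} =
    WithLp.toLp 2 ⁻¹' Metric.ball (0 : EuclideanSpace ℝ (Fin 4)) (Real.sqrt 2) := by
  ext y
  rw [Set.mem_preimage, mem_ball_zero_iff, EuclideanSpace.norm_eq,
    Real.sqrt_lt_sqrt_iff (by positivity)]
  simp

open MeasureTheory in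
-- The volume is `2π²`; the bound 16 is the `2⁴` of Minkowski's theorem.
lemma volume_sum_sq_lt_two :
    (16 : ENNReal) < volume {y : Fin 4 → ℝ | ∑ i, y i ^ 2 < 2} := by
  rw [setOf_sum_sq_lt_two, (PiLp.volume_preserving_toLp (Fin 4)).measure_preimage
    measurableSet_ball.nullMeasurableSet, EuclideanSpace.volume_ball, Fintype.card_fin,
    ← ENNReal.ofReal_pow (Real.sqrt_nonneg _), ← ENNReal.ofReal_mul (by positivity)]
  have h2 : Real.Gamma ((4 : ℕ) / 2 + 1) = 2 := by
    rw [show ((4 : ℕ) / 2 + 1 : ℝ) = (2 : ℕ) + 1 by norm_num, Real.Gamma_nat_eq_factorial]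
    norm_num
  have h3 : Real.sqrt 2 ^ 4 = 4 := by
    rw [show 4 = 2 * 2 by norm_num, pow_mul, Real.sq_sqrt (by norm_num)]; norm_num
  have h4 : Real.sqrt π ^ 4 = π ^ 2 := by
    rw [show 4 = 2 * 2 by norm_num, pow_mul, Real.sq_sqrt Real.pi_pos.le]
  rw [h2, h3, h4, show (16 : ENNReal) = ENNReal.ofReal 16 by simp,
    ENNReal.ofReal_lt_ofReal_iff_of_nonneg (by norm_num)]
  nlinarith [Real.pi_gt_three]

open MeasureTheory in
open scoped MatrixOrder in
-- Minkowski's theorem for the ellipsoid `|Cx|² < 2`, where `S = CᵀC`. Since `|det C| = 1`, it has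
-- the volume of the ball.
lemma exists_short_vector {S : Matrix (Fin 4) (Fin 4) ℤ}
    (hS : (S.map (Int.cast : ℤ → ℝ)).PosDef) (hdet : S.det = 1) :
    ∃ z : Fin 4 → ℤ, z ≠ 0 ∧ z ⬝ᵥ S.mulVec z < 2 := by
  obtain ⟨C, hC⟩ : ∃ C : Matrix (Fin 4) (Fin 4) ℝ, S.map (Int.cast : ℤ → ℝ) = C.transpose * C := by
    obtain ⟨C, hC⟩ := (CStarAlgebra.nonneg_iff_eq_star_mul_self).1 hS.posSemidef.nonneg
    exact ⟨C, hC⟩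
  have hdetC : |C.det| = 1 := by
    have h1 := congrArg Matrix.det hC
    rw [Matrix.det_mul, Matrix.det_transpose, show (S.map (Int.cast : ℤ → ℝ)).det = (S.det : ℝ) from
      (Int.cast_det (R := ℝ) S).symm, hdet, Int.cast_one] at h1
    rcases mul_self_eq_one_iff.1 h1.symm with h | h <;> rw [h] <;> simp
  set s : Set (Fin 4 → ℝ) := Matrix.toLin' C ⁻¹' {y | ∑ i, y i ^ 2 < 2} with hs
  have hconv : Convex ℝ {y : Fin 4 → ℝ | ∑ i, y i ^ 2 < 2} := by
    rw [setOf_sum_sq_lt_two]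
    exact (convex_ball _ _).linear_preimage (WithLp.linearEquiv 2 ℝ (Fin 4 → ℝ)).symm.toLinearMap
  have hvol : volume s = volume {y : Fin 4 → ℝ | ∑ i, y i ^ 2 < 2} := by
    have hne : LinearMap.det (Matrix.toLin' C) ≠ 0 := by
      rw [LinearMap.det_toLin']
      intro h; rw [h] at hdetC; simp at hdetC
    rw [hs, Measure.addHaar_preimage_linearMap _ hne, LinearMap.det_toLin', abs_inv, hdetC]
    simp
  have hcount : Countable (Submodule.span ℤ (Set.range (Pi.basisFun ℝ (Fin 4)))).toAddSubgroup := by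
    change Countable (Submodule.span ℤ (Set.range (Pi.basisFun ℝ (Fin 4))))
    infer_instance
  obtain ⟨⟨x, hx⟩, hx0, hxs⟩ := exists_ne_zero_mem_lattice_of_measure_mul_two_pow_lt_measure
    (μ := volume) (s := s) (ZSpan.isAddFundamentalDomain' (Pi.basisFun ℝ (Fin 4)) volume)
    (fun x hx => by
      rw [hs, Set.mem_preimage, map_neg]
      rw [hs, Set.mem_preimage] at hx
      simpa only [Set.mem_ofPred_eq, Pi.neg_apply, neg_sq] using hx)
    (hconv.linear_preimage _) (by
      rw [hvol, ZSpan.fundamentalDomain_pi_basisFun, volume_pi_pi]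
      simp only [Real.volume_Ico, sub_zero, ENNReal.ofReal_one, Finset.prod_const_one]
      simp only [Module.finrank_fintype_fun_eq_card, Fintype.card_fin, one_mul]
      refine lt_of_eq_of_lt ?_ volume_sum_sq_lt_two
      norm_num)
  have hz : ∀ i, ∃ z : ℤ, (z : ℝ) = x i := fun i => by
    have := ((Pi.basisFun ℝ (Fin 4)).mem_span_iff_repr_mem ℤ x).1 hx i
    simpa using this
  choose z hz using hz
  have hxz : x = fun i => (z i : ℝ) := funext fun i => (hz i).symm
  refine ⟨z, ?_, ?_⟩
  · rintro rfl
    apply hx0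
    ext i
    simp [hxz]
  · rw [hs, Set.mem_preimage, Matrix.toLin'_apply] at hxs
    have h1 : ∑ i, (C.mulVec x) i ^ 2 = ((z ⬝ᵥ S.mulVec z : ℤ) : ℝ) := by
      have h2 : ((z ⬝ᵥ S.mulVec z : ℤ) : ℝ) = x ⬝ᵥ (S.map (Int.cast : ℤ → ℝ)).mulVec x := by
        rw [hxz]; simp [dotProduct, Matrix.mulVec]
      rw [h2, hC, ← Matrix.mulVec_mulVec, Matrix.dotProduct_mulVec, Matrix.vecMul_transpose]
      simp [dotProduct, sq]
    change ∑ i, (C.mulVec x) i ^ 2 < 2 at hxs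
    rw [h1] at hxs
    exact_mod_cast hxs

lemma dotProduct_mulVec_even {n : ℕ} {S : Matrix (Fin n) (Fin n) ℤ} (hsymm : S.IsSymm)
    (heven : ∀ i, ∃ k : ℤ, S i i = 2 * k) (z : Fin n → ℤ) :
    ∃ k : ℤ, z ⬝ᵥ S.mulVec z = 2 * k := by
  have h : ((z ⬝ᵥ S.mulVec z : ℤ) : ZMod 2) = 0 := by
    simp only [dotProduct, Matrix.mulVec, Finset.mul_sum]
    push_cast
    rw [← Finset.sum_product', Finset.univ_product_univ]
    refine Finset.sum_involution (fun ij _ => ij.swap) (fun ij _ => ?_) (fun ij _ hne heq => ?_)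
      (fun _ _ => Finset.mem_univ _) (fun _ _ => Prod.swap_swap _)
    · rw [Prod.fst_swap, Prod.snd_swap, hsymm.apply ij.1 ij.2, mul_left_comm (z ij.2 : ZMod 2),
        mul_comm (z ij.2 : ZMod 2) (z ij.1 : ZMod 2), mul_left_comm (z ij.1 : ZMod 2)]
      exact CharTwo.add_self_eq_zero _
    · have h1 : ij.1 = ij.2 := congrArg Prod.snd heq
      obtain ⟨k, hk⟩ := heven ij.1
      apply hne
      rw [← h1, hk]
      have h2 : (2 : ZMod 2) = 0 := rfl
      push_cast
      rw [h2]
      ring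
  obtain ⟨k, hk⟩ := (ZMod.intCast_zmod_eq_zero_iff_dvd _ 2).1 h
  exact ⟨k, hk⟩

/-- A nonzero vector of norm below 2 cannot exist in an even positive definite lattice. -/
theorem no_even_unimodular_rank_four {S : Matrix (Fin 4) (Fin 4) ℤ}
    (hS : (S.map (Int.cast : ℤ → ℝ)).PosDef) (hsymm : S.IsSymm)
    (heven : ∀ i, ∃ k : ℤ, S i i = 2 * k) : S.det ≠ 1 := by
  intro hdet
  obtain ⟨z, hz, h1⟩ := exists_short_vector hS hdet
  obtain ⟨k, hk⟩ := dotProduct_mulVec_even hsymm heven z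
  have h2 : 0 < z ⬝ᵥ S.mulVec z := by
    have hz' : (fun i => (z i : ℝ)) ≠ 0 := fun h => hz (by
      ext i; have := congrFun h i; simpa using this)
    have h3 := hS.dotProduct_mulVec_pos hz'
    have h4 : star (fun i => (z i : ℝ)) ⬝ᵥ (S.map (Int.cast : ℤ → ℝ)).mulVec (fun i => (z i : ℝ)) =
        ((z ⬝ᵥ S.mulVec z : ℤ) : ℝ) := by simp [dotProduct, Matrix.mulVec]
    rw [h4] at h3
    exact_mod_cast h3
  omega

end FakeMonster

end

open scoped Real

noncomputable section

namespace FakeMonster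

variable {A : Matrix (Fin 8) (Fin 8) ℤ} {p m : ℕ}

/-! ### The Gram matrix of the fixed lattice -/

lemma dualLattice_neg {V : Type*} [AddCommGroup V] [Module ℚ V] (B : LinearMap.BilinForm ℚ V)
    (M : Submodule ℤ V) : dualLattice (-B) M = dualLattice B M := by
  ext x
  rw [mem_dualLattice, mem_dualLattice]
  refine and_congr_left fun _ => forall₂_congr fun y _ => ?_
  rw [LinearMap.neg_apply, LinearMap.neg_apply]
  constructor <;> rintro ⟨n, hn⟩ <;> exact ⟨-n, by push_cast; linarith⟩

lemma card_discGroup_neg {V : Type*} [AddCommGroup V] [Module ℚ V] (B : LinearMap.BilinForm ℚ V)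
    (M : Submodule ℤ V) : Nat.card (DiscGroup (-B) M) = Nat.card (DiscGroup B M) := by
  unfold DiscGroup
  rw [dualLattice_neg]

lemma fixedLattice_isEvenLattice_pos : IsEvenLattice e8Form (fixedLattice A) where
  symm := e8Form_symm
  even _ hx := e8Form_self_even (mem_fixedLattice.1 hx).1

lemma fixedLattice_fg : (fixedLattice A).FG := by
  let c : (Fin 8 → ℤ) →ₗ[ℤ] (Fin 8 → ℚ) :=
    { toFun := fun x i => (x i : ℚ)
      map_add' := fun x y => by ext; simp
      map_smul' := fun k x => by ext; simp }
  have h : fixedLattice A = (LinearMap.ker (Matrix.toLin' A - LinearMap.id)).map c := by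
    ext v
    rw [Submodule.mem_map]
    constructor
    · rintro ⟨x, hx, rfl⟩
      exact ⟨x, by simp [hx], rfl⟩
    · rintro ⟨x, hx, rfl⟩
      refine ⟨x, ?_, rfl⟩
      rw [LinearMap.mem_ker, LinearMap.sub_apply, sub_eq_zero] at hx
      simpa using hx
  rw [h]
  exact (IsNoetherian.noetherian _).map c

lemma exists_fixed_gram (hp : 0 < p) (hA : IsE8Automorphism A) (hs : HasCycleShape A p m) :
    ∃ (b : Fin (2 * m) → Fin 8 → ℚ) (S : Matrix (Fin (2 * m)) (Fin (2 * m)) ℤ),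
      IsGram e8Form (fixedLattice A) b S :=
  exists_isGram fixedLattice_isEvenLattice_pos fixedLattice_fg (finrank_span_fixedLattice hp hA hs)

lemma card_fixedDisc {n : ℕ} {b : Fin n → Fin 8 → ℚ} {S : Matrix (Fin n) (Fin n) ℤ}
    (hG : IsGram e8Form (fixedLattice A) b S) : (Nat.card (FixedDisc A) : ℤ) = S.det := by
  rw [FixedDisc, card_discGroup_neg, hG.card_discGroup fixedLattice_isEvenLattice_pos
    fun _ => e8Form_self_pos, Int.natCast_natAbs, abs_of_pos]
  exact hG.det_pos fixedLattice_isEvenLattice_pos fun _ => e8Form_self_pos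

/-- The Gram matrix of the rescaled dual lattice. -/
lemma exists_dual_gram (hodd : Odd p) (hA : IsE8Automorphism A) (hs : HasCycleShape A p m) {n : ℕ}
    {b : Fin n → Fin 8 → ℚ} {S : Matrix (Fin n) (Fin n) ℤ}
    (hG : IsGram e8Form (fixedLattice A) b S) :
    ∃ T : Matrix (Fin n) (Fin n) ℤ, S * T = (p : ℤ) • (1 : Matrix (Fin n) (Fin n) ℤ) ∧
      ∀ i, ∃ k : ℤ, T i i = 2 * k := by
  have hE := fixedLattice_isEvenLattice_pos (A := A)
  have hp' : (p : ℚ) ≠ 0 := by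
    have := hodd.pos
    exact_mod_cast this.ne'
  set SQ : Matrix (Fin n) (Fin n) ℚ := S.map (Int.cast : ℤ → ℚ) with hSQ
  have hdet : IsUnit SQ.det := by
    rw [isUnit_iff_ne_zero]
    have := Int.cast_det (R := ℚ) S
    rw [show SQ.det = (S.det : ℚ) from this.symm]
    exact_mod_cast hG.det_ne_zero fun _ => e8Form_self_pos
  -- These are the coordinates of the dual basis. The matrix `T = p S⁻¹` is integral because `p`
  -- times the dual lies in the lattice, and its diagonal is even by `exists_mul_half_norm`.
  set r : Fin n → Fin n → ℚ := fun i => SQ⁻¹.mulVec (Pi.single i 1) with hr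
  have hSr : ∀ i, SQ.mulVec (r i) = Pi.single i 1 := fun i => by
    rw [hr, Matrix.mulVec_mulVec, Matrix.mul_nonsing_inv _ hdet, Matrix.one_mulVec]
  have hmem : ∀ i, ∑ j, r i j • b j ∈ fixedDual A := fun i => by
    rw [fixedDual, dualLattice_neg, hG.sum_mem_dual_iff hE]
    refine ⟨Pi.single i 1, ?_⟩
    rw [← hSQ, hSr]
    ext j
    rcases eq_or_ne j i with rfl | h <;> simp [*]
  have hz : ∀ i, ∃ z : Fin n → ℤ, ∀ j, (p : ℚ) * r i j = z j := fun i => by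
    obtain ⟨z, hz⟩ := (hG.mem_iff _).1 (smul_mem_fixedLattice hA hs (hmem i))
    rw [Finset.smul_sum] at hz
    simp_rw [smul_smul] at hz
    exact ⟨z, congrFun (hG.coords_eq hz)⟩
  choose z hz using hz
  have hSz : ∀ i j, (S.mulVec (z j) i : ℚ) = if i = j then (p : ℚ) else 0 := by
    intro i j
    have h1 : (S.mulVec (z j) i : ℚ) = p * SQ.mulVec (r j) i := by
      simp only [Matrix.mulVec, dotProduct, Finset.mul_sum, hSQ, Matrix.map_apply]
      push_cast
      refine Finset.sum_congr rfl fun k _ => ?_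
      rw [← hz]; ring
    rw [h1, hSr]
    rcases eq_or_ne i j with rfl | h <;> simp [*]
  refine ⟨Matrix.of fun i j => z j i, ?_, fun i => ?_⟩
  · ext i j
    have h1 := hSz i j
    have h2 : (S * Matrix.of fun i j => z j i) i j = S.mulVec (z j) i := rfl
    rw [h2, Matrix.smul_apply, Matrix.one_apply]
    split_ifs at h1 ⊢
    · simp only [smul_eq_mul, mul_one]; exact_mod_cast h1
    · simp only [smul_zero]; exact_mod_cast h1
  · obtain ⟨k, hk⟩ := exists_mul_half_norm hodd hA hs (hmem i)
    refine ⟨k, ?_⟩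
    have h1 : e8Form (∑ j, r i j • b j) (∑ j, r i j • b j) = r i i := by
      rw [hG.bilin, ← hSQ, hSr, dotProduct_single_one]
    rw [h1] at hk
    have h2 := hz i i
    have h3 : ((z i i : ℤ) : ℚ) = ((2 * k : ℤ) : ℚ) := by push_cast; rw [← hk, ← h2]; ring
    rw [Matrix.of_apply]
    exact_mod_cast h3

lemma card_fixedDisc_dvd (hodd : Odd p) (hA : IsE8Automorphism A) (hs : HasCycleShape A p m)
    {n : ℕ} {b : Fin n → Fin 8 → ℚ} {S : Matrix (Fin n) (Fin n) ℤ}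
    (hG : IsGram e8Form (fixedLattice A) b S) : Nat.card (FixedDisc A) ∣ p ^ n := by
  obtain ⟨T, hT, -⟩ := exists_dual_gram hodd hA hs hG
  have h1 := congrArg Matrix.det hT
  rw [Matrix.det_mul, Matrix.det_smul, Matrix.det_one, mul_one, Fintype.card_fin] at h1
  have h2 : (Nat.card (FixedDisc A) : ℤ) ∣ (p : ℤ) ^ n := ⟨T.det, by rw [card_fixedDisc hG, h1]⟩
  exact_mod_cast h2

lemma det_fin_four_mod_four {S : Matrix (Fin 4) (Fin 4) ℤ} (hsymm : S.IsSymm)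
    (heven : ∀ i, ∃ k : ℤ, S i i = 2 * k) : ∃ x y : ℤ, S.det = x ^ 2 + 4 * y := by
  choose k hk using heven
  have h10 := hsymm.apply 0 1
  have h20 := hsymm.apply 0 2
  have h30 := hsymm.apply 0 3
  have h21 := hsymm.apply 1 2
  have h31 := hsymm.apply 1 3
  have h32 := hsymm.apply 2 3
  have hdet : S.det =
      S 0 0 * (S 1 1 * (S 2 2 * S 3 3 - S 2 3 * S 3 2) - S 1 2 * (S 2 1 * S 3 3 - S 2 3 * S 3 1)
        + S 1 3 * (S 2 1 * S 3 2 - S 2 2 * S 3 1)) -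
      S 0 1 * (S 1 0 * (S 2 2 * S 3 3 - S 2 3 * S 3 2) - S 1 2 * (S 2 0 * S 3 3 - S 2 3 * S 3 0)
        + S 1 3 * (S 2 0 * S 3 2 - S 2 2 * S 3 0)) +
      S 0 2 * (S 1 0 * (S 2 1 * S 3 3 - S 2 3 * S 3 1) - S 1 1 * (S 2 0 * S 3 3 - S 2 3 * S 3 0)
        + S 1 3 * (S 2 0 * S 3 1 - S 2 1 * S 3 0)) -
      S 0 3 * (S 1 0 * (S 2 1 * S 3 2 - S 2 2 * S 3 1) - S 1 1 * (S 2 0 * S 3 2 - S 2 2 * S 3 0)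
        + S 1 2 * (S 2 0 * S 3 1 - S 2 1 * S 3 0)) := by
    rw [Matrix.det_succ_row_zero, Fin.sum_univ_four]
    simp only [Matrix.det_fin_three, Matrix.submatrix_apply]
    simp [Fin.succAbove, Fin.succ, Fin.lt_def, Fin.castSucc, Fin.castAdd, Fin.castLE]
    ring
  rw [h10, h20, h30, h21, h31, h32, hk 0, hk 1, hk 2, hk 3] at hdet
  rw [hdet]
  -- Modulo 4 the determinant is the square of the Pfaffian built from the entries above the
  -- diagonal.
  refine ⟨S 0 1 * S 2 3 - S 0 2 * S 1 3 + S 0 3 * S 1 2,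
    4 * k 0 * k 1 * k 2 * k 3 - (k 0 * k 1 * S 2 3 ^ 2 + k 0 * k 2 * S 1 3 ^ 2 +
      k 0 * k 3 * S 1 2 ^ 2 + k 1 * k 2 * S 0 3 ^ 2 + k 1 * k 3 * S 0 2 ^ 2 +
      k 2 * k 3 * S 0 1 ^ 2) + (k 0 * S 1 2 * S 1 3 * S 2 3 + k 1 * S 0 2 * S 0 3 * S 2 3 +
      k 2 * S 0 1 * S 0 3 * S 1 3 + k 3 * S 0 1 * S 0 2 * S 1 2) -
      S 0 1 * S 2 3 * S 0 3 * S 1 2, ?_⟩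
  ring

/-! ### The discriminant form for `p = 3` -/

/-- The order divides 81. Being a square mod 4 excludes 3 and 27. The orders 1 and 81 would make the
lattice, respectively its dual rescaled by 3, even unimodular of rank 4. -/
lemma card_fixedDisc_three (hA : IsE8Automorphism A) (hs : HasCycleShape A 3 2) :
    Nat.card (FixedDisc A) = 9 := by
  have hE := fixedLattice_isEvenLattice_pos (A := A)
  obtain ⟨b, S, hG⟩ := exists_fixed_gram (by norm_num) hA hs
  have hpos := hG.posDef hE fun _ => e8Form_self_pos
  have hsymm := hG.isSymm hE
  have heven := hG.even_diag hE
  have hcard := card_fixedDisc hG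
  have hdvd := card_fixedDisc_dvd (by decide) hA hs hG
  have h1 := no_even_unimodular_rank_four hpos hsymm heven
  obtain ⟨x, y, hxy⟩ := det_fin_four_mod_four hsymm heven
  have h81 : S.det ≠ 81 := by
    intro h81
    obtain ⟨T, hT, hTeven⟩ := exists_dual_gram (by decide) hA hs hG
    have hdetT : T.det = 1 := by
      have h2 := congrArg Matrix.det hT
      rw [Matrix.det_mul, Matrix.det_smul, Matrix.det_one, h81] at h2
      norm_num at h2
      linarith
    have hTR : T.map (Int.cast : ℤ → ℝ) = (3 : ℝ) • (S.map (Int.cast : ℤ → ℝ))⁻¹ := by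
      have h2 := congrArg (fun X : Matrix _ _ ℤ => X.map (Int.castRingHom ℝ)) hT
      simp only [Matrix.map_mul] at h2
      have h3 : ((((3 : ℕ) : ℤ) • (1 : Matrix (Fin (2 * 2)) (Fin (2 * 2)) ℤ)).map
          (Int.castRingHom ℝ)) = (3 : ℝ) • 1 := by
        ext i j
        rw [Matrix.map_apply, Matrix.smul_apply, Matrix.smul_apply, Matrix.one_apply,
          Matrix.one_apply]
        split_ifs <;> simp
      rw [h3] at h2
      have h4 := congrArg (fun X => (S.map (Int.cast : ℤ → ℝ))⁻¹ * X) h2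
      simp only [← mul_assoc] at h4
      change (S.map (Int.cast : ℤ → ℝ))⁻¹ * (S.map (Int.cast : ℤ → ℝ)) *
        (T.map (Int.cast : ℤ → ℝ)) = _ at h4
      rw [Matrix.nonsing_inv_mul _ (isUnit_iff_ne_zero.2 hpos.det_pos.ne'), one_mul,
        mul_smul_comm, mul_one] at h4
      exact h4
    have hTpos : (T.map (Int.cast : ℤ → ℝ)).PosDef := by
      rw [hTR]
      exact hpos.inv.smul (by norm_num)
    have hTsymm : T.IsSymm := by
      ext i j
      have h2 := congrFun (congrFun hTpos.isHermitian i) j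
      simp only [Matrix.conjTranspose_apply, Matrix.map_apply, star_trivial] at h2
      exact_mod_cast h2
    exact no_even_unimodular_rank_four hTpos hTsymm hTeven hdetT
  obtain ⟨k, hk, hk2⟩ := (Nat.dvd_prime_pow Nat.prime_three).1 hdvd
  have hx : x ^ 2 % 4 = 0 ∨ x ^ 2 % 4 = 1 := by
    rcases Int.emod_two_eq_zero_or_one x with h | h
    · left
      obtain ⟨t, rfl⟩ := Int.dvd_of_emod_eq_zero h
      ring_nf; omega
    · right
      obtain ⟨t, ht⟩ : ∃ t, x = 2 * t + 1 := ⟨x / 2, by omega⟩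
      subst ht
      ring_nf; omega
  rw [hk2] at hcard ⊢
  interval_cases k <;> norm_num at hcard ⊢ <;> omega

end FakeMonster

end

/-! ### The Gauss sum for `p = 3`. -/

open scoped Real

noncomputable section

namespace FakeMonster

variable {p m : ℕ}

namespace IsQuadraticCharacter

variable {G : Type*} [AddCommGroup G] {ε : G → ℂ} {β : G → G → ℂ} (h : IsQuadraticCharacter ε β)

include h

/-- The product of a Gauss sum with its conjugate. -/
lemma sum_mul_sum_inv [Fintype G] [DecidableEq G] :
    (∑ x, ε x) * ∑ x, (ε x)⁻¹ = Fintype.card G := by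
  have h1 : ∀ y, (∑ x, ε x) * (ε y)⁻¹ = ∑ x, ε x * (β x (-y))⁻¹ := by
    intro y
    rw [← Equiv.sum_comp (Equiv.addRight y), Finset.sum_mul]
    refine Finset.sum_congr rfl fun x _ => ?_
    have h2 := h.beta_add x y (-y)
    rw [add_neg_cancel, h.beta_zero] at h2
    have h3 : (β x (-y))⁻¹ = β x y := inv_eq_of_mul_eq_one_left h2.symm
    rw [Equiv.coe_addRight, h.add, h3]
    have := h.ne_zero y
    field_simp
  rw [Finset.mul_sum]
  simp_rw [h1]
  rw [Finset.sum_comm]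
  have h2 : ∀ x, ∑ y, ε x * (β x (-y))⁻¹ = if x = 0 then (Fintype.card G : ℂ) else 0 := by
    intro x
    have h3 : ∑ y, (β x (-y))⁻¹ = ∑ y, (β x y)⁻¹ :=
      Equiv.sum_comp (Equiv.neg G) (fun y => (β x y)⁻¹)
    rw [← Finset.mul_sum, h3, h.sum_beta_inv]
    split_ifs with hx
    · rw [hx, h.eps_zero, one_mul]
    · rw [mul_zero]
  simp_rw [h2]
  simp

/-- Each of the eight nonzero elements contributes a primitive cube root of unity plus its inverse,
that is `-1`, to the sum of the two Gauss sums. So they add up to `2 - 8 = -6` and multiply to 9,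
which forces both to be `-3`. -/
lemma sum_eq_neg_three [Fintype G] [DecidableEq G] (hcard : Fintype.card G = 9)
    (hexp : ∀ x, ε x ^ 3 = 1) (haniso : ∀ x, ε x = 1 → x = 0) :
    ∑ x, ε x = -3 ∧ ∑ x, (ε x)⁻¹ = -3 := by
  have h1 := h.sum_mul_sum_inv
  rw [hcard] at h1
  have h2 : ∑ x, ε x + ∑ x, (ε x)⁻¹ = -6 := by
    rw [← Finset.sum_add_distrib, ← Finset.add_sum_erase _ _ (Finset.mem_univ 0), h.eps_zero]
    have h3 : ∀ x ∈ Finset.univ.erase (0 : G), ε x + (ε x)⁻¹ = -1 := by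
      intro x hx
      have h4 : ε x ≠ 1 := fun h4 => Finset.ne_of_mem_erase hx (haniso x h4)
      have h5 : (ε x - 1) * (ε x ^ 2 + ε x + 1) = 0 := by linear_combination hexp x
      have h6 := (mul_eq_zero.1 h5).resolve_left (sub_ne_zero.2 h4)
      have := h.ne_zero x
      field_simp
      linear_combination h6
    rw [Finset.sum_congr rfl h3, Finset.sum_const, Finset.card_erase_of_mem (Finset.mem_univ _),
      Finset.card_univ, hcard]
    norm_num
  set s := ∑ x, ε x
  set t := ∑ x, (ε x)⁻¹
  have h3 : s = -3 := by
    have h4 : (s + 3) ^ 2 = 0 := by push_cast at h1; linear_combination s * h2 - h1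
    linear_combination (pow_eq_zero_iff two_ne_zero).1 h4
  exact ⟨h3, by linear_combination h2 - h3⟩

/-- In a plane over the field with `p` elements an isotropic line is its own orthogonal
complement. -/
lemma exists_nsmul_of_beta_eq_one [Finite G] (hp : p.Prime) (hcard : Nat.card G = p ^ 2)
    (hG : ∀ x : G, p • x = 0) {x y : G} (hx : x ≠ 0) (hxx : ε x = 1) (hy : β x y = 1) :
    ∃ k : ℤ, y = k • x := by
  have : Fact p.Prime := ⟨hp⟩
  let H : AddSubgroup G :=
    { carrier := {y | β x y = 1}
      zero_mem' := h.beta_zero x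
      add_mem' := fun {a b} ha hb => by
        rw [Set.mem_ofPred_eq] at *
        rw [h.beta_add, ha, hb, one_mul]
      neg_mem' := fun {a} ha => by
        rw [Set.mem_ofPred_eq] at *
        have h1 := h.beta_add x a (-a)
        rw [add_neg_cancel, h.beta_zero, ha, one_mul] at h1
        exact h1.symm }
  have hle : AddSubgroup.zmultiples x ≤ H := by
    rw [AddSubgroup.zmultiples_le]
    change β x x = 1
    rw [h.beta_self, hxx, one_pow]
  have hZ : Nat.card (AddSubgroup.zmultiples x) = p := by
    rw [Nat.card_zmultiples]
    exact addOrderOf_eq_prime (hG x) hx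
  have hH : Nat.card H ≤ p := by
    have hdvd : Nat.card H ∣ p ^ 2 := hcard ▸ AddSubgroup.card_addSubgroup_dvd_card H
    obtain ⟨k, hk, hk2⟩ := (Nat.dvd_prime_pow hp).1 hdvd
    have hk1 : k ≠ 2 := by
      rintro rfl
      have htop : H = ⊤ := AddSubgroup.eq_top_of_card_eq _ (by rw [hk2, hcard])
      refine hx (h.nondegenerate x fun y => ?_)
      have : y ∈ H := by rw [htop]; exact AddSubgroup.mem_top y
      exact this
    rw [hk2]
    calc p ^ k ≤ p ^ 1 := Nat.pow_le_pow_right hp.pos (by omega)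
      _ = p := pow_one p
  have heq := AddSubgroup.eq_of_le_of_card_ge hle (by rw [hZ]; exact hH)
  have hyH : y ∈ H := hy
  rw [← heq, AddSubgroup.mem_zmultiples_iff] at hyH
  obtain ⟨k, hk⟩ := hyH
  exact ⟨k, hk.symm⟩

end IsQuadraticCharacter

variable {A : Matrix (Fin 8) (Fin 8) ℤ}

/-- The discriminant form for `p = 3` is anisotropic, since otherwise there would be an even
unimodular positive definite lattice of rank `4`. -/
lemma fixedDisc_three_anisotropic (hA : IsE8Automorphism A) (hs : HasCycleShape A 3 2)
    (γ : FixedDisc A) (hγ : discEps (-e8Form) (fixedLattice A) γ = 1) : γ = 0 := by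
  by_contra hγ0
  have hE := fixedLattice_isEvenLattice (A := A)
  have hcard := card_fixedDisc_three hA hs
  have hQ := fixedDisc_isQuadraticCharacter (by norm_num) hA hs
  have : Finite (FixedDisc A) := Nat.finite_of_card_ne_zero (by rw [hcard]; norm_num)
  obtain ⟨y, rfl⟩ := Submodule.Quotient.mk_surjective _ γ
  have hyD : (y : Fin 8 → ℚ) ∈ fixedDual A := y.2
  obtain ⟨hy1, hy2⟩ := mem_fixedDual.1 hyD
  have hyy : ∃ n : ℤ, e8Form y y = 2 * n := by
    rw [hE.discEps_mk, e_rat_eq_one_iff] at hγ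
    obtain ⟨n, hn⟩ := hγ
    rw [LinearMap.neg_apply, LinearMap.neg_apply] at hn
    exact ⟨-n, by push_cast; linarith⟩
  set M : Submodule ℤ (Fin 8 → ℚ) := fixedLattice A ⊔ Submodule.span ℤ {(y : Fin 8 → ℚ)} with hM
  have hLM : fixedLattice A ≤ M := le_sup_left
  have hyM : (y : Fin 8 → ℚ) ∈ M := (le_sup_right : _ ≤ M) (Submodule.mem_span_singleton_self _)
  have hmem : ∀ x ∈ M, ∃ l ∈ fixedLattice A, ∃ k : ℤ, x = l + k • (y : Fin 8 → ℚ) := by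
    intro x hx
    obtain ⟨l, hl, z, hz, rfl⟩ := Submodule.mem_sup.1 hx
    obtain ⟨k, rfl⟩ := Submodule.mem_span_singleton.1 hz
    exact ⟨l, hl, k, rfl⟩
  have hEM : IsEvenLattice e8Form M := by
    refine ⟨e8Form_symm, fun x hx => ?_⟩
    obtain ⟨l, hl, k, rfl⟩ := hmem x hx
    obtain ⟨a, ha⟩ := e8Form_self_even (mem_fixedLattice.1 hl).1
    obtain ⟨b, hb⟩ := hy1 l hl
    obtain ⟨c, hc⟩ := hyy
    refine ⟨a + k * b + k ^ 2 * c, ?_⟩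
    rw [← Int.cast_smul_eq_zsmul ℚ]
    simp only [map_add, LinearMap.add_apply, map_smul, LinearMap.smul_apply, smul_eq_mul, ha,
      hc, e8Form_symm l y, hb]
    push_cast
    ring
  have hspan : Submodule.span ℚ (M : Set (Fin 8 → ℚ)) =
      Submodule.span ℚ (fixedLattice A : Set (Fin 8 → ℚ)) := by
    apply le_antisymm
    · refine Submodule.span_le.2 fun x hx => ?_
      obtain ⟨l, hl, k, rfl⟩ := hmem x hx
      refine mem_span_fixedLattice.2 ?_
      rw [map_add, map_zsmul, hy2, (mem_fixedLattice.1 hl).2]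
    · exact Submodule.span_mono hLM
  -- A dual vector of `M` pairs integrally with `y`, so its class is orthogonal to the isotropic
  -- class of `y` and hence a multiple of it: `M` is unimodular.
  have hself : ∀ x ∈ dualLattice e8Form M, x ∈ M := by
    intro x hx
    obtain ⟨hx1, hx2⟩ := mem_dualLattice.1 hx
    rw [hspan] at hx2
    have hxD : x ∈ dualLattice (-e8Form) (fixedLattice A) := by
      rw [dualLattice_neg, mem_dualLattice]
      exact ⟨fun z hz => hx1 z (hLM hz), hx2⟩
    obtain ⟨n, hn⟩ := hx1 _ hyM
    have hβ : discBeta (-e8Form) (fixedLattice A) (Submodule.Quotient.mk y)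
        (Submodule.Quotient.mk ⟨x, hxD⟩) = 1 := by
      rw [hE.discBeta_mk, e_rat_eq_one_iff]
      refine ⟨-n, ?_⟩
      rw [LinearMap.neg_apply, LinearMap.neg_apply, e8Form_symm, hn]
      push_cast; rfl
    obtain ⟨k, hk⟩ := hQ.exists_nsmul_of_beta_eq_one Nat.prime_three (by rw [hcard]; norm_num)
      (fixedDisc_nsmul hA hs) hγ0 hγ hβ
    rw [← Submodule.Quotient.mk_smul, Submodule.Quotient.eq, mem_submoduleOf_iff] at hk
    have h1 : x = (x - k • (y : Fin 8 → ℚ)) + k • (y : Fin 8 → ℚ) := by abel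
    rw [h1]
    exact M.add_mem (hLM hk) (M.smul_mem k hyM)
  have hfg : M.FG := fixedLattice_fg.sup (Submodule.fg_span_singleton _)
  obtain ⟨b, S, hG⟩ := exists_isGram hEM hfg (n := 4)
    (by rw [hspan, finrank_span_fixedLattice (by norm_num) hA hs])
  have hdet : S.det = 1 := by
    have h1 := hG.card_discGroup hEM fun _ => e8Form_self_pos
    have h2 : Subsingleton (DiscGroup e8Form M) := by
      refine ⟨fun a b => ?_⟩
      obtain ⟨a, rfl⟩ := Submodule.Quotient.mk_surjective _ a
      obtain ⟨b, rfl⟩ := Submodule.Quotient.mk_surjective _ b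
      rw [Submodule.Quotient.eq, mem_submoduleOf_iff]
      exact hself _ (a - b).2
    rw [Nat.card_unique] at h1
    have h3 := hG.det_pos hEM fun _ => e8Form_self_pos
    omega
  exact no_even_unimodular_rank_four (hG.posDef hEM fun _ => e8Form_self_pos) (hG.isSymm hEM)
    (hG.even_diag hEM) hdet

lemma fixedDisc_three_gauss (hA : IsE8Automorphism A) (hs : HasCycleShape A 3 2)
    [Fintype (FixedDisc A)] {l : ℕ} (hl : ¬ 3 ∣ l) :
    ∑ y, (discEps (-e8Form) (fixedLattice A) y ^ (2 * l))⁻¹ = -3 := by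
  classical
  have hexp := fixedDisc_eps_pow (p := 3) (by decide) hA hs
  obtain ⟨h1, h2⟩ := (fixedDisc_isQuadraticCharacter (by norm_num) hA hs).sum_eq_neg_three
    (by rw [← Nat.card_eq_fintype_card, card_fixedDisc_three hA hs]) hexp
    (fixedDisc_three_anisotropic hA hs)
  have h3 : l % 3 = 1 ∨ l % 3 = 2 := by omega
  rcases h3 with h3 | h3
  · rw [← h1]
    refine Finset.sum_congr rfl fun y _ => ?_
    refine inv_eq_of_mul_eq_one_right ?_
    rw [← pow_succ, show 2 * l + 1 = 3 * ((2 * l + 1) / 3) by omega, pow_mul, hexp, one_pow]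
  · rw [← h2]
    refine Finset.sum_congr rfl fun y _ => ?_
    rw [show 2 * l = 3 * (2 * l / 3) + 1 by omega, pow_succ, pow_mul, hexp, one_pow, one_mul]

end FakeMonster

end

open scoped Real

noncomputable section

namespace FakeMonster

variable {A : Matrix (Fin 8) (Fin 8) ℤ}

/-! ### The discriminant form for `p = 7` -/

/-- Reduction of positive definite binary quadratic forms of discriminant `-7`. -/
lemma exists_binary_form_eq_one (a : ℕ) : ∀ b c : ℤ, 4 * (a : ℤ) * c - b ^ 2 = 7 →
    ∃ x y : ℤ, a * x ^ 2 + b * x * y + c * y ^ 2 = 1 := by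
  induction a using Nat.strong_induction_on with
  | _ a ih =>
    intro b c h
    have ha : 0 < (a : ℤ) := by
      rcases Nat.eq_zero_or_pos a with rfl | ha
      · push_cast at h; nlinarith [sq_nonneg b]
      · exact_mod_cast ha
    by_cases h1 : (a : ℤ) = 1
    · exact ⟨1, 0, by rw [h1]; ring⟩
    -- translate so that `|b| ≤ a`
    obtain ⟨k, hk1, hk2⟩ : ∃ k : ℤ, -(a : ℤ) ≤ b + 2 * a * k ∧ b + 2 * a * k ≤ a := by
      refine ⟨-((b + a) / (2 * a)), ?_⟩
      have e1 := Int.emod_add_mul_ediv (b + a) (2 * a)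
      have e2 := Int.emod_nonneg (b + a) (b := 2 * a) (by omega)
      have e3 := Int.emod_lt_of_pos (b + a) (b := 2 * a) (by omega)
      constructor <;> linarith
    set b' := b + 2 * a * k with hb'
    set c' := a * k ^ 2 + b * k + c with hc'
    have h2 : 4 * (a : ℤ) * c' - b' ^ 2 = 7 := by rw [hb', hc']; linear_combination h
    have hb2 : b' ^ 2 ≤ (a : ℤ) ^ 2 := sq_le_sq' hk1 hk2
    have hc0 : 0 < c' := by
      by_contra hc0
      push Not at hc0
      nlinarith [sq_nonneg b']
    -- For `a ≥ 2`, `4ac' = 7 + b'² ≤ 7 + a² < 4a²`, so exchanging the outer coefficients decreases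
    -- the first one.
    have hc1 : c' < a := by
      by_contra hc1
      push Not at hc1
      have ha2 : 2 ≤ (a : ℤ) := by omega
      nlinarith
    obtain ⟨n, hn⟩ := Int.eq_ofNat_of_zero_le hc0.le
    obtain ⟨x, y, hxy⟩ := ih n (by omega) b' a (by rw [← hn]; linarith)
    refine ⟨y + k * x, x, ?_⟩
    rw [← hn, hb', hc'] at hxy
    linear_combination hxy

/-- The order divides 49, and `4ac - b²` is 0 or 3 mod 4, which excludes 1 and 49. -/
lemma card_fixedDisc_seven_of_gram (hA : IsE8Automorphism A) (hs : HasCycleShape A 7 1)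
    {b : Fin 2 → Fin 8 → ℚ} {S : Matrix (Fin 2) (Fin 2) ℤ}
    (hG : IsGram e8Form (fixedLattice A) b S) : Nat.card (FixedDisc A) = 7 := by
  have hE := fixedLattice_isEvenLattice_pos (A := A)
  have hcard := card_fixedDisc hG
  have hdvd := card_fixedDisc_dvd (by decide) hA hs hG
  obtain ⟨a, ha⟩ := hG.even_diag hE 0
  obtain ⟨c, hc⟩ := hG.even_diag hE 1
  have hsymm := (hG.isSymm hE).apply 0 1
  rw [Matrix.det_fin_two, ha, hc, hsymm] at hcard
  obtain ⟨k, hk, hk2⟩ := (Nat.dvd_prime_pow (by norm_num : Nat.Prime 7)).1 hdvd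
  have hx : (S 0 1 * S 0 1) % 4 = 0 ∨ (S 0 1 * S 0 1) % 4 = 1 := by
    rcases Int.emod_two_eq_zero_or_one (S 0 1) with h | h
    · left
      obtain ⟨t, ht⟩ := Int.dvd_of_emod_eq_zero h
      rw [ht]; ring_nf; omega
    · right
      obtain ⟨t, ht⟩ : ∃ t, S 0 1 = 2 * t + 1 := ⟨S 0 1 / 2, by omega⟩
      rw [ht]; ring_nf; omega
  have h4 : 2 * a * (2 * c) = 4 * (a * c) := by ring
  rw [h4] at hcard
  rw [hk2] at hcard ⊢
  interval_cases k <;> norm_num at hcard ⊢ <;> omega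

/-- The discriminant group is generated by an element of norm `γ²/2 = 1/7`. -/
lemma exists_fixedDisc_seven_generator (hA : IsE8Automorphism A) (hs : HasCycleShape A 7 1) :
    Nat.card (FixedDisc A) = 7 ∧
      ∃ γ : FixedDisc A, discEps (-e8Form) (fixedLattice A) γ = e (-1 / 7) := by
  have hE := fixedLattice_isEvenLattice_pos (A := A)
  obtain ⟨b, S, hG⟩ := exists_fixed_gram (by norm_num) hA hs
  have h7 := card_fixedDisc_seven_of_gram hA hs hG
  refine ⟨h7, ?_⟩
  have hcard := card_fixedDisc hG
  obtain ⟨a, ha⟩ := hG.even_diag hE 0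
  obtain ⟨c, hc⟩ := hG.even_diag hE 1
  have hsymm := (hG.isSymm hE).apply 0 1
  have hdet2 : S.det = S 0 0 * S 1 1 - S 0 1 * S 1 0 := Matrix.det_fin_two S
  rw [hdet2, ha, hc, hsymm, h7] at hcard
  push_cast at hcard
  have ha0 : 0 ≤ a := by
    have h1 := e8Form_self_nonneg (b 0)
    rw [hG.gram, ha] at h1
    have h2 : (0 : ℤ) ≤ 2 * a := by exact_mod_cast h1
    omega
  obtain ⟨n, rfl⟩ := Int.eq_ofNat_of_zero_le ha0
  obtain ⟨x, y, hxy⟩ := exists_binary_form_eq_one n (S 0 1) c (by linarith)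
  -- the vector of the dual lattice with coordinates `(-y, x)` in the dual basis
  set r : Fin 2 → ℚ := ![(-(2 * c * y) - S 0 1 * x) / 7, (S 0 1 * y + 2 * n * x) / 7] with hr
  have hdQ : (7 : ℚ) = 2 * n * (2 * c) - S 0 1 * S 0 1 := by exact_mod_cast hcard
  have hSr : (S.map (Int.cast : ℤ → ℚ)).mulVec r = fun i => ((![-y, x] : Fin 2 → ℤ) i : ℚ) := by
    ext i
    fin_cases i
    · simp [Matrix.mulVec, dotProduct, hr, Fin.sum_univ_two, ha]
      linear_combination (y / 7 : ℚ) * hdQ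
    · simp [Matrix.mulVec, dotProduct, hr, Fin.sum_univ_two, hc, hsymm]
      linear_combination (-x / 7 : ℚ) * hdQ
  have hmem : ∑ i, r i • b i ∈ dualLattice (-e8Form) (fixedLattice A) := by
    rw [dualLattice_neg]
    exact (hG.sum_mem_dual_iff hE r).2 ⟨_, hSr⟩
  refine ⟨Submodule.Quotient.mk ⟨_, hmem⟩, ?_⟩
  rw [fixedLattice_isEvenLattice.discEps_mk]
  congr 1
  have h1 : e8Form (∑ i, r i • b i) (∑ i, r i • b i) / 2 = 1 / 7 := by
    have hxyQ : (n * x ^ 2 + S 0 1 * x * y + c * y ^ 2 : ℚ) = 1 := by exact_mod_cast hxy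
    rw [hG.bilin, hSr]
    simp [dotProduct, hr, Fin.sum_univ_two]
    linear_combination (1 / 7 : ℚ) * hxyQ
  have h2 : (-e8Form) (∑ i, r i • b i) (∑ i, r i • b i) / 2 = -1 / 7 := by
    rw [LinearMap.neg_apply, LinearMap.neg_apply, neg_div, h1]; norm_num
  rw [h2]
  push_cast
  rfl

/-! ### The quadratic Gauss sum for `p = 7` -/

/-- This decides the sign of the square root in the Gauss sum. -/
lemma sin_sum_pos : 0 < Real.sin (2 * π / 7) + Real.sin (4 * π / 7) + Real.sin (8 * π / 7) := by
  have hpi := Real.pi_pos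
  have h1 : Real.sin (8 * π / 7) = -Real.sin (π / 7) := by
    rw [show 8 * π / 7 = π / 7 + π by ring, Real.sin_add_pi]
  have h2 : Real.sin (π / 7) < Real.sin (2 * π / 7) :=
    Real.sin_lt_sin_of_lt_of_le_pi_div_two (by linarith) (by linarith) (by linarith)
  have h3 : 0 < Real.sin (4 * π / 7) := Real.sin_pos_of_pos_of_lt_pi (by linarith) (by linarith)
  linarith

lemma e_seventh_pow : e (1 / 7) ^ 7 = 1 := by
  rw [← e_nat_mul]
  simpa using e_intCast 1

lemma e_seventh_geom_sum : 1 + e (1 / 7) + e (1 / 7) ^ 2 + e (1 / 7) ^ 3 + e (1 / 7) ^ 4 +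
    e (1 / 7) ^ 5 + e (1 / 7) ^ 6 = 0 := by
  have h1 : e (1 / 7) ≠ 1 := by
    intro h
    obtain ⟨n, hn⟩ := e_eq_one_iff.1 h
    have h3 : (1 : ℂ) = ((7 * n : ℤ) : ℂ) := by push_cast; rw [← hn]; norm_num
    have h4 : (1 : ℤ) = 7 * n := by exact_mod_cast h3
    omega
  have h2 := sum_range_pow_eq_zero h1 e_seventh_pow
  simp only [Finset.sum_range_succ, Finset.sum_range_zero] at h2
  linear_combination h2

/-- The Gauss sum `g = 1 + 2(ζ + ζ² + ζ⁴)` satisfies `g² = -7`, and its positive imaginary part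
selects `i√7`. -/
lemma e_seventh_sum : e (1 / 7) + e (1 / 7) ^ 2 + e (1 / 7) ^ 4 =
    (-1 + Complex.I * Real.sqrt 7) / 2 := by
  set ζ := e (1 / 7) with hζ
  have h7 : ζ ^ 7 = 1 := e_seventh_pow
  have hsum := e_seventh_geom_sum
  rw [← hζ] at hsum
  have hs : (Real.sqrt 7 : ℂ) ^ 2 = 7 := by
    rw [← Complex.ofReal_pow, Real.sq_sqrt (by norm_num)]; norm_num
  set g := 1 + 2 * (ζ + ζ ^ 2 + ζ ^ 4) with hg
  have hg2 : (g - Complex.I * Real.sqrt 7) * (g + Complex.I * Real.sqrt 7) = 0 := by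
    have h3 : g ^ 2 = -7 := by
      rw [hg]
      linear_combination 8 * hsum + (4 * ζ) * h7
    linear_combination h3 - (Real.sqrt 7 : ℂ) ^ 2 * Complex.I_sq + hs
  have him : 0 < g.im := by
    have h3 : ∀ k : ℕ, (ζ ^ k).im = Real.sin (2 * k * π / 7) := by
      intro k
      rw [hζ, ← e_nat_mul, e, show 2 * (π : ℂ) * Complex.I * (k * (1 / 7)) =
        ((2 * k * π / 7 : ℝ) : ℂ) * Complex.I by push_cast; ring, Complex.exp_ofReal_mul_I_im]
    have h4 := h3 1
    have h5 := h3 2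
    have h6 := h3 4
    have h8 := sin_sum_pos
    rw [pow_one] at h4
    push_cast at h4 h5 h6
    rw [hg]
    simp only [Complex.add_im, Complex.mul_im, Complex.one_im, Complex.re_ofNat, Complex.im_ofNat,
      zero_mul, add_zero, zero_add]
    rw [h4, h5, h6, show 2 * 1 * π / 7 = 2 * π / 7 by ring, show 2 * 2 * π / 7 = 4 * π / 7 by ring,
      show 2 * 4 * π / 7 = 8 * π / 7 by ring]
    linarith
  rcases mul_eq_zero.1 hg2 with h3 | h3
  · linear_combination h3 / 2 + hg / 2
  · exfalso
    have h4 : g = -(Complex.I * Real.sqrt 7) := by linear_combination h3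
    rw [h4] at him
    simp at him
    exact absurd him (not_lt.2 (Real.sqrt_nonneg 7))

/-- The squares mod 7 are 0 once and 1, 2, 4 twice each. Since 2 is a square mod 7, the value
depends only on whether `l` is one. -/
lemma sum_e_seventh {l : ℕ} (hl : ¬ 7 ∣ l) :
    Complex.I * ∑ k ∈ Finset.range 7, (e (1 / 7) ^ (k ^ 2)) ^ (2 * l) =
      Real.sqrt 7 * residueSign 7 1 l := by
  have h7 := e_seventh_pow
  have hS := e_seventh_sum
  have hsum := e_seventh_geom_sum
  set ζ := e (1 / 7) with hζ
  have hred : ∀ k : ℕ, (ζ ^ (k ^ 2)) ^ (2 * l) = ζ ^ ((k ^ 2 * (2 * (l % 7))) % 7) := by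
    intro k
    rw [← pow_mul, pow_eq_pow_mod _ h7]
    congr 1
    simp [Nat.mul_mod]
  have hres : residueSign 7 1 l = residueSign 7 1 ((l % 7 : ℕ) : ℤ) := by
    rw [residueSign, residueSign, jacobiSym.mod_left, jacobiSym.mod_left (-((l % 7 : ℕ) : ℤ))]
    congr 3
    push_cast
    omega
  rw [hres]
  simp_rw [hred]
  have hl7 : l % 7 < 7 := Nat.mod_lt _ (by norm_num)
  have hl0 : l % 7 ≠ 0 := fun h => hl (Nat.dvd_of_mod_eq_zero h)
  have hI := Complex.I_sq
  generalize l % 7 = r at *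
  have hplus : Complex.I * (1 + 2 * (ζ + ζ ^ 2 + ζ ^ 4)) = -Real.sqrt 7 := by
    rw [hS]; linear_combination (Real.sqrt 7 : ℂ) * hI
  have hminus : Complex.I * (1 + 2 * (ζ ^ 3 + ζ ^ 5 + ζ ^ 6)) = Real.sqrt 7 := by
    linear_combination 2 * Complex.I * hsum - hplus
  rw [residueSign, pow_one]
  interval_cases r
  · exact absurd rfl hl0
  all_goals
    norm_num [Finset.sum_range_succ]
    first
      | linear_combination hplus
      | linear_combination hminus

end FakeMonster

end

/-! ### The Gauss sum of the whole `p`-part. -/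

open scoped Real

noncomputable section

namespace FakeMonster

variable {A : Matrix (Fin 8) (Fin 8) ℤ} {p m : ℕ}

lemma fixedDisc_seven_gauss (hA : IsE8Automorphism A) (hs : HasCycleShape A 7 1)
    [Fintype (FixedDisc A)] {l : ℕ} (hl : ¬ 7 ∣ l) :
    Complex.I * ∑ y, (discEps (-e8Form) (fixedLattice A) y ^ (2 * l))⁻¹ =
      Real.sqrt 7 * residueSign 7 1 l := by
  classical
  have hQ := fixedDisc_isQuadraticCharacter (by norm_num) hA hs
  obtain ⟨hcard, γ, hγ⟩ := exists_fixedDisc_seven_generator hA hs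
  have hγ0 : γ ≠ 0 := by
    rintro rfl
    rw [hQ.eps_zero] at hγ
    obtain ⟨n, hn⟩ := e_eq_one_iff.1 hγ.symm
    have h3 : (-1 : ℂ) = ((7 * n : ℤ) : ℂ) := by push_cast; rw [← hn]; norm_num
    have h4 : (-1 : ℤ) = 7 * n := by exact_mod_cast h3
    omega
  have : Fact (Nat.Prime 7) := ⟨by norm_num⟩
  have hord : addOrderOf γ = 7 := addOrderOf_eq_prime (fixedDisc_nsmul hA hs γ) hγ0
  have hinj : Set.InjOn (fun k : ℕ => k • γ) (Finset.range 7) := by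
    intro a ha b hb hab
    rw [Finset.coe_range, Set.mem_Iio] at ha hb
    exact nsmul_injOn_Iio_addOrderOf (by simpa [hord] using ha) (by simpa [hord] using hb) hab
  have himage : (Finset.range 7).image (fun k : ℕ => k • γ) = Finset.univ := by
    apply Finset.eq_univ_of_card
    rw [Finset.card_image_of_injOn hinj, Finset.card_range, ← Nat.card_eq_fintype_card, hcard]
  rw [← sum_e_seventh hl, ← himage, Finset.sum_image hinj]
  congr 1
  refine Finset.sum_congr rfl fun k _ => ?_
  rw [hQ.eps_nsmul, hγ, show (-1 / 7 : ℂ) = -(1 / 7) by ring, e_neg, inv_pow, inv_pow, inv_inv]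

lemma card_fixedDisc_eq (hp : p.Prime) (hpm : m * (p + 1) = 8) (hA : IsE8Automorphism A)
    (hs : HasCycleShape A p m) : Nat.card (FixedDisc A) = p ^ m := by
  rcases prime_cases hp hpm with ⟨rfl, rfl⟩ | ⟨rfl, rfl⟩
  · rw [card_fixedDisc_three hA hs]; norm_num
  · rw [(exists_fixedDisc_seven_generator hA hs).1]; norm_num

/-- For `p = 3` this is `i² (-3) = 3`. For `p = 7` the residue symbol matches the sign of the
classical sum. The dependence on `l` agrees with the sign in `xFun_exchange`. -/
lemma fixedDisc_gauss (hp : p.Prime) (hpm : m * (p + 1) = 8) (hA : IsE8Automorphism A)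
    (hs : HasCycleShape A p m) [Fintype (FixedDisc A)] {l : ℕ} (hl : ¬ p ∣ l) :
    Complex.I ^ m * ∑ y, (discEps (-e8Form) (fixedLattice A) y ^ (2 * l))⁻¹ =
      (Real.sqrt p : ℂ) ^ m * residueSign p m l := by
  rcases prime_cases hp hpm with ⟨rfl, rfl⟩ | ⟨rfl, rfl⟩
  · have h1 : residueSign 3 2 l = 1 := by
      have h2 : jacobiSym (-(l : ℤ)) 3 ^ 2 = 1 := by
        refine jacobiSym.sq_one ?_
        rw [Int.neg_gcd, Int.gcd_natCast_natCast, Nat.gcd_comm]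
        exact (Nat.Prime.coprime_iff_not_dvd Nat.prime_three).2 hl
      rw [residueSign]
      exact_mod_cast h2
    have hs3 : (Real.sqrt (3 : ℕ) : ℂ) ^ 2 = 3 := by
      rw [← Complex.ofReal_pow, Real.sq_sqrt (by norm_num)]; norm_num
    rw [fixedDisc_three_gauss hA hs hl, h1, hs3, Complex.I_sq]
    norm_num
  · simpa using fixedDisc_seven_gauss hA hs hl

/-! ### Products and hyperbolic planes -/

lemma IsQuadraticCharacter.prod {G H : Type*} [AddCommGroup G] [AddCommGroup H] {ε : G → ℂ}
    {β : G → G → ℂ} {ε' : H → ℂ} {β' : H → H → ℂ} (h : IsQuadraticCharacter ε β)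
    (h' : IsQuadraticCharacter ε' β') :
    IsQuadraticCharacter (fun x : G × H => ε x.1 * ε' x.2)
      (fun x y : G × H => β x.1 y.1 * β' x.2 y.2) where
  add x y := by rw [Prod.fst_add, Prod.snd_add, h.add, h'.add]; ring
  beta_add x y z := by rw [Prod.fst_add, Prod.snd_add, h.beta_add, h'.beta_add]; ring
  beta_comm x y := by rw [h.beta_comm, h'.beta_comm]
  beta_self x := by rw [h.beta_self, h'.beta_self]; ring
  ne_zero x := mul_ne_zero (h.ne_zero _) (h'.ne_zero _)
  nondegenerate x hx := by
    refine Prod.ext (h.nondegenerate _ fun y => ?_) (h'.nondegenerate _ fun y => ?_)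
    · simpa [h'.beta_zero] using hx (y, 0)
    · simpa [h.beta_zero] using hx (0, y)

/-- The quadratic character `(c, d) ↦ e(rcd/p)`. -/
def hyperbolicEps (p r : ℕ) [NeZero p] (c : ZMod p × ZMod p) : ℂ :=
  ZMod.stdAddChar ((r : ZMod p) * (c.1 * c.2))

/-- The bicharacter of `hyperbolicEps`. -/
def hyperbolicBeta (p r : ℕ) [NeZero p] (c d : ZMod p × ZMod p) : ℂ :=
  ZMod.stdAddChar ((r : ZMod p) * (c.1 * d.2 + c.2 * d.1))

lemma hyperbolic_isQuadraticCharacter [NeZero p] {r : ℕ} (hr : IsUnit (r : ZMod p)) :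
    IsQuadraticCharacter (hyperbolicEps p r) (hyperbolicBeta p r) where
  add x y := by
    rw [hyperbolicEps, hyperbolicEps, hyperbolicEps, hyperbolicBeta, ← AddChar.map_add_eq_mul,
      ← AddChar.map_add_eq_mul, Prod.fst_add, Prod.snd_add]
    congr 1; ring
  beta_add x y z := by
    rw [hyperbolicBeta, hyperbolicBeta, hyperbolicBeta, ← AddChar.map_add_eq_mul, Prod.fst_add,
      Prod.snd_add]
    congr 1; ring
  beta_comm x y := by rw [hyperbolicBeta, hyperbolicBeta]; congr 1; ring
  beta_self x := by
    rw [hyperbolicBeta, hyperbolicEps, sq, ← AddChar.map_add_eq_mul]; congr 1; ring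
  ne_zero x := by
    rw [hyperbolicEps]
    intro h0
    have h1 := AddChar.map_add_eq_mul (ZMod.stdAddChar (N := p)) (r * (x.1 * x.2))
      (-(r * (x.1 * x.2)))
    rw [add_neg_cancel, AddChar.map_zero_eq_one, h0, zero_mul] at h1
    exact one_ne_zero h1
  nondegenerate x hx := by
    have h1 : ∀ z : ZMod p, ZMod.stdAddChar z = 1 → z = 0 := fun z hz =>
      ZMod.injective_stdAddChar (by rw [hz, AddChar.map_zero_eq_one])
    have e1 := h1 _ (hx (0, 1))
    have e2 := h1 _ (hx (1, 0))
    simp only [mul_one, mul_zero, add_zero, zero_add] at e1 e2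
    exact Prod.ext (hr.mul_right_eq_zero.1 e1) (hr.mul_right_eq_zero.1 e2)

lemma hyperbolicEps_pow [NeZero p] (r : ℕ) (c : ZMod p × ZMod p) : hyperbolicEps p r c ^ p = 1 := by
  rw [hyperbolicEps, ← AddChar.map_nsmul_eq_pow, nsmul_eq_mul, ZMod.natCast_self, zero_mul,
    AddChar.map_zero_eq_one]

/-- The sum over the second coordinate vanishes unless the first is 0, where it equals `p`. -/
lemma hyperbolic_gauss (hp : p.Prime) (hodd : Odd p) [NeZero p] {r l : ℕ}
    (hr : IsUnit (r : ZMod p)) (hl : ¬ p ∣ l) :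
    ∑ c, (hyperbolicEps p r c ^ (2 * l))⁻¹ = p := by
  have : Fact p.Prime := ⟨hp⟩
  have hne : -((r : ZMod p) * (2 * (l : ZMod p))) ≠ 0 := by
    rw [neg_ne_zero]
    refine mul_ne_zero hr.ne_zero (mul_ne_zero ?_ ?_)
    · intro h2
      have h3 : p ∣ 2 := (ZMod.natCast_eq_zero_iff 2 p).1 (by exact_mod_cast h2)
      have := (Nat.prime_dvd_prime_iff_eq hp Nat.prime_two).1 h3
      subst this
      exact absurd hodd (by decide)
    · rwa [Ne, ZMod.natCast_eq_zero_iff]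
  have h1 : ∀ c : ZMod p × ZMod p, (hyperbolicEps p r c ^ (2 * l))⁻¹ =
      ZMod.stdAddChar (c.2 * (-((r : ZMod p) * (2 * (l : ZMod p))) * c.1)) := by
    intro c
    rw [hyperbolicEps, ← AddChar.map_nsmul_eq_pow, ← AddChar.map_neg_eq_inv]
    congr 1
    rw [nsmul_eq_mul]
    push_cast
    ring
  simp_rw [h1]
  rw [Fintype.sum_prod_type]
  simp only [AddChar.sum_mulShift _ (ZMod.isPrimitive_stdAddChar p), mul_eq_zero, hne, false_or,
    ZMod.card]
  simp

/-- The quadratic character of the `p`-part of the discriminant group. -/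
def oddEps (A : Matrix (Fin 8) (Fin 8) ℤ) (p r : ℕ) [NeZero p]
    (x : FixedDisc A × (ZMod p × ZMod p)) : ℂ :=
  discEps (-e8Form) (fixedLattice A) x.1 * hyperbolicEps p r x.2

/-- The bicharacter of the `p`-part of the discriminant group. -/
def oddBeta (A : Matrix (Fin 8) (Fin 8) ℤ) (p r : ℕ) [NeZero p]
    (x y : FixedDisc A × (ZMod p × ZMod p)) : ℂ :=
  discBeta (-e8Form) (fixedLattice A) x.1 y.1 * hyperbolicBeta p r x.2 y.2

lemma odd_isQuadraticCharacter [NeZero p] {r : ℕ} (hr : IsUnit (r : ZMod p))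
    (hA : IsE8Automorphism A) (hs : HasCycleShape A p m) :
    IsQuadraticCharacter (oddEps A p r) (oddBeta A p r) :=
  (fixedDisc_isQuadraticCharacter (NeZero.pos p) hA hs).prod (hyperbolic_isQuadraticCharacter hr)

lemma oddEps_pow [NeZero p] {r : ℕ} (hodd : Odd p) (hA : IsE8Automorphism A)
    (hs : HasCycleShape A p m) (x) : oddEps A p r x ^ p = 1 := by
  rw [oddEps, mul_pow, fixedDisc_eps_pow hodd hA hs, hyperbolicEps_pow, one_mul]

lemma card_odd (hp : p.Prime) (hpm : m * (p + 1) = 8) (hA : IsE8Automorphism A)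
    (hs : HasCycleShape A p m) : Nat.card (FixedDisc A × (ZMod p × ZMod p)) = p ^ (2 + m) := by
  rw [Nat.card_prod, Nat.card_prod, card_fixedDisc_eq hp hpm hA hs, Nat.card_zmod]
  ring

lemma odd_gauss (hp : p.Prime) (hpm : m * (p + 1) = 8) (hA : IsE8Automorphism A)
    (hs : HasCycleShape A p m) [NeZero p] {r : ℕ} (hr : IsUnit (r : ZMod p))
    [Fintype (FixedDisc A)] {l : ℕ} (hl : ¬ p ∣ l) :
    Complex.I ^ m * ∑ x, (oddEps A p r x ^ (2 * l))⁻¹ =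
      (Real.sqrt p : ℂ) ^ (2 + m) * residueSign p m l := by
  have hs2 : (Real.sqrt p : ℂ) ^ 2 = p := by
    rw [← Complex.ofReal_pow, Real.sq_sqrt (by positivity), Complex.ofReal_natCast]
  simp only [oddEps, mul_pow, mul_inv]
  rw [Fintype.sum_prod_type]
  simp_rw [← Finset.mul_sum]
  rw [hyperbolic_gauss hp (odd_of_pair hp hpm) hr hl, ← Finset.sum_mul, ← mul_assoc,
    fixedDisc_gauss hp hpm hA hs hl, pow_add, hs2]
  ring

end FakeMonster

end

open scoped Real

noncomputable section

namespace FakeMonster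

variable {A : Matrix (Fin 8) (Fin 8) ℤ} {p m : ℕ}

/-! ### The discriminant group of `M` -/

lemma ambientForm_apply (x y : Ambient) : ambientForm p x y =
    -e8Form x.1 y.1 + -(2 * p) * (x.2.1.1 * y.2.1.2 + x.2.1.2 * y.2.1.1) +
      -1 * (x.2.2.1 * y.2.2.2 + x.2.2.2 * y.2.2.1) := rfl

lemma mem_latticeM {x : Ambient} : x ∈ latticeM A ↔ x.1 ∈ fixedLattice A ∧
    (∃ a b : ℤ, x.2.1 = ((a : ℚ), (b : ℚ))) ∧ ∃ a b : ℤ, x.2.2 = ((a : ℚ), (b : ℚ)) := Iff.rfl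

lemma latticeM_isEvenLattice : IsEvenLattice (ambientForm p) (latticeM A) where
  symm x y := by rw [ambientForm_apply, ambientForm_apply, e8Form_symm]; ring
  even x hx := by
    obtain ⟨h1, ⟨a, b, hab⟩, c, d, hcd⟩ := mem_latticeM.1 hx
    obtain ⟨n, hn⟩ := e8Form_self_even (mem_fixedLattice.1 h1).1
    refine ⟨-n - 2 * p * (a * b) - c * d, ?_⟩
    rw [ambientForm_apply, hab, hcd, hn]
    push_cast
    ring

lemma mem_span_latticeM {x : Ambient} :
    x ∈ Submodule.span ℚ (latticeM A : Set Ambient) ↔ rationalEnd A x.1 = x.1 := by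
  constructor
  · intro hx
    have h : Submodule.span ℚ (latticeM A : Set Ambient) ≤
        (LinearMap.eqLocus (rationalEnd A) LinearMap.id).comap (LinearMap.fst ℚ _ _) :=
      Submodule.span_le.2 fun y hy => (mem_fixedLattice.1 hy.1).2
    exact h hx
  · intro hx
    have h1 : (x.1, 0) ∈ Submodule.span ℚ (latticeM A : Set Ambient) := by
      have h2 : Submodule.span ℚ (fixedLattice A : Set (Fin 8 → ℚ)) ≤
          (Submodule.span ℚ (latticeM A : Set Ambient)).comap (LinearMap.inl ℚ _ _) :=
        Submodule.span_le.2 fun y hy => Submodule.subset_span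
          ⟨hy, (integerPlane.prod integerPlane).zero_mem⟩
      exact h2 (mem_span_fixedLattice.2 hx)
    have h3 : ∀ a b c d : ℤ, ((0, ((a : ℚ), (b : ℚ)), ((c : ℚ), (d : ℚ))) : Ambient) ∈
        Submodule.span ℚ (latticeM A : Set Ambient) := fun a b c d =>
      Submodule.subset_span (mem_latticeM.2 ⟨zero_mem _, ⟨a, b, rfl⟩, c, d, rfl⟩)
    have h4 : x = (x.1, 0) + x.2.1.1 • (0, (((1 : ℤ) : ℚ), ((0 : ℤ) : ℚ)), (((0 : ℤ) : ℚ), ((0 : ℤ) : ℚ)))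
        + x.2.1.2 • (0, (((0 : ℤ) : ℚ), ((1 : ℤ) : ℚ)), (((0 : ℤ) : ℚ), ((0 : ℤ) : ℚ)))
        + x.2.2.1 • (0, (((0 : ℤ) : ℚ), ((0 : ℤ) : ℚ)), (((1 : ℤ) : ℚ), ((0 : ℤ) : ℚ)))
        + x.2.2.2 • (0, (((0 : ℤ) : ℚ), ((0 : ℤ) : ℚ)), (((0 : ℤ) : ℚ), ((1 : ℤ) : ℚ))) := by
      ext <;> simp
    rw [h4]
    exact add_mem (add_mem (add_mem (add_mem h1 (Submodule.smul_mem _ _ (h3 1 0 0 0)))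
      (Submodule.smul_mem _ _ (h3 0 1 0 0))) (Submodule.smul_mem _ _ (h3 0 0 1 0)))
      (Submodule.smul_mem _ _ (h3 0 0 0 1))

lemma mem_dualLattice_latticeM (hp : 0 < p) {x : Ambient} :
    x ∈ dualLattice (ambientForm p) (latticeM A) ↔ x.1 ∈ fixedDual A ∧
      (∃ u v : ℤ, x.2.1 = ((u : ℚ) / (2 * p), (v : ℚ) / (2 * p))) ∧
        ∃ a b : ℤ, x.2.2 = ((a : ℚ), (b : ℚ)) := by
  have hp' : (2 * p : ℚ) ≠ 0 := by positivity
  rw [mem_dualLattice, mem_span_latticeM, mem_fixedDual]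
  constructor
  · rintro ⟨h1, h2⟩
    have h3 : ∀ a b c d : ℤ, ∃ n : ℤ, -(2 * p) * (x.2.1.1 * b + x.2.1.2 * a) +
      -1 * (x.2.2.1 * d + x.2.2.2 * c) = n := fun a b c d => by
      obtain ⟨n, hn⟩ := h1 (0, (a, b), (c, d))
        (mem_latticeM.2 ⟨zero_mem _, ⟨a, b, rfl⟩, c, d, rfl⟩)
      exact ⟨n, by rw [← hn, ambientForm_apply, map_zero, neg_zero, zero_add]⟩
    refine ⟨⟨fun y hy => ?_, h2⟩, ?_, ?_⟩
    · obtain ⟨n, hn⟩ := h1 (y, 0) (mem_latticeM.2 ⟨hy, ⟨0, 0, by ext <;> simp⟩, 0, 0, by ext <;> simp⟩)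
      refine ⟨-n, ?_⟩
      rw [ambientForm_apply] at hn
      simp only [Prod.snd_zero, Prod.fst_zero, mul_zero, add_zero] at hn
      push_cast
      linarith
    · obtain ⟨u, hu⟩ := h3 0 1 0 0
      obtain ⟨v, hv⟩ := h3 1 0 0 0
      refine ⟨-u, -v, ?_⟩
      push_cast at hu hv ⊢
      ext
      · rw [eq_div_iff hp']; linarith
      · rw [eq_div_iff hp']; linarith
    · obtain ⟨u, hu⟩ := h3 0 0 0 1
      obtain ⟨v, hv⟩ := h3 0 0 1 0
      refine ⟨-u, -v, ?_⟩
      push_cast at hu hv ⊢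
      ext
      · linarith
      · linarith
  · rintro ⟨⟨h1, h2⟩, ⟨u, v, huv⟩, c, d, hcd⟩
    refine ⟨fun y hy => ?_, h2⟩
    obtain ⟨hy1, ⟨a, b, hab⟩, c', d', hcd'⟩ := mem_latticeM.1 hy
    obtain ⟨n, hn⟩ := h1 _ hy1
    refine ⟨-n - (u * b + v * a) - (c * d' + d * c'), ?_⟩
    rw [ambientForm_apply, huv, hab, hcd, hcd', hn]
    push_cast
    field_simp
    ring

/-- The vector of `M'` with components `x`, `(u/2p, v/2p)` and `0`. -/
def dualVector (A : Matrix (Fin 8) (Fin 8) ℤ) (p : ℕ) [NeZero p] :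
    dualLattice (-e8Form) (fixedLattice A) × ℤ × ℤ →+
      dualLattice (ambientForm p) (latticeM A) :=
  AddMonoidHom.mk' (fun n => ⟨((n.1 : Fin 8 → ℚ), ((n.2.1 : ℚ) / (2 * p), (n.2.2 : ℚ) / (2 * p)), 0),
    (mem_dualLattice_latticeM (NeZero.pos p)).2 ⟨n.1.2, ⟨_, _, rfl⟩, 0, 0, by ext <;> simp⟩⟩)
    fun a b => by
      refine Subtype.ext ?_
      simp only [Prod.fst_add, Prod.snd_add, Submodule.coe_add, Prod.mk_add_mk, add_zero,
        Int.cast_add, add_div]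

/-- The class of `dualVector`. -/
def dualClass (A : Matrix (Fin 8) (Fin 8) ℤ) (p : ℕ) [NeZero p] :
    dualLattice (-e8Form) (fixedLattice A) × ℤ × ℤ →+
      DiscGroup (ambientForm p) (latticeM A) :=
  (Submodule.mkQ _).toAddMonoidHom.comp (dualVector A p)

lemma dualClass_surjective [NeZero p] : Function.Surjective (dualClass A p) := by
  intro γ
  obtain ⟨x, rfl⟩ := Submodule.Quotient.mk_surjective _ γ
  obtain ⟨h1, ⟨u, v, huv⟩, a, b, hab⟩ := (mem_dualLattice_latticeM (NeZero.pos p)).1 x.2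
  refine ⟨(⟨_, h1⟩, u, v), ?_⟩
  refine (Submodule.Quotient.eq _).2 ?_
  rw [mem_submoduleOf_iff, mem_latticeM]
  refine ⟨?_, ⟨0, 0, ?_⟩, -a, -b, ?_⟩
  · simp [dualVector]
  · ext <;> simp [dualVector, huv]
  · simp [dualVector, hab]

lemma dualClass_eq_zero_iff [NeZero p] (n : dualLattice (-e8Form) (fixedLattice A) × ℤ × ℤ) :
    dualClass A p n = 0 ↔ (n.1 : Fin 8 → ℚ) ∈ fixedLattice A ∧
      ((2 * p : ℕ) : ℤ) ∣ n.2.1 ∧ ((2 * p : ℕ) : ℤ) ∣ n.2.2 := by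
  have hp' : (2 * p : ℚ) ≠ 0 := by have := NeZero.pos p; positivity
  have h : dualClass A p n = 0 ↔ ((dualVector A p n : dualLattice (ambientForm p) (latticeM A)) : Ambient) ∈ latticeM A :=
    Submodule.Quotient.mk_eq_zero _
  rw [h, mem_latticeM]
  refine and_congr Iff.rfl ?_
  simp only [dualVector, AddMonoidHom.mk'_apply, Prod.mk.injEq]
  constructor
  · rintro ⟨⟨a, b, ha, hb⟩, -⟩
    rw [div_eq_iff hp'] at ha hb
    refine ⟨⟨a, ?_⟩, ⟨b, ?_⟩⟩
    · rw [mul_comm]; push_cast; exact_mod_cast ha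
    · rw [mul_comm]; push_cast; exact_mod_cast hb
  · rintro ⟨⟨a, ha⟩, ⟨b, hb⟩⟩
    refine ⟨⟨a, b, ?_, ?_⟩, 0, 0, by ext <;> simp⟩
    · rw [ha, div_eq_iff hp']; push_cast; ring
    · rw [hb, div_eq_iff hp']; push_cast; ring

/-- The decomposition of the class of `dualVector` into its `2`-part and its `p`-part. -/
def splitClass (A : Matrix (Fin 8) (Fin 8) ℤ) (p : ℕ) :
    dualLattice (-e8Form) (fixedLattice A) × ℤ × ℤ →+
      (ZMod 2 × ZMod 2) × (FixedDisc A × (ZMod p × ZMod p)) :=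
  AddMonoidHom.mk' (fun n => (((n.2.1 : ZMod 2), (n.2.2 : ZMod 2)),
    (Submodule.Quotient.mk n.1, ((n.2.1 : ZMod p), (n.2.2 : ZMod p)))))
    fun a b => by simp

lemma exists_int_of_zmod [NeZero p] (hodd : Odd p) (a : ZMod 2) (c : ZMod p) :
    ∃ u : ℤ, (u : ZMod 2) = a ∧ (u : ZMod p) = c := by
  -- Chinese remainder theorem: `p` is 1 mod 2 and 0 mod `p`, while `p + 1` is 0 mod 2 and 1 mod
  -- `p`.
  refine ⟨p * a.val + (p + 1) * c.val, ?_, ?_⟩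
  · have h : ((p : ℕ) : ZMod 2) = 1 := (ZMod.natCast_eq_one_iff_odd).2 hodd
    push_cast
    rw [h, ZMod.natCast_zmod_val, one_add_one_eq_two, show (2 : ZMod 2) = 0 from rfl]
    ring
  · push_cast
    rw [ZMod.natCast_self, ZMod.natCast_zmod_val]
    ring

lemma splitClass_surjective [NeZero p] (hodd : Odd p) : Function.Surjective (splitClass A p) := by
  rintro ⟨⟨a, b⟩, γ, c, d⟩
  obtain ⟨x, rfl⟩ := Submodule.Quotient.mk_surjective _ γ
  obtain ⟨u, hu, hu'⟩ := exists_int_of_zmod hodd a c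
  obtain ⟨v, hv, hv'⟩ := exists_int_of_zmod hodd b d
  exact ⟨(x, u, v), by simp [splitClass, hu, hu', hv, hv']⟩

lemma two_mul_dvd_iff (hodd : Odd p) (u : ℤ) :
    ((2 * p : ℕ) : ℤ) ∣ u ↔ (u : ZMod 2) = 0 ∧ (u : ZMod p) = 0 := by
  rw [ZMod.intCast_zmod_eq_zero_iff_dvd, ZMod.intCast_zmod_eq_zero_iff_dvd, Nat.cast_mul]
  constructor
  · intro h
    exact ⟨dvd_of_mul_right_dvd h, dvd_of_mul_left_dvd h⟩
  · rintro ⟨h1, h2⟩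
    refine IsCoprime.mul_dvd ?_ h1 h2
    rw [Nat.isCoprime_iff_coprime]
    exact (Nat.coprime_two_left).2 hodd

lemma splitClass_eq_zero_iff (hodd : Odd p)
    (n : dualLattice (-e8Form) (fixedLattice A) × ℤ × ℤ) :
    splitClass A p n = 0 ↔ (n.1 : Fin 8 → ℚ) ∈ fixedLattice A ∧
      ((2 * p : ℕ) : ℤ) ∣ n.2.1 ∧ ((2 * p : ℕ) : ℤ) ∣ n.2.2 := by
  rw [two_mul_dvd_iff hodd, two_mul_dvd_iff hodd, ← mem_submoduleOf_iff (B := -e8Form),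
    ← Submodule.Quotient.mk_eq_zero]
  simp only [splitClass, AddMonoidHom.mk'_apply, Prod.mk_eq_zero]
  tauto

/-- The discriminant group of `M` as a product of its `2`-part and its `p`-part. -/
def discEquiv (A : Matrix (Fin 8) (Fin 8) ℤ) [NeZero p] (hodd : Odd p) :
    DiscGroup (ambientForm p) (latticeM A) ≃+
      (ZMod 2 × ZMod 2) × (FixedDisc A × (ZMod p × ZMod p)) :=
  -- Both groups are quotients of the same group of vectors, by the same kernel.
  (QuotientAddGroup.quotientKerEquivOfSurjective _ dualClass_surjective).symm.trans <|
    (QuotientAddGroup.quotientAddEquivOfEq (by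
      ext n
      rw [AddMonoidHom.mem_ker, AddMonoidHom.mem_ker, dualClass_eq_zero_iff,
        splitClass_eq_zero_iff hodd])).trans
    (QuotientAddGroup.quotientKerEquivOfSurjective _ (splitClass_surjective hodd))

lemma discEquiv_dualClass [NeZero p] (hodd : Odd p) (n) :
    discEquiv A hodd (dualClass A p n) = splitClass A p n := by
  have h : (QuotientAddGroup.quotientKerEquivOfSurjective (dualClass A p)
      dualClass_surjective).symm (dualClass A p n) = (n : _ ⧸ (dualClass A p).ker) := by
    rw [AddEquiv.symm_apply_eq]; rfl
  rw [discEquiv, AddEquiv.trans_apply, h]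
  rfl

/-- The quadratic character of the `2`-part of the discriminant group. -/
def planeEps (a : ZMod 2 × ZMod 2) : ℂ := if a = (1, 1) then -1 else 1

lemma planeEps_add (a b : ZMod 2 × ZMod 2) :
    planeEps (a + b) = planeEps a * planeEps b * planeBeta a b := by
  have h : ∀ a b : ZMod 2 × ZMod 2, (if a + b = (1, 1) then (-1 : ℤ) else 1) =
      (if a = (1, 1) then -1 else 1) * (if b = (1, 1) then -1 else 1) *
        (if a.1 * b.2 + a.2 * b.1 = 0 then 1 else -1) := by decide
  have := congrArg (fun n : ℤ => (n : ℂ)) (h a b)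
  simp only [planeEps, planeBeta]
  push_cast at this
  exact this

lemma planeEps_ne_zero (a : ZMod 2 × ZMod 2) : planeEps a ≠ 0 := by
  rw [planeEps]; split_ifs <;> norm_num

lemma planeEps_intCast (u v : ℤ) : planeEps ((u : ZMod 2), (v : ZMod 2)) =
    e ((-(u * v) / 2 : ℚ) : ℂ) := by
  have key : ∀ w : ℤ, (Odd w → e ((-w / 2 : ℚ) : ℂ) = -1) ∧ (Even w → e ((-w / 2 : ℚ) : ℂ) = 1) := by
    intro w
    constructor
    · rintro ⟨k, rfl⟩
      rw [← e_half]
      have : e ((-((2 * k + 1 : ℤ) : ℚ) / 2 : ℚ) : ℂ) = e ((1 / 2 : ℚ) : ℂ) :=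
        e_eq_of_sub_eq ⟨-k - 1, by push_cast; ring⟩
      rw [this]; norm_num
    · rintro ⟨k, rfl⟩
      rw [e_rat_eq_one_iff]
      exact ⟨-k, by push_cast; ring⟩
  have h1 : ((u : ZMod 2), (v : ZMod 2)) = (1, 1) ↔ Odd (u * v) := by
    rw [Int.odd_mul, Prod.mk.injEq, ZMod.intCast_eq_one_iff_odd, ZMod.intCast_eq_one_iff_odd]
  have h2 : ((u : ℚ) * v) = ((u * v : ℤ) : ℚ) := by push_cast; ring
  rw [planeEps, h2]
  split_ifs with h
  · exact ((key _).1 (h1.1 h)).symm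
  · exact ((key _).2 (Int.not_odd_iff_even.1 (mt h1.2 h))).symm

lemma hyperbolicEps_intCast [NeZero p] (r : ℕ) (u v : ℤ) :
    hyperbolicEps p r ((u : ZMod p), (v : ZMod p)) = e ((r * (u * v) / p : ℚ) : ℂ) := by
  rw [hyperbolicEps]
  have h : ((r : ZMod p) * ((u : ZMod p) * (v : ZMod p))) = ((r * (u * v) : ℤ) : ZMod p) := by
    push_cast; ring
  simp only [h]
  rw [ZMod.stdAddChar_coe, e]
  congr 1
  push_cast
  ring

/-- With `p = 2r + 1` one has `-uv/(2p) = -uv/2 + r uv/p`, which separates the half norm into its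
2-part and its `p`-part and explains the parameter `r`. -/
lemma discEps_discEquiv {r : ℕ} [NeZero p] (hr : p = 2 * r + 1) (hodd : Odd p)
    (γ : DiscGroup (ambientForm p) (latticeM A)) :
    discEps (ambientForm p) (latticeM A) γ =
      planeEps (discEquiv A hodd γ).1 * oddEps A p r (discEquiv A hodd γ).2 := by
  have hp' : (2 * r + 1 : ℚ) ≠ 0 := by positivity
  obtain ⟨⟨x, u, v⟩, rfl⟩ := dualClass_surjective γ
  rw [discEquiv_dualClass]
  simp only [splitClass, AddMonoidHom.mk'_apply, oddEps]
  rw [planeEps_intCast, hyperbolicEps_intCast, fixedLattice_isEvenLattice.discEps_mk,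
    show dualClass A p (x, u, v) = Submodule.Quotient.mk (dualVector A p (x, u, v)) from rfl,
    latticeM_isEvenLattice.discEps_mk, ← e_ratCast_add, ← e_ratCast_add]
  congr 2
  rw [ambientForm_apply]
  simp only [dualVector, AddMonoidHom.mk'_apply, LinearMap.neg_apply, Prod.fst_zero, Prod.snd_zero]
  rw [hr]
  push_cast
  field_simp
  ring

/-- Both bicharacters are the polarisations of quadratic characters already matched by
`discEps_discEquiv`. -/
lemma discBeta_discEquiv {r : ℕ} [NeZero p] (hr : p = 2 * r + 1) (hodd : Odd p)
    (h : IsQuadraticCharacter (oddEps A p r) (oddBeta A p r))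
    (γ δ : DiscGroup (ambientForm p) (latticeM A)) :
    discBeta (ambientForm p) (latticeM A) γ δ =
      planeBeta (discEquiv A hodd γ).1 (discEquiv A hodd δ).1 *
        oddBeta A p r (discEquiv A hodd γ).2 (discEquiv A hodd δ).2 := by
  have h1 := (latticeM_isEvenLattice (A := A) (p := p)).discEps_add γ δ
  simp only [discEps_discEquiv hr hodd, map_add, Prod.fst_add, Prod.snd_add, planeEps_add,
    h.add] at h1
  set a := (discEquiv A hodd γ)
  set b := (discEquiv A hodd δ)
  have h2 : planeEps a.1 * oddEps A p r a.2 * (planeEps b.1 * oddEps A p r b.2) ≠ 0 :=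
    mul_ne_zero (mul_ne_zero (planeEps_ne_zero _) (h.ne_zero _))
      (mul_ne_zero (planeEps_ne_zero _) (h.ne_zero _))
  refine mul_left_cancel₀ h2 ?_
  rw [← h1]
  ring

lemma card_discGroup_latticeM [NeZero p] (hodd : Odd p) :
    Nat.card (DiscGroup (ambientForm p) (latticeM A)) = 4 * Nat.card (FixedDisc A × (ZMod p × ZMod p)) := by
  rw [Nat.card_congr (discEquiv A hodd).toEquiv, Nat.card_prod, Nat.card_prod, Nat.card_zmod]

end FakeMonster

end

open scoped Real

noncomputable section

namespace FakeMonster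

variable {A : Matrix (Fin 8) (Fin 8) ℤ} {p m : ℕ}

/-! ### The signature of `M` -/

lemma finrank_le_sigPos {U W : Type*} [AddCommGroup U] [Module ℚ U] [AddCommGroup W] [Module ℚ W]
    [FiniteDimensional ℚ W] {Q : QuadraticForm ℚ W} (φ : U →ₗ[ℚ] W) (h : ∀ u ≠ 0, 0 < Q (φ u)) :
    Module.finrank ℚ U ≤ sigPos Q := by
  have hinj : Function.Injective φ := by
    rw [injective_iff_map_eq_zero]
    intro u hu
    by_contra hne
    have := h u hne
    rw [hu, map_zero] at this
    exact lt_irrefl _ this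
  rw [← LinearMap.finrank_range_of_inj hinj]
  refine le_sigPos_of_posDef Q ?_
  rintro ⟨_, u, rfl⟩ hne
  exact h u fun hu => hne (by simp [hu])

/-- A subspace of dimension two on which the form of `M` is positive definite. -/
def positivePlane (A : Matrix (Fin 8) (Fin 8) ℤ) :
    ℚ × ℚ →ₗ[ℚ] Submodule.span ℚ (latticeM A : Set Ambient) :=
  LinearMap.codRestrict _
    { toFun := fun s => (0, (s.1, -s.1), (s.2, -s.2))
      map_add' := fun s t => by ext <;> simp <;> ring
      map_smul' := fun c s => by ext <;> simp }
    fun s => mem_span_latticeM.2 (map_zero _)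

/-- A complement of `positivePlane` on which the form of `M` is negative definite. -/
def negativeSpace (A : Matrix (Fin 8) (Fin 8) ℤ) :
    Submodule.span ℚ (fixedLattice A : Set (Fin 8 → ℚ)) × (ℚ × ℚ) →ₗ[ℚ]
      Submodule.span ℚ (latticeM A : Set Ambient) :=
  LinearMap.codRestrict _
    { toFun := fun s => ((s.1 : Fin 8 → ℚ), (s.2.1, s.2.1), (s.2.2, s.2.2))
      map_add' := fun s t => by ext <;> simp
      map_smul' := fun c s => by ext <;> simp }
    fun s => mem_span_latticeM.2 (mem_span_fixedLattice.1 s.1.2)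

/-- The coordinates of a vector in the rational span of `M`. -/
def spanCoordinates (A : Matrix (Fin 8) (Fin 8) ℤ) :
    Submodule.span ℚ (latticeM A : Set Ambient) →ₗ[ℚ]
      Submodule.span ℚ (fixedLattice A : Set (Fin 8 → ℚ)) × ((ℚ × ℚ) × (ℚ × ℚ)) :=
  (LinearMap.codRestrict _ (LinearMap.fst ℚ _ _ ∘ₗ Submodule.subtype _)
    fun s => mem_span_fixedLattice.2 (mem_span_latticeM.1 s.2)).prod
    (LinearMap.snd ℚ _ _ ∘ₗ Submodule.subtype _)

lemma finrank_span_latticeM_le (hp : 0 < p) (hA : IsE8Automorphism A) (hs : HasCycleShape A p m) :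
    Module.finrank ℚ (Submodule.span ℚ (latticeM A : Set Ambient)) ≤ 2 * m + 4 := by
  have hinj : Function.Injective (spanCoordinates A) := by
    intro x y hxy
    have h := Prod.ext_iff.1 hxy
    exact Subtype.ext (Prod.ext (congrArg Subtype.val h.1) h.2)
  have h := LinearMap.finrank_le_finrank_of_injective hinj
  simp only [Module.finrank_prod, finrank_span_fixedLattice hp hA hs, Module.finrank_self] at h
  omega

lemma two_le_sigPos (hp : 0 < p) : 2 ≤ sigPos (spanForm (ambientForm p) (latticeM A)) := by
  have hp' : (0 : ℚ) < p := by exact_mod_cast hp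
  have h := finrank_le_sigPos (Q := spanForm (ambientForm p) (latticeM A)) (positivePlane A) ?_
  · simpa using h
  · rintro ⟨s, t⟩ hst
    have h1 : spanForm (ambientForm p) (latticeM A) (positivePlane A (s, t)) =
        ambientForm p (0, (s, -s), (t, -t)) (0, (s, -s), (t, -t)) := rfl
    rw [h1, ambientForm_apply]
    simp only [map_zero]
    have h2 : s ≠ 0 ∨ t ≠ 0 := by
      by_contra! h
      exact hst (by rw [h.1, h.2]; rfl)
    rcases h2 with h2 | h2
    · nlinarith [mul_pos hp' (mul_self_pos.2 h2), mul_self_nonneg t]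
    · nlinarith [mul_nonneg hp'.le (mul_self_nonneg s), mul_self_pos.2 h2]

lemma le_sigNeg (hp : 0 < p) (hA : IsE8Automorphism A) (hs : HasCycleShape A p m) :
    2 * m + 2 ≤ sigNeg (spanForm (ambientForm p) (latticeM A)) := by
  have hp' : (0 : ℚ) < p := by exact_mod_cast hp
  have h := finrank_le_sigPos (Q := -spanForm (ambientForm p) (latticeM A)) (negativeSpace A) ?_
  · simpa [Module.finrank_prod, finrank_span_fixedLattice hp hA hs] using h
  · rintro ⟨x, s, t⟩ hst
    have h1 : (-spanForm (ambientForm p) (latticeM A)) (negativeSpace A (x, s, t)) =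
        -ambientForm p ((x : Fin 8 → ℚ), (s, s), (t, t)) ((x : Fin 8 → ℚ), (s, s), (t, t)) := rfl
    rw [h1, ambientForm_apply]
    have hx := e8Form_self_nonneg (x : Fin 8 → ℚ)
    have hs := mul_nonneg hp'.le (mul_self_nonneg s)
    have ht := mul_self_nonneg t
    simp only
    by_cases h2 : s = 0
    · by_cases h3 : t = 0
      · have h4 : (x : Fin 8 → ℚ) ≠ 0 := by
          rintro h
          exact hst (by rw [h2, h3, Subtype.ext (a1 := x) (a2 := 0) h]; rfl)
        have := e8Form_self_pos h4
        nlinarith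
      · have := mul_self_pos.2 h3
        nlinarith
    · have := mul_pos hp' (mul_self_pos.2 h2)
      nlinarith

/-- The positive plane and the negative space give lower bounds 2 and `2m + 2`, which already
exhaust the dimension. -/
lemma signature_latticeM (hp : 0 < p) (hA : IsE8Automorphism A) (hs : HasCycleShape A p m) :
    sigPos (spanForm (ambientForm p) (latticeM A)) = 2 ∧
      sigNeg (spanForm (ambientForm p) (latticeM A)) = 2 * m + 2 := by
  have h1 := two_le_sigPos (A := A) hp
  have h2 := le_sigNeg hp hA hs
  have h3 := finrank_span_latticeM_le hp hA hs
  have h4 := QuadraticForm.sigPos_add_sigNeg_add_radical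
    (Q := spanForm (ambientForm p) (latticeM A))
  omega

end FakeMonster

end

open scoped Real

noncomputable section

namespace FakeMonster

variable {A : Matrix (Fin 8) (Fin 8) ℤ} {p m : ℕ}

/-! ### The components in terms of the decomposition of the discriminant group -/

/-- The floor loses nothing: the hypothesis makes `2p γ²/2` an integer. -/
lemma normIndex_eq (hp : 0 < p) {γ : DiscGroup (ambientForm p) (latticeM A)}
    (h : discEps (ambientForm p) (latticeM A) γ ^ (2 * p) = 1) :
    (normIndex p A γ : ℚ) =
      2 * p * Int.fract (discHalfNorm (ambientForm p) (latticeM A) γ) := by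
  have hp' : (0 : ℚ) < p := by exact_mod_cast hp
  rw [discEps, ← e_nat_mul, ← Rat.cast_natCast, ← Rat.cast_mul, e_rat_eq_one_iff] at h
  obtain ⟨n, hn⟩ := h
  set x := discHalfNorm (ambientForm p) (latticeM A) γ with hx
  push_cast at hn
  have h1 : 2 * p * Int.fract x = ((n - 2 * p * ⌊x⌋ : ℤ) : ℚ) := by
    push_cast; rw [← hn, Int.fract]; ring
  have h2 : 0 ≤ 2 * p * Int.fract x := by have := Int.fract_nonneg x; positivity
  obtain ⟨k, hk⟩ : ∃ k : ℕ, (n - 2 * p * ⌊x⌋ : ℤ) = k :=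
    Int.eq_ofNat_of_zero_le (by rw [h1] at h2; exact_mod_cast h2)
  rw [hk, Int.cast_natCast] at h1
  rw [normIndex, ← hx, h1, Nat.floor_natCast]

lemma normIndex_lt (hp : 0 < p) {γ : DiscGroup (ambientForm p) (latticeM A)}
    (h : discEps (ambientForm p) (latticeM A) γ ^ (2 * p) = 1) : normIndex p A γ < 2 * p := by
  have hp' : (0 : ℚ) < p := by exact_mod_cast hp
  have h1 := normIndex_eq hp h
  have h2 := Int.fract_lt_one (discHalfNorm (ambientForm p) (latticeM A) γ)
  have h3 : (normIndex p A γ : ℚ) < (2 * p : ℕ) := by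
    rw [h1]; push_cast; exact mul_lt_of_lt_one_right (by positivity) h2
  exact_mod_cast h3

lemma e_normIndex (hp : 0 < p) {γ : DiscGroup (ambientForm p) (latticeM A)}
    (h : discEps (ambientForm p) (latticeM A) γ ^ (2 * p) = 1) :
    e (normIndex p A γ / (2 * p)) = discEps (ambientForm p) (latticeM A) γ := by
  have hp' : (2 * p : ℚ) ≠ 0 := by positivity
  have h1 := normIndex_eq hp h
  have h2 : (normIndex p A γ / (2 * p) : ℂ) = ((normIndex p A γ / (2 * p) : ℚ) : ℂ) := by
    push_cast; rfl
  rw [h2, discEps]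
  refine e_eq_of_sub_eq ⟨-⌊discHalfNorm (ambientForm p) (latticeM A) γ⌋, ?_⟩
  rw [h1, Int.fract]
  field_simp
  push_cast
  ring

lemma eq_zero_of_e_div_eq_one (hp : 0 < p) {j : ℕ} (hj : j < 2 * p) (h : e (j / (2 * p)) = 1) :
    j = 0 := by
  have hp' : (2 * p : ℂ) ≠ 0 := by simp [hp.ne']
  obtain ⟨n, hn⟩ := e_eq_one_iff.1 h
  rw [div_eq_iff hp'] at hn
  have h1 : (j : ℤ) = n * (2 * p : ℕ) := by exact_mod_cast hn
  have h2 : 2 * p ∣ j := Int.natCast_dvd_natCast.1 ⟨n, by rw [h1, mul_comm]⟩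
  exact Nat.eq_zero_of_dvd_of_lt h2 hj

lemma eq_of_e_div_eq_neg_one (hp : 0 < p) {j : ℕ} (hj : j < 2 * p) (h : e (j / (2 * p)) = -1) :
    j = p := by
  have hp' : (p : ℂ) ≠ 0 := by exact_mod_cast hp.ne'
  have h1 : e ((j + p : ℕ) / (2 * p)) = 1 := by
    rw [Nat.cast_add, add_div, e_add, h, show (p : ℂ) / (2 * p) = 1 / 2 by field_simp, e_half]
    norm_num
  rcases lt_or_ge j p with hlt | hge
  · have := eq_zero_of_e_div_eq_one hp (by omega) h1
    omega
  · have h2 : e ((j - p : ℕ) / (2 * p)) = 1 := by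
      rw [← h1, ← e_add_intCast _ 1]
      congr 1
      push_cast [hge]
      field_simp
      ring
    have := eq_zero_of_e_div_eq_one hp (by omega) h2
    omega

lemma component_congr_sq {X : ℂ → ℂ} {ε ε' : ℂ} (h : ε ^ 2 = ε' ^ 2) (τ : ℂ) :
    component p X ε τ = component p X ε' τ := by
  simp only [component, pow_mul, h]

lemma component_xFun_eq_neg {a : ZMod 2 × ZMod 2} (h0 : a ≠ 0) (h1 : a ≠ (1, 1)) (ε τ : ℂ) :
    component p (xFun p m a) ε τ = -component p (xFun p m 0) ε τ := by
  simp only [component, xFun_eq_neg h0 h1, mul_neg, Finset.sum_neg_distrib, neg_div]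

lemma planeEps_sq (a : ZMod 2 × ZMod 2) : planeEps a ^ 2 = 1 := by
  rw [planeEps]; split_ifs <;> norm_num

lemma planeEps_pow (hodd : Odd p) (a : ZMod 2 × ZMod 2) : planeEps a ^ p = planeEps a := by
  rw [planeEps]; split_ifs
  · exact hodd.neg_one_pow
  · exact one_pow p

lemma odd_iff_of_neg_one_pow {j : ℕ} {a : ZMod 2 × ZMod 2} (h : (-1) ^ j = planeEps a) :
    Odd j ↔ a = (1, 1) := by
  rw [planeEps] at h
  constructor
  · intro hj
    by_contra ha
    rw [if_neg ha, hj.neg_one_pow] at h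
    norm_num at h
  · rintro rfl
    by_contra hj
    rw [if_pos rfl, (Nat.not_odd_iff_even.1 hj).neg_one_pow] at h
    norm_num at h

lemma addOrderOf_plane {a : ZMod 2 × ZMod 2} (ha : a ≠ 0) : addOrderOf a = 2 := by
  have : Fact (Nat.Prime 2) := ⟨Nat.prime_two⟩
  exact addOrderOf_eq_prime (by revert a; decide) ha

lemma nsmul_oddPart [NeZero p] (hA : IsE8Automorphism A) (hs : HasCycleShape A p m)
    (b : FixedDisc A × (ZMod p × ZMod p)) : p • b = 0 := by
  ext
  · exact fixedDisc_nsmul hA hs b.1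
  · simp
  · simp

/-- For a pair `(a, b)` the six cases combine `a = 0`, `a = (1, 1)` or another `a` with `b = 0` or
`b ≠ 0`. The order of `γ` is the least common multiple of the orders of `a` and `b`, and the parity
of the norm index detects `a = (1, 1)`. -/
lemma superF_eq [DecidableEq (FixedDisc A)] [NeZero p] (hp : p.Prime) (hpm : m * (p + 1) = 8)
    (hA : IsE8Automorphism A) (hs : HasCycleShape A p m) {r : ℕ} (hr : p = 2 * r + 1)
    (hu : IsUnit (r : ZMod p)) (hodd : Odd p) (γ : DiscGroup (ambientForm p) (latticeM A)) {τ : ℂ}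
    (hτ : 0 < τ.im) :
    superF p m A γ τ =
      vectorForm p m (oddEps A p r) (discEquiv A hodd γ).1 (discEquiv A hodd γ).2 τ := by
  have hQ := odd_isQuadraticCharacter hu hA hs
  have heps := discEps_discEquiv hr hodd γ
  have hγ0 : γ = 0 ↔ (discEquiv A hodd γ).1 = 0 ∧ (discEquiv A hodd γ).2 = 0 := by
    rw [← EmbeddingLike.map_eq_zero_iff (f := discEquiv A hodd), Prod.ext_iff]; rfl
  have hord : addOrderOf γ = Nat.lcm (addOrderOf (discEquiv A hodd γ).1)
      (addOrderOf (discEquiv A hodd γ).2) := by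
    rw [← addOrderOf_injective (discEquiv A hodd).toAddMonoidHom (discEquiv A hodd).injective γ]
    exact Prod.addOrderOf _
  generalize (discEquiv A hodd γ).1 = a at *
  generalize (discEquiv A hodd γ).2 = b at *
  have hbp := oddEps_pow (r := r) hodd hA hs b
  have hpow : discEps (ambientForm p) (latticeM A) γ ^ (2 * p) = 1 := by
    rw [heps, mul_pow, pow_mul, planeEps_sq, one_pow, mul_comm 2 p, pow_mul, hbp]
    norm_num
  have hlt := normIndex_lt hp.pos hpow
  have he := e_normIndex hp.pos hpow
  rw [heps] at he
  have hpar : Odd (normIndex p A γ) ↔ a = (1, 1) := by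
    apply odd_iff_of_neg_one_pow
    rw [← e_div_pow hp.pos, he, mul_pow, planeEps_pow hodd, hbp, mul_one]
  -- The root of unity of `γ` differs from that of `b` by a sign, which a component does not see.
  have hsq : e (normIndex p A γ / (2 * p)) ^ 2 = oddEps A p r b ^ 2 := by
    rw [he, mul_pow, planeEps_sq, one_mul]
  have h1p : p ≠ 1 := hp.ne_one
  have hp2 : p ≠ 2 := by rintro rfl; exact absurd hodd (by decide)
  have hp0 := hp.pos
  rw [superF, vectorForm]
  generalize normIndex p A γ = j at *
  by_cases hb : b = 0
  · rw [hb, hQ.eps_zero, mul_one] at he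
    rw [hb, addOrderOf_zero, Nat.lcm_one_right] at hord
    simp only [hb, if_true, hQ.eps_zero]
    rw [hb, hQ.eps_zero] at hsq
    by_cases ha : a = 0
    · rw [if_pos (hγ0.2 ⟨ha, hb⟩), ha, f_eq_xFun hp hpm, g_eq hp hpm (by decide) hτ]
      simp [e_zero]
    · rw [if_neg fun h => ha (hγ0.1 h).1]
      rw [addOrderOf_plane ha] at hord
      by_cases ha1 : a = (1, 1)
      · have hj : j = p := eq_of_e_div_eq_neg_one hp.pos hlt (by rw [he, planeEps, if_pos ha1])
        rw [hj] at hsq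
        rw [if_neg (by omega), if_pos ⟨hord, hj⟩, ha1, delta_eq_xFun hp hpm, lam_eq hp hpm,
          component_congr_sq hsq]
      · have hj : j = 0 := eq_zero_of_e_div_eq_one hp.pos hlt (by rw [he, planeEps, if_neg ha1])
        rw [if_pos ⟨hord, hj⟩, xFun_eq_neg ha ha1, component_xFun_eq_neg ha ha1,
          f_eq_xFun hp hpm, g_eq hp hpm (by decide) hτ]
        simp [sub_eq_add_neg, e_zero]
  · have : Fact p.Prime := ⟨hp⟩
    rw [addOrderOf_eq_prime (nsmul_oddPart hA hs b) hb] at hord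
    simp only [if_neg hb, zero_add]
    rw [if_neg fun h => hb (hγ0.1 h).2]
    by_cases ha : a = 0
    · rw [ha, addOrderOf_zero, Nat.lcm_one_left] at hord
      have hj : Even j := by rw [← Nat.not_odd_iff_even, hpar, ha]; decide
      rw [if_neg (by omega), if_neg (by omega), if_neg (by omega), if_pos ⟨hord, hj⟩,
        g_eq hp hpm hj hτ, component_congr_sq hsq, ha]
    · rw [addOrderOf_plane ha, Nat.Coprime.lcm_eq_mul ((Nat.coprime_two_left).2 hodd)] at hord
      rw [if_neg (by omega), if_neg (by omega)]
      by_cases ha1 : a = (1, 1)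
      · rw [if_pos ⟨hord, hpar.2 ha1⟩, lam_eq hp hpm, component_congr_sq hsq, ha1]
      · have hj : Even j := by rw [← Nat.not_odd_iff_even, hpar]; exact ha1
        rw [if_neg fun h => ha1 (hpar.1 h.2), if_neg (by omega), if_pos ⟨hord, hj⟩,
          g_eq hp hpm hj hτ, component_congr_sq hsq, component_xFun_eq_neg ha ha1]

lemma isHolomorphicMeromorphicAtCusp_congr {φ ψ : ℂ → ℂ} (h : IsHolomorphicMeromorphicAtCusp φ)
    (hφ : ∀ τ : ℂ, 0 < τ.im → ψ τ = φ τ) : IsHolomorphicMeromorphicAtCusp ψ := by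
  obtain ⟨hd, N, a, n₀, hN, ha, hs⟩ := h
  exact ⟨hd.congr fun τ hτ => hφ τ hτ, N, a, n₀, hN, ha,
    fun τ hτ => by rw [hφ τ hτ]; exact hs τ hτ⟩

/-! ### Modularity -/

lemma exp_pi_div_four_zpow (m : ℕ) :
    Complex.exp (π * Complex.I / 4) ^ (((2 * m + 2 : ℕ) : ℤ) - ((2 : ℕ) : ℤ)) = Complex.I ^ m := by
  have h1 : Complex.exp (π * Complex.I / 4) ^ 2 = Complex.I := by
    rw [← Complex.exp_nat_mul,
      show ((2 : ℕ) : ℂ) * (π * Complex.I / 4) = π / 2 * Complex.I by push_cast; ring,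
      Complex.exp_pi_div_two_mul_I]
  rw [show ((2 * m + 2 : ℕ) : ℤ) - ((2 : ℕ) : ℤ) = ((2 * m : ℕ) : ℤ) by push_cast; ring,
    zpow_natCast, pow_mul, h1]

lemma planeBeta_inv (a b : ZMod 2 × ZMod 2) : (planeBeta a b)⁻¹ = planeBeta a b := by
  rw [planeBeta]; split_ifs <;> norm_num

lemma e_neg_discPair {r : ℕ} [NeZero p] (hr : p = 2 * r + 1) (hodd : Odd p)
    (h : IsQuadraticCharacter (oddEps A p r) (oddBeta A p r))
    (γ δ : DiscGroup (ambientForm p) (latticeM A)) :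
    e (-(discPair (ambientForm p) (latticeM A) γ δ : ℚ)) =
      planeBeta (discEquiv A hodd γ).1 (discEquiv A hodd δ).1 *
        (oddBeta A p r (discEquiv A hodd γ).2 (discEquiv A hodd δ).2)⁻¹ := by
  rw [e_neg]
  have := discBeta_discEquiv hr hodd h γ δ
  rw [discBeta] at this
  rw [this, mul_inv, planeBeta_inv]

lemma sqrt_natCast_pow (k : ℕ) : Real.sqrt ((4 * p ^ k : ℕ) : ℝ) = 2 * Real.sqrt p ^ k := by
  rw [show ((4 * p ^ k : ℕ) : ℝ) = (2 * Real.sqrt p ^ k) ^ 2 by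
    rw [mul_pow, ← pow_mul, mul_comm k, pow_mul, Real.sq_sqrt (by positivity)]
    push_cast
    norm_num]
  exact Real.sqrt_sq (by positivity)

theorem superF_isModularFormOfType (hp : p.Prime) (hpm : m * (p + 1) = 8)
    (hA : IsE8Automorphism A) (hs : HasCycleShape A p m) :
    IsModularFormOfType (ambientForm p) (latticeM A) (-m) (superF p m A) ∧
      ∀ γ, IsHolomorphicMeromorphicAtCusp (superF p m A γ) := by
  classical
  have hodd := odd_of_pair hp hpm
  obtain ⟨r, hr⟩ := id hodd
  have : NeZero p := ⟨hp.ne_zero⟩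
  have : Fact p.Prime := ⟨hp⟩
  have hu : IsUnit (r : ZMod p) := by
    rw [isUnit_iff_ne_zero, Ne, ZMod.natCast_eq_zero_iff]
    intro h
    have h1 : 0 < r := by have := hp.two_le; omega
    have := Nat.le_of_dvd h1 h
    omega
  have hQ := odd_isQuadraticCharacter hu hA hs
  have hexp := oddEps_pow (r := r) hodd hA hs
  have hfin : Finite (FixedDisc A) := Nat.finite_of_card_ne_zero (by
    rw [card_fixedDisc_eq hp hpm hA hs]; exact pow_ne_zero _ hp.ne_zero)
  have := Fintype.ofFinite (FixedDisc A)
  have hcard := card_odd hp hpm hA hs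
  refine ⟨⟨Finite.of_equiv _ (discEquiv A hodd).symm.toEquiv, fun γ τ hτ => ?_,
    fun γ τ hτ => ?_⟩, fun γ => ?_⟩
  · rw [superF_eq hp hpm hA hs hr hu hodd γ (by simpa using hτ),
      superF_eq hp hpm hA hs hr hu hodd γ hτ, vectorForm_add_one hp hpm hQ.eps_zero hexp _ _ hτ]
    have h := discEps_discEquiv hr hodd γ
    rw [discEps, planeEps] at h
    rw [h]
  · have h0 := im_neg_one_div hτ
    have := Fintype.ofEquiv _ (discEquiv A hodd).symm.toEquiv
    rw [superF_eq hp hpm hA hs hr hu hodd γ h0, (signature_latticeM hp.pos hA hs).1,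
      (signature_latticeM hp.pos hA hs).2, exp_pi_div_four_zpow, card_discGroup_latticeM hodd, hcard,
      sqrt_natCast_pow, finsum_eq_sum_of_fintype, zpow_neg, zpow_natCast,
      vectorForm_neg_one_div hp hpm hQ hexp (by rw [← Nat.card_eq_fintype_card, hcard])
        (fun l hl => odd_gauss hp hpm hA hs hu hl) _ _ hτ]
    push_cast
    congr 1
    rw [← Fintype.sum_prod_type' (f := fun a' b' => planeBeta (discEquiv A hodd γ).1 a' *
      (oddBeta A p r (discEquiv A hodd γ).2 b')⁻¹ * vectorForm p m (oddEps A p r) a' b' τ)]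
    refine (Fintype.sum_equiv (discEquiv A hodd).toEquiv _ _ fun δ => ?_).symm
    rw [e_neg_discPair hr hodd hQ, superF_eq hp hpm hA hs hr hu hodd δ hτ]
    rfl
  · exact isHolomorphicMeromorphicAtCusp_congr
      (vectorForm_isHolomorphic hp hpm hQ.eps_zero hexp _ _)
      fun τ hτ => superF_eq hp hpm hA hs hr hu hodd γ hτ

/-! ### The case of the identity -/

lemma isE8Automorphism_one : IsE8Automorphism 1 := by simp [IsE8Automorphism]

/-- The identity has shape `1⁴ 1⁴`, so the results on the lattice apply with `p = 1`, `m = 4`, `r =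
0`, although 1 is not prime. -/
lemma hasCycleShape_one : HasCycleShape 1 1 4 := by
  rw [HasCycleShape, Matrix.charpoly_one, pow_one, ← pow_add]
  simp

lemma oddPart_subsingleton :
    Subsingleton (FixedDisc (1 : Matrix (Fin 8) (Fin 8) ℤ) × (ZMod 1 × ZMod 1)) :=
  ⟨fun a b => by
    rw [← one_nsmul a, ← one_nsmul b, nsmul_oddPart isE8Automorphism_one hasCycleShape_one,
      nsmul_oddPart isE8Automorphism_one hasCycleShape_one]⟩

lemma superFOne_eq (γ : DiscGroup (ambientForm 1) (latticeM 1)) :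
    superFOne γ = xFun 1 4 (discEquiv 1 odd_one γ).1 := by
  have := oddPart_subsingleton
  have hQ := odd_isQuadraticCharacter (r := 0) (isUnit_of_subsingleton _) isE8Automorphism_one
    hasCycleShape_one
  have heps := discEps_discEquiv (p := 1) (r := 0) rfl odd_one γ
  have hγ0 : γ = 0 ↔ (discEquiv 1 odd_one γ).1 = 0 := by
    rw [← EmbeddingLike.map_eq_zero_iff (f := discEquiv 1 odd_one), Prod.ext_iff]
    exact and_iff_left (Subsingleton.elim _ _)
  rw [Subsingleton.elim (discEquiv 1 odd_one γ).2 0, hQ.eps_zero, mul_one] at heps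
  generalize (discEquiv 1 odd_one γ).1 = a at *
  have hpow : discEps (ambientForm 1) (latticeM 1) γ ^ (2 * 1) = 1 := by rw [heps, planeEps_sq]
  have hlt := normIndex_lt one_pos hpow
  have he := e_normIndex one_pos hpow
  ext τ
  rw [superFOne]
  by_cases ha : a = 0
  · rw [if_pos (hγ0.2 ha), ha, fOne_eq_xFun]
  · rw [if_neg fun h => ha (hγ0.1 h)]
    by_cases ha1 : a = (1, 1)
    · have hj := eq_of_e_div_eq_neg_one one_pos hlt (by rw [he, heps, planeEps, if_pos ha1])
      rw [if_neg (by omega), ha1, deltaOne_eq_xFun]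
    · have hj := eq_zero_of_e_div_eq_one one_pos hlt (by rw [he, heps, planeEps, if_neg ha1])
      rw [if_pos hj, xFun_eq_neg ha ha1, fOne_eq_xFun]

/-- With trivial `p`-part no averaging is needed: `S` is the Fricke involution for `p = 1`, matched
by `sum_planeBeta_xFun`. -/
theorem superFOne_isModularFormOfType :
    IsModularFormOfType (ambientForm 1) (latticeM 1) (-4) superFOne ∧
      ∀ γ, IsHolomorphicMeromorphicAtCusp (superFOne γ) := by
  classical
  have := oddPart_subsingleton
  have hQ := odd_isQuadraticCharacter (r := 0) (isUnit_of_subsingleton _) isE8Automorphism_one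
    hasCycleShape_one
  have := Fintype.ofFinite (FixedDisc (1 : Matrix (Fin 8) (Fin 8) ℤ) × (ZMod 1 × ZMod 1))
  have hT : ∀ γ (τ : ℂ), 0 < τ.im → superFOne γ (τ + 1) =
      e (discHalfNorm (ambientForm 1) (latticeM 1) γ : ℚ) * superFOne γ τ := by
    intro γ τ hτ
    rw [superFOne_eq, xFun_add_one one_pos (by norm_num) _ hτ]
    have h := discEps_discEquiv (r := 0) rfl odd_one γ
    rw [discEps, planeEps, Subsingleton.elim (discEquiv 1 odd_one γ).2 0, hQ.eps_zero,
      mul_one] at h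
    rw [h]
  have hbeta : ∀ b c, oddBeta 1 1 0 b c = 1 := fun b c => by
    rw [Subsingleton.elim b 0, hQ.zero_beta]
  refine ⟨⟨Finite.of_equiv _ (discEquiv 1 odd_one).symm.toEquiv, hT, fun γ τ hτ => ?_⟩,
    fun γ => ?_⟩
  · have := Fintype.ofEquiv _ (discEquiv (1 : Matrix (Fin 8) (Fin 8) ℤ) odd_one).symm.toEquiv
    have := uniqueOfSubsingleton
      (0 : FixedDisc (1 : Matrix (Fin 8) (Fin 8) ℤ) × (ZMod 1 × ZMod 1))
    have hsum : ∑ δ, e (-(discPair (ambientForm 1) (latticeM 1) γ δ : ℚ)) * superFOne δ τ =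
        2 * zFun 1 4 (discEquiv 1 odd_one γ).1 τ := by
      rw [← sum_planeBeta_xFun]
      refine Fintype.sum_equiv ((discEquiv 1 odd_one).toEquiv.trans
        (Equiv.prodUnique _ _)) _ _ fun δ => ?_
      rw [e_neg_discPair (r := 0) rfl odd_one hQ, hbeta, superFOne_eq]
      simp
    have hcard : Nat.card (FixedDisc (1 : Matrix (Fin 8) (Fin 8) ℤ) × (ZMod 1 × ZMod 1)) = 1 :=
      Nat.card_unique
    rw [(signature_latticeM one_pos isE8Automorphism_one hasCycleShape_one).1,
      (signature_latticeM one_pos isE8Automorphism_one hasCycleShape_one).2, exp_pi_div_four_zpow,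
      card_discGroup_latticeM odd_one, hcard, finsum_eq_sum_of_fintype, hsum, superFOne_eq,
      xFun_neg_one_div one_pos _ hτ]
    have h4 := sqrt_natCast_pow (p := 1) 0
    simp only [pow_zero, mul_one] at h4 ⊢
    rw [h4, show (-4 : ℤ) = -((4 : ℕ) : ℤ) by norm_num, zpow_neg, zpow_natCast]
    simp
    ring
  · rw [superFOne_eq]
    refine isHolomorphicMeromorphicAtCusp_of_expGrowth (N := 2) (K := π) two_pos
      (xFun_differentiableOn one_pos _) (fun τ hτ => ?_) (expGrowth_xFun one_pos (by norm_num) _)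
    have h1 : 0 < (τ + 1).im := by simpa using hτ
    rw [show τ + (2 : ℕ) = τ + 1 + 1 by push_cast; ring, xFun_add_one one_pos (by norm_num) _ h1,
      xFun_add_one one_pos (by norm_num) _ hτ]
    split_ifs <;> ring

end FakeMonster

end

/-! ### Assembly of the proposition. -/

theorem mainTheorem5 :
    (∀ (p m : ℕ) (A : Matrix (Fin 8) (Fin 8) ℤ), p.Prime → m * (p + 1) = 8 →
      FakeMonster.IsE8Automorphism A → FakeMonster.HasCycleShape A p m →
      -- supersymmetry: `δ` has only half-integral exponents
      FakeMonster.HasExpansionMod (1 / 2) (FakeMonster.delta p m) ∧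
      -- the decompositions of `f(τ/p)` and `δ(τ/p)`
      (∀ τ : ℂ, 0 < τ.im →
        FakeMonster.f p m (τ / p) = ∑ j ∈ Finset.range (2 * p) with Even j, FakeMonster.g p m j τ) ∧
      (∀ τ : ℂ, 0 < τ.im →
        FakeMonster.delta p m (τ / p) =
          ∑ j ∈ Finset.range (2 * p) with Odd j, FakeMonster.lam p m j τ) ∧
      (∀ j < 2 * p, Even j →
        FakeMonster.HasExpansionMod ((j : ℚ) / (2 * p)) (FakeMonster.g p m j)) ∧
      (∀ j < 2 * p, Odd j →
        FakeMonster.HasExpansionMod ((j : ℚ) / (2 * p)) (FakeMonster.lam p m j)) ∧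
      -- `F` is a modular form of weight `-m` and representation `ρ_M`
      FakeMonster.IsModularFormOfType (FakeMonster.ambientForm p) (FakeMonster.latticeM A) (-m)
        (FakeMonster.superF p m A) ∧
      ∀ γ, FakeMonster.IsHolomorphicMeromorphicAtCusp (FakeMonster.superF p m A γ)) ∧
    -- the case `p = 1`
    (FakeMonster.HasExpansionMod (1 / 2) FakeMonster.deltaOne ∧
      FakeMonster.IsModularFormOfType (FakeMonster.ambientForm 1) (FakeMonster.latticeM 1) (-4)
        FakeMonster.superFOne ∧
      ∀ γ, FakeMonster.IsHolomorphicMeromorphicAtCusp (FakeMonster.superFOne γ)) := by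
  refine ⟨fun p m A hp hpm hA hs => ?_, FakeMonster.deltaOne_hasExpansionMod,
    FakeMonster.superFOne_isModularFormOfType⟩
  exact ⟨FakeMonster.delta_hasExpansionMod hp hpm, fun τ _ => FakeMonster.f_div_eq_sum hp τ,
    fun τ _ => FakeMonster.delta_div_eq_sum hp hpm τ,
    fun j _ hj => FakeMonster.g_hasExpansionMod hp hpm hj,
    fun j _ hj => FakeMonster.lam_hasExpansionMod hp hpm hj,
    FakeMonster.superF_isModularFormOfType hp hpm hA hs⟩
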